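/- Let $n\ge 5$ and $k\ge n+2$, and consider $k$ qubits $q_1,\dots,q_k$ arranged on a line, where two-qubit gates may act only on neighboring qubits $q_l,q_{l+1}$ (linear-nearest-neighbor, LNN, connectivity). Let $C$ be any set of $n$ of these qubits and let $t$ be any of the $k$ qubits not in $C$ (so the controls, the target and the remaining $k-n-1\ge 1$ qubits may occur along the line in any order). Then the multi-controlled $X$ gate with control set $C$ and target $t$, i.e. the unitary on all $k$ qubits that applies $X=\begin{pmatrix}0&1\\1&0\end{pmatrix}$ to $t$ if all qubits in $C$ are in the state $|1\rangle$, and otherwise acts as the identity (in particular, the remaining qubits, which may be in an arbitrary state, are returned unchanged), is exactly equal to the unitary of a circuit on these $k$ qubits that consists only of the gates $H=\frac1{\sqrt2}\begin{pmatrix}1&1\\1&-1\end{pmatrix}$, $T=\begin{pmatrix}1&0\\0&e^{i\pi/4}\end{pmatrix}$, $T^\dagger$, and CNOT gates acting on neighboring qubits (with either of the two as the control), and that uses no more than - $8k+14n-34$ CNOT gates, in CNOT depth at most $8k+5n+1$, - $16n-16$ $T$ gates, in $T$ depth at most $4n+4$, - $8n+4$ $H$ gates, in $H$ depth at most $4n+3$.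 Here both $T$ and $T^\dagger$ count as $T$ gates. A circuit is a sequence of time slots, each of which holds gates acting on pairwise disjoint sets of qubits, and the CNOT (respectively $T$, $H$) depth of the circuit is the number of its time slots that hold at least one CNOT (respectively $T$ or $T^\dagger$, $H$) gate. All six bounds hold for one and the same circuit. -/

import Mathlib

namespace LNN

noncomputable section

/-- The Pauli `X` gate. -/
def pauliX : Matrix (Fin 2) (Fin 2) ℂ := !![0, 1; 1, 0]

/-- The Hadamard gate. -/
def hadamard : Matrix (Fin 2) (Fin 2) ℂ :=
  ((Real.sqrt 2 : ℝ) : ℂ)⁻¹ • !![1, 1; 1, -1]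

/-- The phase gate `P(φ) = diag(1, exp(iφ))`. -/
def phase (φ : ℝ) : Matrix (Fin 2) (Fin 2) ℂ :=
  !![1, 0; 0, Complex.exp (Complex.I * (φ : ℂ))]

/-- The computational basis states of `k` qubits. -/
abbrev Basis (k : ℕ) : Type := Fin k → Fin 2

/-- Operators on `k` qubits, written as matrices in the computational basis
(the entry `(x, y)` is `⟨x| A |y⟩`). -/
abbrev Op (k : ℕ) : Type := Matrix (Basis k) (Basis k) ℂ

/-- The single-qubit operator `U` applied to qubit `t`, controlled by the qubits in `C`
(for `t ∉ C`), and acting as the identity on all the remaining qubits: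
`U` is applied to `t` iff every qubit of `C` is in the state `1`. With `C = ∅` this is `U` acting
on qubit `t` alone. -/
def controlled {k : ℕ} (U : Matrix (Fin 2) (Fin 2) ℂ) (C : Finset (Fin k)) (t : Fin k) : Op k :=
  Matrix.of fun x y =>
    if ∀ j, j ≠ t → x j = y j then
      (if ∀ c ∈ C, y c = 1 then U (x t) (y t)
        else (1 : Matrix (Fin 2) (Fin 2) ℂ) (x t) (y t))
    else 0

/-- The multi-controlled `X` gate with control set `C` and target `t`, as an operator on all
`k` qubits of the register. -/
def mcx {k : ℕ} (C : Finset (Fin k)) (t : Fin k) : Op k := controlled pauliX C t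

/-- The elementary gates on a register of `k` qubits: `H`, `T`, `T†`, and `CNOT` (first argument the
control, second argument the target). -/
inductive Gate (k : ℕ) : Type
  | H (q : Fin k) : Gate k
  | T (q : Fin k) : Gate k
  | Tdag (q : Fin k) : Gate k
  | CNOT (c t : Fin k) : Gate k

namespace Gate

variable {k : ℕ}

/-- The operator of a gate. -/
def op : Gate k → Op k
  | H q => controlled hadamard ∅ q
  | T q => controlled (phase (Real.pi / 4)) ∅ q
  | Tdag q => controlled (phase (-(Real.pi / 4))) ∅ q
  | CNOT c t => controlled pauliX {c} t

/-- The qubits on which a gate acts. -/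
def qubits : Gate k → Finset (Fin k)
  | H q => {q}
  | T q => {q}
  | Tdag q => {q}
  | CNOT c t => {c, t}

/-- Linear-nearest-neighbor connectivity: a `CNOT` acts on two neighboring qubits of the line. -/
def NearestNeighbor : Gate k → Prop
  | H _ => True
  | T _ => True
  | Tdag _ => True
  | CNOT c t => c.val + 1 = t.val ∨ t.val + 1 = c.val

/-- Is the gate a `CNOT`? -/
def isCNOT : Gate k → Bool
  | CNOT _ _ => true
  | _ => false

/-- Is the gate a `T` gate (a `T` or its inverse `T†`)? -/
def isT : Gate k → Bool
  | T _ => true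
  | Tdag _ => true
  | _ => false

/-- Is the gate a Hadamard gate? -/
def isH : Gate k → Bool
  | H _ => true
  | _ => false

end Gate

/-- A circuit is the list, in order of execution, of its time slots; a time slot is a list
of gates, executed in parallel (see `Circuit.IsLNN`). -/
abbrev Circuit (k : ℕ) : Type := List (List (Gate k))

namespace Circuit

variable {k : ℕ}

/-- The circuit is a legal circuit in linear-nearest-neighbor connectivity: gates in the same
time slot act on disjoint sets of qubits, and every `CNOT` acts on neighboring qubits. -/
def IsLNN (c : Circuit k) : Prop :=
  ∀ slot ∈ c, slot.Pairwise (fun g h => Disjoint g.qubits h.qubits) ∧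
    ∀ g ∈ slot, g.NearestNeighbor

/-- The operator of a circuit: the product of the operators of its gates, the gates executed
first standing on the right. -/
def op (c : Circuit k) : Op k :=
  c.flatten.foldl (fun A g => g.op * A) 1

/-- The cost: the number of gates of the circuit of a given type. -/
def cost (p : Gate k → Bool) (c : Circuit k) : ℕ := c.flatten.countP p

/-- The depth: the number of time slots of the circuit which hold a gate of a given type. -/
def depth (p : Gate k → Bool) (c : Circuit k) : ℕ := c.countP (fun slot => slot.any p)

end Circuit

end

end LNN

/-!
The proof constructs a circuit for every position of the controls and the target on the line.

A multi-controlled `X` gate is a multi-controlled `Z` gate between two Hadamard gates on its target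
(`H_mul_mcz_mul_H`), and the latter is symmetric in the set `S` of all controls and the target. At
the price of two slots of Hadamard gates (`exchange_mcx`), the target is therefore the last qubit
`u` of `S`. A few `CNOT` gates arrange that the first control is followed by a qubit that is not a
control, a gap; where needed, the line is reflected (`realizable_of_zero_notMem`,
`realizable_of_both_ends`, `realizable_of_reflect`). The following qubits are runs of controls that
are separated by further gaps.

The main part, `core`, is a commutator. Let `K` be the head, which flips the first gap iff the first
control and the first two controls of the run after the gap are on. Let `κ` be a circuit, `carrier`,
that carries a difference along the line: if two basis states differ in the first gap only, then
after `κ` the qubit before `u` differs iff all remaining controls are on (`Carries`,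
`carries_carrier`). Let `M` be the `CNOT` gate from this qubit to `u`, conjugated by `κ`. Then
`M * K⁻¹ * M * K` flips `u` iff `κ` yields different bits before `u` from `y` and from `K y`, that is,
iff all controls are on (`isFlip_core`). As only differences matter, the gaps may be in arbitrary
states, and all other qubits and all phases are restored, because both `K` and `κ` are undone.

All parts are monomial operators, that is, they permute the basis states up to phases that are
eighth roots of unity (`Acts`). Those with Hadamard gates are brackets: a monomial circuit between
two Hadamard gates (`acts_bracket`). This makes relative-phase Toffoli gates available, and the
gadgets on at most five qubits can be verified by evaluation on basis states (`acts_headOne`,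
`acts_headTwo`, `carries_pairFast`, `carries_pairSlow`, `carries_finishOdd`). The carrier is
composed of these gadgets: within a run, it passes two controls at a time, using as storage two
controls that are already known to be on (`carries_tail`), and a head takes it across a gap
(`carries_headAll`).

For the bounds, consecutive gadgets overlap in time (`op_lead_rest`), the left parts of all heads
are executed at the same time, and those parts of the carrier that commute with `K` cancel between
the two occurrences of `M` (`op_core`). Costs and depths are then sums over the runs
(`cost_core_cnot`, `depth_core_cnot` and their analogues for `T` and `H`), and there are at most
`k - n - 2` gaps after the first (`realizable_of_runs`).
-/

namespace LNN

noncomputable section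

open Matrix

/-! ### Monomial operators -/

/-- The eighth root of unity `exp (iπ/4) ^ a`. -/
def ph (a : ZMod 8) : ℂ := Complex.exp (Complex.I * ((Real.pi / 4 : ℝ) : ℂ)) ^ a.val

lemma omega_pow_eight : Complex.exp (Complex.I * ((Real.pi / 4 : ℝ) : ℂ)) ^ 8 = 1 := by
  rw [← Complex.exp_nat_mul, Complex.exp_eq_one_iff]
  exact ⟨1, by push_cast; ring⟩

lemma omega_pow_four : Complex.exp (Complex.I * ((Real.pi / 4 : ℝ) : ℂ)) ^ 4 = -1 := by
  rw [← Complex.exp_nat_mul, ← Complex.exp_pi_mul_I]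
  congr 1; push_cast; ring

lemma ph_add (a b : ZMod 8) : ph (a + b) = ph a * ph b := by
  unfold ph
  rw [← pow_add, ZMod.val_add]
  conv_rhs => rw [← Nat.mod_add_div (a.val + b.val) 8, pow_add, pow_mul, omega_pow_eight, one_pow,
    mul_one]

@[simp] lemma ph_zero : ph 0 = 1 := by simp [ph]

lemma ph_one : ph 1 = Complex.exp (Complex.I * ((Real.pi / 4 : ℝ) : ℂ)) := by
  have : (1 : ZMod 8).val = 1 := rfl
  simp [ph, this]

lemma ph_four : ph 4 = -1 := by
  have : (4 : ZMod 8).val = 4 := rfl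
  rw [ph, this, omega_pow_four]

lemma ph_ne_zero (a : ZMod 8) : ph a ≠ 0 := pow_ne_zero _ (Complex.exp_ne_zero _)

lemma ph_neg_one : ph (-1) = Complex.exp (Complex.I * ((-(Real.pi / 4) : ℝ) : ℂ)) := by
  have h : ph (-1) * ph 1 = 1 := by rw [← ph_add]; simp
  rw [ph_one] at h
  rw [eq_comm, ← mul_left_inj' (Complex.exp_ne_zero (Complex.I * ((Real.pi / 4 : ℝ) : ℂ))), h,
    ← Complex.exp_add]
  push_cast
  rw [show Complex.I * -(Real.pi / 4 : ℂ) + Complex.I * (Real.pi / 4) = 0 by ring, Complex.exp_zero]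

/-- The basis vector of the register that belongs to the bit assignment `y`. -/
def ket {k : ℕ} (y : Basis k) : Basis k → ℂ := Pi.single y 1

lemma mulVec_ket {k : ℕ} (A : Op k) (y x : Basis k) : (A *ᵥ ket y) x = A x y := by
  simp [ket]

lemma op_ext {k : ℕ} {A B : Op k} (h : ∀ y, A *ᵥ ket y = B *ᵥ ket y) : A = B := by
  ext x y
  have := congrFun (h y) x
  rwa [mulVec_ket, mulVec_ket] at this

lemma ket_apply {k : ℕ} (y x : Basis k) : ket y x = if x = y then 1 else 0 := by
  simp [ket, Pi.single_apply]

lemma controlled_ket {k : ℕ} (U : Matrix (Fin 2) (Fin 2) ℂ) (C : Finset (Fin k)) (t : Fin k)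
    (y : Basis k) :
    controlled U C t *ᵥ ket y =
      ∑ b, (if ∀ c ∈ C, y c = 1 then U b (y t) else (1 : Matrix (Fin 2) (Fin 2) ℂ) b (y t)) •
        ket (Function.update y t b) := by
  ext x
  rw [mulVec_ket]
  simp only [Finset.sum_apply, Pi.smul_apply, ket_apply, smul_eq_mul, mul_ite, mul_one, mul_zero]
  simp only [controlled, Matrix.of_apply]
  by_cases h : ∀ j, j ≠ t → x j = y j
  · have hx : ∀ b, x = Function.update y t b ↔ b = x t := by
      intro b
      constructor
      · intro e; rw [e]; simp
      · rintro rfl; ext j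
        by_cases hj : j = t
        · subst hj; simp
        · simp [hj, h j hj]
    rw [if_pos h]
    simp [hx]
  · rw [if_neg h]
    symm
    apply Finset.sum_eq_zero
    intro b _
    rw [if_neg]
    rintro rfl
    exact h fun j hj => by simp [hj]

/-- Operators controlled by, and acting on, disjoint sets of qubits commute. -/
lemma controlled_commute {k : ℕ} (U U' : Matrix (Fin 2) (Fin 2) ℂ) (C C' : Finset (Fin k))
    (t t' : Fin k) (h1 : t ≠ t') (h2 : t ∉ C') (h3 : t' ∉ C) :
    controlled U C t * controlled U' C' t' = controlled U' C' t' * controlled U C t := by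
  apply op_ext
  intro y
  have a1 : ∀ b, (∀ c ∈ C, Function.update y t' b c = 1) ↔ ∀ c ∈ C, y c = 1 := by
    intro b
    refine forall₂_congr fun c hc => ?_
    rw [Function.update_of_ne (by rintro rfl; exact h3 hc)]
  have a2 : ∀ b, (∀ c ∈ C', Function.update y t b c = 1) ↔ ∀ c ∈ C', y c = 1 := by
    intro b
    refine forall₂_congr fun c hc => ?_
    rw [Function.update_of_ne (by rintro rfl; exact h2 hc)]
  simp only [← mulVec_mulVec, controlled_ket, Matrix.one_apply, mulVec_sum, mulVec_smul, Finset.smul_sum, a1, a2,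
    Function.update_of_ne h1, Function.update_of_ne h1.symm]
  rw [Finset.sum_comm]
  refine Finset.sum_congr rfl fun b _ => Finset.sum_congr rfl fun b' _ => ?_
  rw [smul_comm, Function.update_comm h1]

/-- The operator of a list of gates, the first gate of the list being executed first. -/
def ev {k : ℕ} (l : List (Gate k)) : Op k := l.foldl (fun A g => g.op * A) 1

lemma foldl_op {k : ℕ} (l : List (Gate k)) (B : Op k) :
    l.foldl (fun A g => g.op * A) B = ev l * B := by
  induction l generalizing B with
  | nil => simp [ev]
  | cons g l ih => rw [List.foldl_cons, ih, show ev (g :: l) = l.foldl (fun A g => g.op * A) (g.op * 1) from rfl,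
      ih (g.op * 1), ← mul_assoc, mul_one]

@[simp] lemma ev_nil {k : ℕ} : ev ([] : List (Gate k)) = 1 := rfl

lemma ev_cons {k : ℕ} (g : Gate k) (l : List (Gate k)) : ev (g :: l) = ev l * g.op := by
  rw [ev, List.foldl_cons, foldl_op]; simp

lemma ev_append {k : ℕ} (l l' : List (Gate k)) : ev (l ++ l') = ev l' * ev l := by
  rw [ev, List.foldl_append, foldl_op, foldl_op]; simp

lemma op_eq_ev {k : ℕ} (c : Circuit k) : c.op = ev c.flatten := rfl

lemma Gate.op_commute {k : ℕ} {g h : Gate k} (hd : Disjoint g.qubits h.qubits) :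
    g.op * h.op = h.op * g.op := by
  cases g <;> cases h <;> simp only [Gate.qubits, Finset.disjoint_left, Finset.mem_insert,
    Finset.mem_singleton, forall_eq_or_imp, forall_eq] at hd <;> apply controlled_commute <;>
    simp_all [eq_comm]

lemma ev_commute {k : ℕ} {l l' : List (Gate k)}
    (h : ∀ g ∈ l, ∀ g' ∈ l', Disjoint g.qubits g'.qubits) : ev l * ev l' = ev l' * ev l := by
  have one : ∀ (g : Gate k), (∀ g' ∈ l', Disjoint g.qubits g'.qubits) →
      g.op * ev l' = ev l' * g.op := by
    intro g
    clear h
    induction l' with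
    | nil => simp
    | cons a l' ih =>
      intro hg
      rw [ev_cons, ← mul_assoc, ih fun x hx => hg x (by simp [hx]), mul_assoc,
        Gate.op_commute (hg a (by simp)), mul_assoc]
  induction l with
  | nil => simp
  | cons a l ih =>
    rw [ev_cons, mul_assoc, one a fun x hx => h a (by simp) x hx, ← mul_assoc,
      ih fun g hg => h g (by simp [hg]), mul_assoc]

/-- `A` maps every basis vector `y` to the basis vector `π y`, up to the phase `exp (iπ/4) ^ φ y`.
-/
def Acts {k : ℕ} (A : Op k) (π : Basis k → Basis k) (φ : Basis k → ZMod 8) : Prop :=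
  ∀ y, A *ᵥ ket y = ph (φ y) • ket (π y)

lemma Acts.comp {k : ℕ} {A B : Op k} {π ρ : Basis k → Basis k} {φ ψ : Basis k → ZMod 8}
    (hA : Acts A π φ) (hB : Acts B ρ ψ) : Acts (A * B) (π ∘ ρ) (fun y => ψ y + φ (ρ y)) := by
  intro y
  rw [← mulVec_mulVec, hB y, mulVec_smul, hA, smul_smul, ph_add]; rfl

lemma Acts.unique {k : ℕ} {A B : Op k} {π : Basis k → Basis k} {φ : Basis k → ZMod 8}
    (hA : Acts A π φ) (hB : Acts B π φ) : A = B := op_ext fun y => by rw [hA y, hB y]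

lemma acts_one {k : ℕ} : Acts (1 : Op k) id (fun _ => 0) := by intro y; simp

lemma acts_T {k : ℕ} (q : Fin k) :
    Acts (Gate.T q).op id (fun y => if y q = 1 then 1 else 0) := by
  intro y
  rw [Gate.op, controlled_ket, Fin.sum_univ_two]
  have e := Function.update_eq_self q y
  rcases Fin.exists_fin_two.mp ⟨y q, rfl⟩ with h | h <;> rw [h] at e <;>
    simp [h, phase, ph_one, e]

lemma acts_Tdag {k : ℕ} (q : Fin k) :
    Acts (Gate.Tdag q).op id (fun y => if y q = 1 then -1 else 0) := by
  intro y
  rw [Gate.op, controlled_ket, Fin.sum_univ_two]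
  have e := Function.update_eq_self q y
  rcases Fin.exists_fin_two.mp ⟨y q, rfl⟩ with h | h <;> rw [h] at e <;>
    simp [h, phase, ph_neg_one, e]

lemma acts_CNOT {k : ℕ} (c t : Fin k) :
    Acts (Gate.CNOT c t).op (fun y => Function.update y t (y t + y c)) (fun _ => 0) := by
  intro y
  rw [Gate.op, controlled_ket, Fin.sum_univ_two]
  rcases Fin.exists_fin_two.mp ⟨y c, rfl⟩ with h | h <;>
  rcases Fin.exists_fin_two.mp ⟨y t, rfl⟩ with h' | h' <;>
    simp [h, h', pauliX, Matrix.one_apply]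

lemma H_ket {k : ℕ} (q : Fin k) (y : Basis k) :
    (Gate.H q).op *ᵥ ket y = ((Real.sqrt 2 : ℝ) : ℂ)⁻¹ • (ket (Function.update y q 0) +
      ph (if y q = 1 then 4 else 0) • ket (Function.update y q 1)) := by
  rw [Gate.op, controlled_ket, Fin.sum_univ_two]
  rcases Fin.exists_fin_two.mp ⟨y q, rfl⟩ with h | h <;>
    simp [h, hadamard, ph_four, smul_add]

/-! ### Hadamard brackets -/

lemma inv_sqrt_two_sq : ((Real.sqrt 2 : ℝ) : ℂ)⁻¹ * ((Real.sqrt 2 : ℝ) : ℂ)⁻¹ = 1 / 2 := by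
  rw [← mul_inv, ← Complex.ofReal_mul, Real.mul_self_sqrt (by norm_num)]; norm_num

/-- Let `R` be a monomial operator that, when the qubit `p` of the input is flipped, flips the
qubit `q` of the output, leaves its other qubits unchanged and multiplies the phase by a sign
`(-1) ^ f`. Between two Hadamard gates, on `p` before and on `q` after `R`, it is again monomial:
the sign is turned into a change of the bit `p` by `f`, and this bit is stored in `q`. -/
lemma acts_bracket {k : ℕ} {R : Op k} {π : Basis k → Basis k} {φ : Basis k → ZMod 8}
    (hR : Acts R π φ) (p q : Fin k) (f : Basis k → Fin 2)
    (hπ : ∀ y, π (Function.update y p 1) =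
      Function.update (π (Function.update y p 0)) q (π (Function.update y p 0) q + 1))
    (hφ : ∀ y, φ (Function.update y p 1) =
      φ (Function.update y p 0) + if f y = 1 then 4 else 0) :
    Acts ((Gate.H q).op * R * (Gate.H p).op)
      (fun y => Function.update (π (Function.update y p 0)) q (y p + f y))
      (fun y => φ (Function.update y p 0) +
        if (y p + f y) = 1 ∧ π (Function.update y p 0) q = 1 then 4 else 0) := by
  intro y
  have hR' : ∀ y, R *ᵥ ket y = ph (φ y) • ket (π y) := hR
  simp only [← mulVec_mulVec, H_ket, mulVec_smul, mulVec_add, hR', hπ, hφ]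
  generalize Function.update y p 0 = y0
  simp only [Function.update_idem, Function.update_self, ph_add, smul_add, smul_smul]
  generalize ph (φ y0) = P
  have hs := inv_sqrt_two_sq
  generalize ((Real.sqrt 2 : ℝ) : ℂ)⁻¹ = s at hs ⊢
  rcases Fin.exists_fin_two.mp ⟨π y0 q, rfl⟩ with h1 | h1 <;>
  rcases Fin.exists_fin_two.mp ⟨y p, rfl⟩ with h2 | h2 <;>
  rcases Fin.exists_fin_two.mp ⟨f y, rfl⟩ with h3 | h3 <;>
    simp only [h1, h2, h3, ph_four, ph_zero, Fin.isValue, zero_ne_one, if_true, if_false, add_zero,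
      zero_add, show (1 + 1 : Fin 2) = 0 from rfl, and_true, and_false, and_self] <;>
    ext x <;> simp only [Pi.add_apply, Pi.smul_apply, smul_eq_mul] <;>
    generalize ket (Function.update (π y0) q 0) x = a <;>
    generalize ket (Function.update (π y0) q 1) x = b <;>
    first
    | linear_combination (2 * P * a) * hs
    | linear_combination (2 * P * b) * hs
    | linear_combination (-2 * P * a) * hs
    | linear_combination (-2 * P * b) * hs

/-! ### Inverse circuits -/

/-- The inverse of a gate. -/
def Gate.dag {k : ℕ} : Gate k → Gate k
  | .H q => .H q
  | .T q => .Tdag q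
  | .Tdag q => .T q
  | .CNOT c t => .CNOT c t

lemma Gate.dag_dag {k : ℕ} (g : Gate k) : g.dag.dag = g := by cases g <;> rfl

lemma Gate.dag_op_mul {k : ℕ} (g : Gate k) (hg : ∀ c t, g = .CNOT c t → c ≠ t) :
    g.dag.op * g.op = 1 := by
  cases g with
  | H q =>
    have := acts_bracket (acts_one (k := k)) q q (fun _ => 0) (by simp) (by simp)
    rw [mul_one] at this
    refine this.unique (fun y => ?_)
    simp
  | T q =>
    refine ((acts_Tdag q).comp (acts_T q)).unique (fun y => ?_)
    by_cases h : y q = 1 <;> simp [h]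
  | Tdag q =>
    refine ((acts_T q).comp (acts_Tdag q)).unique (fun y => ?_)
    by_cases h : y q = 1 <;> simp [h]
  | CNOT c t =>
    refine ((acts_CNOT c t).comp (acts_CNOT c t)).unique (fun y => ?_)
    have := hg c t rfl
    have e : y t + y c + y c = y t := by generalize y t = a; generalize y c = b; revert a b; decide
    simp [Function.update_of_ne this, e]

/-! ### Placing a circuit on a larger register -/

/-- The gate `g` with its qubits renamed. -/
def Gate.map {w k : ℕ} (ι : Fin w → Fin k) : Gate w → Gate k
  | .H q => .H (ι q)
  | .T q => .T (ι q)
  | .Tdag q => .Tdag (ι q)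
  | .CNOT c t => .CNOT (ι c) (ι t)

/-- The operator that acts as `A` on the qubits in the range of `ι`, and trivially elsewhere. -/
def liftOp {w k : ℕ} (ι : Fin w → Fin k) (A : Op w) : Op k :=
  Matrix.of fun x y => if ∀ j, (∀ i, ι i ≠ j) → x j = y j then A (x ∘ ι) (y ∘ ι) else 0

lemma extend_comp_self {w k : ℕ} {ι : Fin w → Fin k} (y : Basis k) :
    Function.extend ι (y ∘ ι) y = y := by
  ext j
  by_cases h : ∃ i, ι i = j
  · rw [Function.extend_def, dif_pos h]
    simp [h.choose_spec]
  · rw [Function.extend_apply' _ _ _ h]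

lemma liftOp_ket {w k : ℕ} {ι : Fin w → Fin k} (hι : Function.Injective ι) (A : Op w)
    (y : Basis k) :
    liftOp ι A *ᵥ ket y = ∑ u, A u (y ∘ ι) • ket (Function.extend ι u y) := by
  ext x
  rw [mulVec_ket]
  simp only [Finset.sum_apply, Pi.smul_apply, ket_apply, smul_eq_mul, mul_ite, mul_one, mul_zero,
    liftOp, Matrix.of_apply]
  by_cases h : ∀ j, (∀ i, ι i ≠ j) → x j = y j
  · have hx : ∀ u, x = Function.extend ι u y ↔ x ∘ ι = u := by
      intro u
      constructor
      · rintro rfl; exact Function.extend_comp hι u y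
      · rintro rfl
        ext j
        by_cases hj : ∃ i, ι i = j
        · obtain ⟨i, rfl⟩ := hj
          rw [hι.extend_apply]; rfl
        · rw [Function.extend_apply' _ _ _ hj, h j (by simpa using hj)]
    rw [if_pos h]
    simp [hx]
  · rw [if_neg h]
    symm
    apply Finset.sum_eq_zero
    intro u _
    rw [if_neg]
    rintro rfl
    exact h fun j hj => Function.extend_apply' _ _ _ (by simpa using hj)

lemma liftOp_one {w k : ℕ} {ι : Fin w → Fin k} (hι : Function.Injective ι) :
    liftOp ι (1 : Op w) = 1 := by
  apply op_ext
  intro y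
  rw [liftOp_ket hι]
  simp [Matrix.one_apply, extend_comp_self]

lemma extend_extend {w k : ℕ} {ι : Fin w → Fin k} (hι : Function.Injective ι) (u v : Basis w)
    (y : Basis k) : Function.extend ι u (Function.extend ι v y) = Function.extend ι u y := by
  ext j
  by_cases hj : ∃ i, ι i = j
  · obtain ⟨i, rfl⟩ := hj
    rw [hι.extend_apply, hι.extend_apply]
  · rw [Function.extend_apply' _ _ _ hj, Function.extend_apply' _ _ _ hj,
      Function.extend_apply' _ _ _ hj]

lemma liftOp_mul {w k : ℕ} {ι : Fin w → Fin k} (hι : Function.Injective ι) (A B : Op w) :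
    liftOp ι (A * B) = liftOp ι A * liftOp ι B := by
  apply op_ext
  intro y
  rw [← mulVec_mulVec, liftOp_ket hι, liftOp_ket hι, mulVec_sum]
  simp only [mulVec_smul, liftOp_ket hι, Function.extend_comp hι, extend_extend hι, Matrix.mul_apply,
    Finset.smul_sum, Finset.sum_smul, smul_smul]
  rw [Finset.sum_comm]
  refine Finset.sum_congr rfl fun u _ => Finset.sum_congr rfl fun v _ => ?_
  rw [mul_comm]

lemma liftOp_controlled {w k : ℕ} {ι : Fin w → Fin k} (hι : Function.Injective ι)
    (U : Matrix (Fin 2) (Fin 2) ℂ) (C : Finset (Fin w)) (t : Fin w) :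
    liftOp ι (controlled U C t) = controlled U (C.image ι) (ι t) := by
  ext x y
  simp only [liftOp, controlled, Matrix.of_apply, Finset.mem_image, forall_exists_index, and_imp,
    forall_apply_eq_imp_iff₂, Function.comp]
  by_cases h : ∀ j, j ≠ ι t → x j = y j
  · rw [if_pos h, if_pos fun j hj => h j (hj t).symm,
      if_pos fun j hj => h _ fun e => hj (hι e)]
    rfl
  · rw [if_neg h]
    split_ifs with h1 h2 <;> try rfl
    all_goals
      exfalso
      apply h
      intro j hj
      by_cases hj' : ∃ i, ι i = j
      · obtain ⟨i, rfl⟩ := hj'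
        exact h2 i fun e => hj (e ▸ rfl)
      · exact h1 j (by simpa using hj')

lemma Gate.map_op {w k : ℕ} {ι : Fin w → Fin k} (hι : Function.Injective ι) (g : Gate w) :
    (g.map ι).op = liftOp ι g.op := by
  cases g <;> simp [Gate.map, Gate.op, liftOp_controlled hι]

lemma ev_map {w k : ℕ} {ι : Fin w → Fin k} (hι : Function.Injective ι) (l : List (Gate w)) :
    ev (l.map (Gate.map ι)) = liftOp ι (ev l) := by
  induction l with
  | nil => simp [liftOp_one hι]
  | cons g l ih => rw [List.map_cons, ev_cons, ev_cons, ih, Gate.map_op hι, liftOp_mul hι]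

lemma Acts.lift {w k : ℕ} {ι : Fin w → Fin k} (hι : Function.Injective ι) {A : Op w}
    {π : Basis w → Basis w} {φ : Basis w → ZMod 8} (h : Acts A π φ) :
    Acts (liftOp ι A) (fun y => Function.extend ι (π (y ∘ ι)) y) (fun y => φ (y ∘ ι)) := by
  intro y
  have hA : ∀ u, A u (y ∘ ι) = ph (φ (y ∘ ι)) * if u = π (y ∘ ι) then 1 else 0 := by
    intro u
    have := congrFun (h (y ∘ ι)) u
    rwa [mulVec_ket, Pi.smul_apply, ket_apply, smul_eq_mul] at this
  rw [liftOp_ket hι]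
  simp [hA]

/-! ### Equality of operators up to commuting gates on disjoint qubits -/

/-- Equality of gates, as a Boolean function that evaluates quickly. -/
def Gate.same {k : ℕ} : Gate k → Gate k → Bool
  | .H q, .H q' => q == q'
  | .T q, .T q' => q == q'
  | .Tdag q, .Tdag q' => q == q'
  | .CNOT c t, .CNOT c' t' => c == c' && t == t'
  | _, _ => false

lemma Gate.eq_of_same {k : ℕ} {g h : Gate k} (e : g.same h = true) : g = h := by
  cases g <;> cases h <;> simp_all [Gate.same]

/-- Remove the first occurrence of `g` from a list, if `g` can be moved to its front. -/
def pullGate {k : ℕ} (g : Gate k) : List (Gate k) → Option (List (Gate k))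
  | [] => none
  | h :: l => if g.same h then some l else
      if Disjoint g.qubits h.qubits then (pullGate g l).map (h :: ·) else none

/-- Do two lists of gates agree up to exchanging neighbors that act on disjoint qubits? -/
def traceEq {k : ℕ} : List (Gate k) → List (Gate k) → Bool
  | [], l => l.isEmpty
  | g :: l, l' => match pullGate g l' with
    | none => false
    | some l'' => traceEq l l''

lemma ev_of_pullGate {k : ℕ} (g : Gate k) (l l' : List (Gate k)) (h : pullGate g l = some l') :
    ev l = ev l' * g.op := by
  induction l generalizing l' with
  | nil => simp [pullGate] at h
  | cons a l ih =>
    rw [pullGate] at h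
    split_ifs at h with h1 h2
    · obtain rfl := Gate.eq_of_same h1
      simp only [Option.some.injEq] at h
      rw [ev_cons, h]
    · simp only [Option.map_eq_some_iff] at h
      obtain ⟨l'', h3, rfl⟩ := h
      rw [ev_cons, ev_cons, ih _ h3, mul_assoc, mul_assoc, Gate.op_commute h2]

lemma ev_eq_of_traceEq {k : ℕ} {l l' : List (Gate k)} (h : traceEq l l' = true) :
    ev l = ev l' := by
  induction l generalizing l' with
  | nil =>
    rw [traceEq, List.isEmpty_iff] at h
    rw [h]
  | cons g l ih =>
    rw [traceEq] at h
    split at h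
    · simp at h
    · next l'' h' => rw [ev_cons, ih h, ev_of_pullGate g l' l'' h']

/-! ### Evaluation of circuits of `CNOT` and `T` gates -/

/-- Effect of a `CNOT`, `T` or `T†` gate on a basis state together with its phase. -/
def Gate.step {k : ℕ} : Gate k → Basis k × ZMod 8 → Basis k × ZMod 8
  | .H _, s => s
  | .T q, s => (s.1, s.2 + if s.1 q = 1 then 1 else 0)
  | .Tdag q, s => (s.1, s.2 + if s.1 q = 1 then -1 else 0)
  | .CNOT c t, s => (Function.update s.1 t (s.1 t + s.1 c), s.2)

/-- Effect of a list of `CNOT`, `T` and `T†` gates on a basis state and its phase. -/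
def steps {k : ℕ} (l : List (Gate k)) (s : Basis k × ZMod 8) : Basis k × ZMod 8 :=
  l.foldl (fun s g => g.step s) s

lemma ev_steps {k : ℕ} (l : List (Gate k)) (hl : l.all (fun g => !g.isH) = true) (y : Basis k)
    (a : ZMod 8) : ev l *ᵥ (ph a • ket y) = ph (steps l (y, a)).2 • ket (steps l (y, a)).1 := by
  induction l generalizing y a with
  | nil => simp [steps]
  | cons g l ih =>
    simp only [List.all_cons, Bool.and_eq_true] at hl
    have key : g.op *ᵥ (ph a • ket y) = ph (g.step (y, a)).2 • ket (g.step (y, a)).1 := by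
      rw [mulVec_smul]
      cases g with
      | H q => simp [Gate.isH] at hl
      | T q => rw [acts_T q y, smul_smul, ← ph_add]; rfl
      | Tdag q => rw [acts_Tdag q y, smul_smul, ← ph_add]; rfl
      | CNOT c t => rw [acts_CNOT c t y, smul_smul, ← ph_add, add_zero]; rfl
    rw [ev_cons, ← mulVec_mulVec, key, ih hl.2]
    rfl

lemma acts_steps {k : ℕ} (l : List (Gate k)) (hl : l.all (fun g => !g.isH) = true) :
    Acts (ev l) (fun y => (steps l (y, 0)).1) (fun y => (steps l (y, 0)).2) := by
  intro y
  rw [← ev_steps l hl y 0, ph_zero, one_smul]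

lemma forall_basis_three {P : Basis 3 → Prop} :
    (∀ y, P y) ↔ ∀ a b c, P ![a, b, c] :=
  ⟨fun h _ _ _ => h _, fun h y => by
    have : y = ![y 0, y 1, y 2] := by ext i; fin_cases i <;> rfl
    rw [this]; exact h _ _ _⟩

lemma forall_basis_four {P : Basis 4 → Prop} :
    (∀ y, P y) ↔ ∀ a b c d, P ![a, b, c, d] :=
  ⟨fun h _ _ _ _ => h _, fun h y => by
    have : y = ![y 0, y 1, y 2, y 3] := by ext i; fin_cases i <;> rfl
    rw [this]; exact h _ _ _ _⟩

lemma forall_basis_five {P : Basis 5 → Prop} :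
    (∀ y, P y) ↔ ∀ a b c d f, P ![a, b, c, d, f] :=
  ⟨fun h _ _ _ _ _ => h _, fun h y => by
    have : y = ![y 0, y 1, y 2, y 3, y 4] := by ext i; fin_cases i <;> rfl
    rw [this]; exact h _ _ _ _ _⟩

/-! ### Windows of the register -/

/-- The wires `d, d + 1, …` of the register, as the wires of a smaller register. -/
def wire {k : ℕ} [NeZero k] (w d : ℕ) (i : Fin w) : Fin k := Fin.ofNat k (d + i.val)

/-- The circuit `c` on the qubits `d, …, d + w - 1`. -/
def place {w k : ℕ} [NeZero k] (d : ℕ) (c : Circuit w) : Circuit k :=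
  c.map (List.map (Gate.map (wire w d)))

lemma wire_val {k : ℕ} [NeZero k] {w d : ℕ} (h : d + w ≤ k) (i : Fin w) :
    (wire w d i : Fin k).val = d + i.val := by
  rw [wire, Fin.val_ofNat, Nat.mod_eq_of_lt (by omega)]

lemma wire_injective {k : ℕ} [NeZero k] {w d : ℕ} (h : d + w ≤ k) :
    Function.Injective (wire w d : Fin w → Fin k) := by
  intro i j e
  have := congrArg Fin.val e
  rw [wire_val h, wire_val h] at this
  exact Fin.ext (by omega)

lemma flatten_place {w k : ℕ} [NeZero k] (d : ℕ) (c : Circuit w) :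
    (place d c : Circuit k).flatten = c.flatten.map (Gate.map (wire w d)) := by
  rw [place, List.map_flatten]

lemma Gate.map_map {u w k : ℕ} (f : Fin u → Fin w) (g : Fin w → Fin k) (a : Gate u) :
    (a.map f).map g = a.map (g ∘ f) := by cases a <;> rfl

lemma place_place {u w k : ℕ} [NeZero w] [NeZero k] (d s d' : ℕ) (c : Circuit u) (h : s + u ≤ w)
    (hd : d + s = d') : place d (place s c : Circuit w) = (place d' c : Circuit k) := by
  have : (wire w d : Fin w → Fin k) ∘ wire u s = wire u d' := by
    ext i
    simp only [Function.comp, wire, Fin.val_ofNat, ← hd]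
    rw [Nat.mod_eq_of_lt (a := s + i.val) (by omega), add_assoc]
  simp only [place, List.map_map, ← this]
  congr 1
  ext1 l
  simp only [Function.comp, List.map_map]
  congr 1
  ext1 g
  exact Gate.map_map _ _ _

lemma place_append {w k : ℕ} [NeZero k] (d : ℕ) (c c' : Circuit w) :
    (place d (c ++ c') : Circuit k) = place d c ++ place d c' := by simp [place]

/-! ### Monomial gadgets -/

lemma acts_bracket_steps {k : ℕ} (l : List (Gate k)) (hl : l.all (fun g => !g.isH) = true)
    (p q : Fin k) (f : Basis k → Fin 2) (ρ : Basis k → Basis k)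
    (h : ∀ y, (steps l (Function.update y p 1, 0)).1 =
        Function.update (steps l (Function.update y p 0, 0)).1 q
          ((steps l (Function.update y p 0, 0)).1 q + 1) ∧
      (steps l (Function.update y p 1, 0)).2 =
        (steps l (Function.update y p 0, 0)).2 + (if f y = 1 then 4 else 0) ∧
      Function.update (steps l (Function.update y p 0, 0)).1 q (y p + f y) = ρ y) :
    ∃ φ, Acts (ev (.H p :: (l ++ [.H q]))) ρ φ := by
  have := acts_bracket (acts_steps l hl) p q f (fun y => (h y).1) (fun y => (h y).2.1)
  rw [ev_cons, ev_append, ev_cons, ev_nil, one_mul, funext fun y => (h y).2.2.symm]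
  exact ⟨_, this⟩

lemma exists_acts_append {k : ℕ} {l l' : List (Gate k)} {π ρ : Basis k → Basis k}
    (h : ∃ φ, Acts (ev l) π φ) (h' : ∃ φ, Acts (ev l') ρ φ) :
    ∃ φ, Acts (ev (l ++ l')) (ρ ∘ π) φ := by
  obtain ⟨φ, h⟩ := h
  obtain ⟨φ', h'⟩ := h'
  rw [ev_append]
  exact ⟨_, h'.comp h⟩

lemma exists_acts_CNOT {k : ℕ} (c t : Fin k) :
    ∃ φ, Acts (ev [.CNOT c t]) (fun y => Function.update y t (y t + y c)) φ :=
  ⟨_, by rw [ev_cons, ev_nil, one_mul]; exact acts_CNOT c t⟩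

lemma Acts.congr {k : ℕ} {A : Op k} {π ρ : Basis k → Basis k} {φ : Basis k → ZMod 8}
    (h : Acts A π φ) (e : ∀ y, π y = ρ y) : Acts A ρ φ := (funext e : π = ρ) ▸ h

/-! ### The gadgets on a small register

A head adds the product of the carrier and of the first controls of a run, two at most, to the gap
before the run. Its gates are sorted into a left and a right part, which do not act on the carrier,
and a middle part: the left parts of all heads can be executed at the same time.

A pair passes two controls. The carrier is qubit `0`, and qubits `1` (the spare) and `2` (the root)
are controls that are already known to be on whenever there is a difference to carry, so that they
can store it: the product of the controls `3` and `4` is added to the root, then the product of the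
carrier and of the negated root is added to the spare, and finally the spare is added to the root,
which is the next carrier. There are two versions: the fast one has two more `CNOT` gates, but no
`T` and `H` gates in its last layer, which for the last pair of a run is executed on its own. -/

/-- Left part of a head with one control: target `0`, control `1`. -/
def headLeftOne : Circuit 2 := [[.H 0], [], [.CNOT 0 1], [.T 0, .Tdag 1], [.CNOT 0 1], [], []]

/-- Left outer part of a head with two controls: target `0`, nearer control `1`. -/
def headLeftTwo : Circuit 2 := [[.H 0], [], [.CNOT 0 1], [.T 0, .Tdag 1], [.CNOT 0 1], [], [.H 0]]

/-- Left inner part of a head with two controls: target `0`, controls `1` and `2`. -/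
def headInnerTwo : Circuit 3 := [[.CNOT 2 1], [.CNOT 0 1], [.T 0, .T 1], [.CNOT 0 1]]

/-- The head of an empty run: the carrier `0` is added to the target `1`. -/
def headMidZero : Circuit 2 := [[.CNOT 0 1]]

/-- Right part of a head with one control: carrier `0`, target `1`, control `2`. -/
def headMidOne : Circuit 3 :=
  [[.CNOT 0 1], [.CNOT 1 2], [.Tdag 1, .T 2], [.CNOT 1 2], [.H 1]]

/-- Right inner part of a head with two controls: carrier `0`, target `1`, controls `2` and `3`. -/
def headMidTwo : Circuit 4 :=
  [[.CNOT 0 1], [.CNOT 1 2], [.Tdag 1, .Tdag 2], [.CNOT 1 2], [.CNOT 0 1, .CNOT 3 2]]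

/-- Right outer part of a head with two controls: target `0`, nearer control `1`. -/
def headRightTwo : Circuit 2 := [[.H 0], [], [.CNOT 0 1], [.Tdag 0, .T 1], [.CNOT 0 1], [], [.H 0]]

/-- First layer of a pair: spare `0`, root `1`, nearer control `2` of the pair. -/
def pairLead : Circuit 3 := [[.H 1], [], [.CNOT 1 2], [.T 1, .Tdag 2], [.CNOT 2 1], [], [.H 0]]

/-- First layer of the last control `1` of an odd run, with the target `0`. -/
def oddLead : Circuit 2 := [[.H 0], [], [.CNOT 0 1], [.T 0, .Tdag 1], [.CNOT 0 1], [], []]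

/-- Second layer of a pair, first part: spare `0`, root `1`, controls `2` and `3`. The Boolean
selects the fast version. -/
def pairOne : Bool → Circuit 4
  | true => [[.CNOT 3 2]]
  | false => [[.CNOT 3 2], [.CNOT 2 1], [.Tdag 1, .T 2, .T 0], [.CNOT 1 2]]

/-- Second layer of a pair, second part: carrier `0`, spare `1`, root `2`, controls `3`, `4`. -/
def pairTwo : Bool → Circuit 5
  | true => [[.CNOT 3 2, .CNOT 1 0], [.Tdag 2, .T 3, .T 1, .Tdag 0], [.CNOT 2 3, .CNOT 1 0]]
  | false => []

/-- Third layer of a pair: carrier `0`, spare `1`, root `2`. If `fin` holds, the carrier is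
still to be closed by a Hadamard gate. -/
def pairThree (fast fin : Bool) : Circuit 3 :=
  (if fin then [.H 0, .H 2] else [.H 2]) ::
    match fast with
    | true => [[.CNOT 2 1], [.CNOT 1 0], [.T 1, .Tdag 0], [.CNOT 1 0], [], [.H 1]]
    | false => [[], [.CNOT 2 1], [.T 1], [.CNOT 0 1], [], []]

/-- Last layer of a pair: spare `0`, root `1`. -/
def pairPend : Bool → Circuit 2
  | true => [[.CNOT 0 1]]
  | false => [[.CNOT 0 1], [], [.Tdag 0, .Tdag 1], [.CNOT 1 0]]

/-- The gate that follows `pairPend`. -/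
def pairFin : Bool → List (Gate 2)
  | true => []
  | false => [.H 1]

/-- The end of a run with an even number of controls. -/
def finishEven : Circuit 3 := [[.CNOT 0 1], [.CNOT 1 2]]

/-- The end of a run with an odd number of controls, after `oddLead`. -/
def finishOdd : Circuit 4 :=
  [[.CNOT 0 1], [.CNOT 1 2], [.CNOT 2 3], [.Tdag 2, .T 3], [.CNOT 3 2], [.H 3]]

set_option maxRecDepth 100000 in
lemma acts_headOne : ∃ φ, Acts (ev (place 1 headLeftOne ++ headMidOne).flatten)
    (fun y => Function.update y 1 (y 1 + y 0 * y 2)) φ := by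
  apply acts_bracket_steps [.CNOT 1 2, .T 1, .Tdag 2, .CNOT 1 2, .CNOT 0 1, .CNOT 1 2, .Tdag 1,
    .T 2, .CNOT 1 2] rfl 1 1 (fun y => y 0 * y 2)
  rw [forall_basis_three]
  decide

/-- A bracket within a bracket, on the same qubit. -/
lemma ev_nested {k : ℕ} (q : Fin k) (l i r : List (Gate k)) :
    ev (.H q :: (l ++ .H q :: (i ++ .H q :: (r ++ [.H q])))) =
      (Gate.H q).op * (ev r * ((Gate.H q).op * ev i * (Gate.H q).op) * ev l) * (Gate.H q).op := by
  simp only [ev_cons, ev_append, ev_nil, one_mul, mul_assoc]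

set_option maxRecDepth 100000 in
lemma acts_headTwo : ∃ φ, Acts (ev (place 1 headLeftTwo ++ place 1 headInnerTwo ++ headMidTwo ++
      place 1 headRightTwo).flatten)
    (fun y => Function.update y 1 (y 1 + y 0 * y 2 * y 3)) φ := by
  have h1 := acts_bracket (acts_steps [.CNOT 3 2, .CNOT 1 2, .T 1, .T 2, .CNOT 1 2, .CNOT 0 1,
      .CNOT 1 2, .Tdag 1, .Tdag 2, .CNOT 1 2, .CNOT 0 1, .CNOT 3 2] rfl) (1 : Fin 4) 1
    (fun y => y 0 * (1 + y 2 + y 3))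
    (by rw [forall_basis_four]; decide) (by rw [forall_basis_four]; decide)
  have h2 := ((acts_steps [.CNOT 1 2, .Tdag 1, .T 2, .CNOT 1 2] rfl).comp h1).comp
    (acts_steps [.CNOT 1 2, .T 1, .Tdag 2, .CNOT 1 2] rfl)
  have h3 := acts_bracket h2 1 1 (fun y => y 0 * y 2 * y 3)
    (by rw [forall_basis_four]; decide) (by rw [forall_basis_four]; decide)
  rw [← ev_nested, ← ev_eq_of_traceEq (l := (place 1 headLeftTwo ++ place 1 headInnerTwo ++
    headMidTwo ++ place 1 headRightTwo).flatten) (by decide)] at h3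
  exact ⟨_, h3.congr (by rw [forall_basis_four]; decide)⟩

/-! ### Carrying a difference along the line -/

/-- The controls among the qubits `lo + 1, …, hi` (those selected by `W`) are all in state `1`. -/
def Ones {k : ℕ} (W : ℕ → Bool) (y : Basis k) (lo hi : ℕ) : Prop :=
  ∀ i : Fin k, lo < i.val → i.val ≤ hi → W i.val = true → y i = 1

/-- The basis states `x` and `y` agree on the qubit number `v`. -/
def SameAt {k : ℕ} (x y : Basis k) (v : ℕ) : Prop := ∀ i : Fin k, i.val = v → x i = y i

/-- Take two basis states that agree on the qubits after `v`, and that may differ on `v` only if the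
controls up to `a` are all on. Then `π` does not change the qubits after `v'`, and the images
differ on `v'` iff the given states differ on `v` and all controls up to `b` are on. -/
def Trans {k : ℕ} (W : ℕ → Bool) (π : Basis k → Basis k) (v a v' b : ℕ) : Prop :=
  ∀ x y : Basis k, (∀ i : Fin k, v < i.val → x i = y i) → (¬ SameAt x y v → Ones W y v a) →
    (∀ i : Fin k, v' < i.val → π x i = y i) ∧ (∀ i : Fin k, v' < i.val → π y i = y i) ∧
    (¬ SameAt (π x) (π y) v' ↔ ¬ SameAt x y v ∧ Ones W y v b)

instance {k : ℕ} (W : ℕ → Bool) (y : Basis k) (lo hi : ℕ) : Decidable (Ones W y lo hi) := by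
  unfold Ones; infer_instance

instance {k : ℕ} (x y : Basis k) (v : ℕ) : Decidable (SameAt x y v) := by
  unfold SameAt; infer_instance

/-- A list of gates that acts as a monomial operator whose permutation has the property `Trans`. -/
def Carries {k : ℕ} (W : ℕ → Bool) (l : List (Gate k)) (v a v' b : ℕ) : Prop :=
  ∃ π φ, Acts (ev l) π φ ∧ Trans W π v a v' b

lemma Ones.mono {k : ℕ} {W : ℕ → Bool} {y : Basis k} {lo hi lo' hi' : ℕ} (h : Ones W y lo hi)
    (h1 : lo ≤ lo') (h2 : hi' ≤ hi) : Ones W y lo' hi' :=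
  fun i a b => h i (h1.trans_lt a) (b.trans h2)

lemma Carries.append {k : ℕ} {W : ℕ → Bool} {l l' : List (Gate k)} {v a v' b a' v'' b' : ℕ}
    (h : Carries W l v a v' b) (h' : Carries W l' v' a' v'' b') (h1 : v ≤ v') (h2 : v' ≤ v'')
    (hb : v' ≤ b) (ha : a' ≤ b) (hb' : b ≤ b') : Carries W (l ++ l') v a v'' b' := by
  obtain ⟨π, φ, hA, hT⟩ := h
  obtain ⟨ρ, ψ, hA', hT'⟩ := h'
  rw [Carries, ev_append]
  refine ⟨_, _, hA'.comp hA, fun x y hxy hd => ?_⟩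
  obtain ⟨a1, a2, a3⟩ := hT x y hxy hd
  obtain ⟨b1, b2, b3⟩ := hT' (π x) (π y) (fun i hi => by rw [a1 i hi, a2 i hi]) (fun hs i hi hi' hW => by
    rw [a2 i hi]
    exact (a3.1 hs).2 i (by omega) (by omega) hW)
  refine ⟨fun i hi => ?_, fun i hi => ?_, ?_⟩
  · rw [Function.comp, b1 i hi, a2 i (by omega)]
  · rw [Function.comp, b2 i hi, a2 i (by omega)]
  · rw [Function.comp, Function.comp, b3, a3, and_assoc, and_congr_right_iff]
    intro _
    constructor
    · rintro ⟨c1, c2⟩ i hi hi' hW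
      by_cases hb : i.val ≤ b
      · exact c1 i hi hb hW
      · rw [← a2 i (by omega)]
        exact c2 i (by omega) hi' hW
    · intro c
      refine ⟨c.mono le_rfl hb', fun i hi hi' hW => ?_⟩
      rw [a2 i hi]
      exact c i (by omega) hi' hW

lemma Carries.of_ev_eq {k : ℕ} {W : ℕ → Bool} {l l' : List (Gate k)} {v a v' b : ℕ}
    (h : Carries W l v a v' b) (e : ev l' = ev l) : Carries W l' v a v' b := by
  unfold Carries; rw [e]; exact h

lemma Carries.place {w k : ℕ} [NeZero k] {mask W : ℕ → Bool} {l : List (Gate w)} {a v' b d : ℕ}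
    (h : Carries mask l 0 a v' b) (hd : d + w ≤ k) (hv : v' < w) (hab : a ≤ b) (hb : b < w)
    (hW : ∀ i, 0 < i → i ≤ b → W (d + i) = mask i) :
    Carries W (l.map (Gate.map (wire w d : Fin w → Fin k))) d (d + a) (d + v') (d + b) := by
  obtain ⟨π, φ, hA, hT⟩ := h
  have hι := wire_injective (k := k) hd
  have hval := wire_val (k := k) hd
  rw [Carries, ev_map hι]
  refine ⟨_, _, hA.lift hι, fun x y hxy hs => ?_⟩
  have same : ∀ (x y : Basis k) v, v < w → (SameAt (x ∘ wire w d) (y ∘ wire w d) v ↔ SameAt x y (d + v)) := by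
    intro x y v hv
    constructor
    · intro h i hi
      have e : i = wire w d ⟨v, hv⟩ := Fin.ext (by rw [hval, hi])
      rw [e]
      exact h ⟨v, hv⟩ rfl
    · intro h i hi
      exact h _ (by rw [hval, hi])
  have ones : ∀ hi, hi ≤ b → (Ones mask (y ∘ wire w d) 0 hi ↔ Ones W y d (d + hi)) := by
    intro hi hhi
    constructor
    · intro h i h1 h2 h3
      have e : i = wire w d ⟨i.val - d, by omega⟩ := Fin.ext (by rw [hval]; dsimp only; omega)
      rw [e]
      refine h ⟨i.val - d, by omega⟩ (by dsimp only; omega) (by dsimp only; omega) ?_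
      rw [← hW _ (by dsimp only; omega) (by dsimp only; omega), ← h3]
      congr 1
      dsimp only; omega
    · intro h i h1 h2 h3
      refine h _ (by rw [hval]; omega) (by rw [hval]; omega) ?_
      rw [hval, hW _ h1 (by omega), h3]
  have ext : ∀ (u : Basis w) (z : Basis k), Function.extend (wire w d) u z ∘ wire w d = u :=
    fun u z => Function.extend_comp hι u z
  have hw : 0 < w := by omega
  obtain ⟨h1, h2, h3⟩ := hT (x ∘ wire w d) (y ∘ wire w d)
    (fun i hi => hxy _ (by rw [hval]; omega))
    (fun h => (ones a hab).2 (hs (by rwa [same _ _ _ hw, add_zero] at h)))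
  have out : ∀ i : Fin k, (¬ ∃ j : Fin w, wire w d j = i) ↔ (i.val < d ∨ d + w ≤ i.val) := by
    intro i
    constructor
    · intro h
      by_contra hc
      exact h ⟨⟨i.val - d, by omega⟩, Fin.ext (by rw [hval]; dsimp only; omega)⟩
    · rintro h ⟨j, rfl⟩
      rw [hval] at h
      omega
  refine ⟨fun i hi => ?_, fun i hi => ?_, ?_⟩
  · by_cases hj : ∃ j : Fin w, wire w d j = i
    · obtain ⟨j, rfl⟩ := hj
      rw [hι.extend_apply]
      exact h1 j (by rw [hval] at hi; omega)
    · rw [Function.extend_apply' _ _ _ hj]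
      exact hxy _ (by omega)
  · by_cases hj : ∃ j : Fin w, wire w d j = i
    · obtain ⟨j, rfl⟩ := hj
      rw [hι.extend_apply]
      exact h2 j (by rw [hval] at hi; omega)
    · rw [Function.extend_apply' _ _ _ hj]
  · rw [← same _ _ _ hv, ext, ext, h3, same _ _ _ hw, ones b le_rfl, add_zero]

lemma exists_acts_bracket_steps {k : ℕ} (l : List (Gate k)) (hl : l.all (fun g => !g.isH) = true)
    (p q : Fin k) (f : Basis k → Fin 2)
    (h : ∀ y, (steps l (Function.update y p 1, 0)).1 =
        Function.update (steps l (Function.update y p 0, 0)).1 q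
          ((steps l (Function.update y p 0, 0)).1 q + 1) ∧
      (steps l (Function.update y p 1, 0)).2 =
        (steps l (Function.update y p 0, 0)).2 + (if f y = 1 then 4 else 0)) :
    ∃ φ, Acts (ev (.H p :: (l ++ [.H q])))
      (fun y => Function.update (steps l (Function.update y p 0, 0)).1 q (y p + f y)) φ :=
  acts_bracket_steps l hl p q f _ fun y => ⟨(h y).1, (h y).2, rfl⟩

lemma exists_acts_steps {k : ℕ} (l : List (Gate k)) (hl : l.all (fun g => !g.isH) = true) :
    ∃ φ, Acts (ev l) (fun y => (steps l (y, 0)).1) φ := ⟨_, acts_steps l hl⟩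

lemma Carries.of_acts {k : ℕ} {W : ℕ → Bool} {l : List (Gate k)} {π : Basis k → Basis k}
    {v a v' b : ℕ} (h : ∃ φ, Acts (ev l) π φ) (hT : Trans W π v a v' b) : Carries W l v a v' b := by
  obtain ⟨φ, h⟩ := h
  exact ⟨π, φ, h, hT⟩

/-- All layers of a pair of controls, one after the other; `f` selects the fast version. -/
def pairAll (f : Bool) : Circuit 5 :=
  place 1 pairLead ++ place 1 (pairOne f) ++ pairTwo f ++ place 0 (pairThree f false) ++
    place 1 (pairPend f ++ [pairFin f])

lemma trans_five {W : ℕ → Bool} {π : Basis 5 → Basis 5} {a v' b : ℕ}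
    (h : ∀ s a1 b1 c d e : Fin 2, let x : Basis 5 := ![s, b1, c, d, e]
      let y : Basis 5 := ![a1, b1, c, d, e]
      (¬ SameAt x y 0 → Ones W y 0 a) →
      (∀ i : Fin 5, v' < i.val → π x i = y i) ∧ (∀ i : Fin 5, v' < i.val → π y i = y i) ∧
      (¬ SameAt (π x) (π y) v' ↔ ¬ SameAt x y 0 ∧ Ones W y 0 b)) : Trans W π 0 a v' b := by
  intro x y hxy
  have ey : y = ![y 0, y 1, y 2, y 3, y 4] := by ext i; fin_cases i <;> rfl
  have ex : x = ![x 0, y 1, y 2, y 3, y 4] := by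
    ext i; fin_cases i
    · rfl
    all_goals simp [hxy]
  rw [ey, ex]
  exact h (x 0) (y 0) (y 1) (y 2) (y 3) (y 4)

set_option maxRecDepth 100000 in
lemma carries_pairFast : Carries (fun _ => true) (pairAll true).flatten 0 2 2 4 := by
  have h1 := exists_acts_bracket_steps (k := 5) [.CNOT 2 3, .T 2, .Tdag 3, .CNOT 3 2, .CNOT 4 3,
    .CNOT 3 2, .Tdag 2, .T 3, .CNOT 2 3] rfl 2 2 (fun y => y 3 * y 4)
    (by rw [forall_basis_five]; decide)
  have h2 := exists_acts_bracket_steps (k := 5) [.CNOT 1 0, .T 1, .Tdag 0, .CNOT 1 0, .CNOT 2 1,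
    .CNOT 1 0, .T 1, .Tdag 0, .CNOT 1 0] rfl 1 1 (fun y => y 0 * (1 + y 2))
    (by rw [forall_basis_five]; decide)
  have h3 := exists_acts_append (exists_acts_append h1 h2) (exists_acts_CNOT 1 2)
  refine Carries.of_ev_eq (Carries.of_acts h3 (trans_five ?_)) (ev_eq_of_traceEq ?_)
  · decide
  · decide

set_option maxRecDepth 100000 in
lemma carries_pairSlow : Carries (fun _ => true) (pairAll false).flatten 0 2 2 4 := by
  have h1 := exists_acts_bracket_steps (k := 5) [.CNOT 2 3, .T 2, .Tdag 3, .CNOT 3 2, .CNOT 4 3,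
    .CNOT 3 2, .Tdag 2, .T 3, .CNOT 2 3] rfl 2 2 (fun y => y 3 * y 4)
    (by rw [forall_basis_five]; decide)
  have h2 := exists_acts_bracket_steps (k := 5) [.T 1, .CNOT 2 1, .T 1, .CNOT 0 1, .CNOT 1 2,
    .Tdag 1, .Tdag 2, .CNOT 2 1] rfl 1 2 (fun y => y 0 * (1 + y 2))
    (by rw [forall_basis_five]; decide)
  refine Carries.of_ev_eq (Carries.of_acts (exists_acts_append h1 h2) (trans_five ?_))
    (ev_eq_of_traceEq ?_)
  · decide
  · decide

lemma trans_four {W : ℕ → Bool} {π : Basis 4 → Basis 4} {a v' b : ℕ}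
    (h : ∀ s a1 b1 c d : Fin 2, let x : Basis 4 := ![s, b1, c, d]
      let y : Basis 4 := ![a1, b1, c, d]
      (¬ SameAt x y 0 → Ones W y 0 a) →
      (∀ i : Fin 4, v' < i.val → π x i = y i) ∧ (∀ i : Fin 4, v' < i.val → π y i = y i) ∧
      (¬ SameAt (π x) (π y) v' ↔ ¬ SameAt x y 0 ∧ Ones W y 0 b)) : Trans W π 0 a v' b := by
  intro x y hxy
  have ey : y = ![y 0, y 1, y 2, y 3] := by ext i; fin_cases i <;> rfl
  have ex : x = ![x 0, y 1, y 2, y 3] := by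
    ext i; fin_cases i
    · rfl
    all_goals simp [hxy]
  rw [ey, ex]
  exact h (x 0) (y 0) (y 1) (y 2) (y 3)

lemma trans_three {W : ℕ → Bool} {π : Basis 3 → Basis 3} {a v' b : ℕ}
    (h : ∀ s a1 b1 c : Fin 2, let x : Basis 3 := ![s, b1, c]
      let y : Basis 3 := ![a1, b1, c]
      (¬ SameAt x y 0 → Ones W y 0 a) →
      (∀ i : Fin 3, v' < i.val → π x i = y i) ∧ (∀ i : Fin 3, v' < i.val → π y i = y i) ∧
      (¬ SameAt (π x) (π y) v' ↔ ¬ SameAt x y 0 ∧ Ones W y 0 b)) : Trans W π 0 a v' b := by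
  intro x y hxy
  have ey : y = ![y 0, y 1, y 2] := by ext i; fin_cases i <;> rfl
  have ex : x = ![x 0, y 1, y 2] := by
    ext i; fin_cases i
    · rfl
    all_goals simp [hxy]
  rw [ey, ex]
  exact h (x 0) (y 0) (y 1) (y 2)

set_option maxRecDepth 100000 in
lemma carries_finishEven : Carries (fun _ => true) finishEven.flatten 0 2 2 2 :=
  Carries.of_acts (exists_acts_steps _ rfl) (trans_three (by decide))

lemma trans_two {W : ℕ → Bool} {π : Basis 2 → Basis 2} {a v' b : ℕ}
    (h : ∀ s a1 b1 : Fin 2, let x : Basis 2 := ![s, b1]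
      let y : Basis 2 := ![a1, b1]
      (¬ SameAt x y 0 → Ones W y 0 a) →
      (∀ i : Fin 2, v' < i.val → π x i = y i) ∧ (∀ i : Fin 2, v' < i.val → π y i = y i) ∧
      (¬ SameAt (π x) (π y) v' ↔ ¬ SameAt x y 0 ∧ Ones W y 0 b)) : Trans W π 0 a v' b := by
  intro x y hxy
  have ey : y = ![y 0, y 1] := by ext i; fin_cases i <;> rfl
  have ex : x = ![x 0, y 1] := by
    ext i; fin_cases i
    · rfl
    all_goals simp [hxy]
  rw [ey, ex]
  exact h (x 0) (y 0) (y 1)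

lemma carries_CNOT : Carries (fun _ => true) [Gate.CNOT (0 : Fin 2) 1] 0 1 1 1 :=
  Carries.of_acts (exists_acts_steps _ rfl) (trans_two (by decide))

set_option maxRecDepth 100000 in
lemma carries_finishOdd :
    Carries (fun _ => true) (place 2 oddLead ++ finishOdd : Circuit 4).flatten 0 2 3 3 := by
  have h1 := exists_acts_steps (k := 4) [.CNOT 0 1] rfl
  have h2 := exists_acts_bracket_steps (k := 4) [.CNOT 2 3, .T 2, .Tdag 3, .CNOT 2 3, .CNOT 1 2,
    .CNOT 2 3, .Tdag 2, .T 3, .CNOT 3 2] rfl 2 3 (fun y => y 1 * y 3)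
    (by rw [forall_basis_four]; decide)
  refine Carries.of_ev_eq (Carries.of_acts (exists_acts_append h1 h2) (trans_four ?_))
    (ev_eq_of_traceEq ?_)
  · decide
  · decide

/-! ### Parallel composition and inverse of circuits -/

/-- Two circuits run in parallel, slot by slot. -/
def par {k : ℕ} : Circuit k → Circuit k → Circuit k
  | [], B => B
  | A, [] => A
  | a :: A, b :: B => (a ++ b) :: par A B

/-- The gates of `A` and the gates of `B` act on disjoint sets of qubits. -/
def Apart {k : ℕ} (A B : Circuit k) : Prop :=
  ∀ g ∈ A.flatten, ∀ h ∈ B.flatten, Disjoint g.qubits h.qubits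

/-- The circuit acts on the qubits `lo, …, hi` only. -/
def On {k : ℕ} (lo hi : ℕ) (c : Circuit k) : Prop :=
  ∀ g ∈ c.flatten, ∀ q ∈ g.qubits, lo ≤ q.val ∧ q.val ≤ hi

lemma On.apart {k : ℕ} {A B : Circuit k} {a b a' b' : ℕ} (hA : On a b A) (hB : On a' b' B)
    (h : b < a' ∨ b' < a) : Apart A B := by
  intro g hg g' hg'
  rw [Finset.disjoint_left]
  intro q hq hq'
  have := hA g hg q hq
  have := hB g' hg' q hq'
  omega

lemma On.mono {k : ℕ} {A : Circuit k} {a b a' b' : ℕ} (h : On a b A) (h1 : a' ≤ a) (h2 : b ≤ b') :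
    On a' b' A := fun g hg q hq => by
  have := h g hg q hq
  omega

lemma On.nil {k : ℕ} {a b : ℕ} : On a b ([] : Circuit k) := by intro g hg; simp at hg

lemma On.append {k : ℕ} {A B : Circuit k} {a b : ℕ} (hA : On a b A) (hB : On a b B) :
    On a b (A ++ B) := by
  intro g hg
  rw [List.flatten_append, List.mem_append] at hg
  exact hg.elim (hA g) (hB g)

lemma mem_flatten_par {k : ℕ} {A B : Circuit k} {g : Gate k} :
    g ∈ (par A B).flatten ↔ g ∈ A.flatten ∨ g ∈ B.flatten := by
  induction A, B using par.induct with
  | case1 B => simp [par]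
  | case2 A h =>
    cases A with
    | nil => simp [par]
    | cons a A => simp [par]
  | case3 a A b B ih =>
    rw [par, List.flatten_cons, List.mem_append, ih, List.mem_append, List.flatten_cons,
      List.flatten_cons, List.mem_append, List.mem_append]
    tauto

lemma On.par {k : ℕ} {A B : Circuit k} {a b : ℕ} (hA : On a b A) (hB : On a b B) :
    On a b (par A B) := by
  intro g hg
  exact (mem_flatten_par.1 hg).elim (hA g) (hB g)

lemma On.place {w k : ℕ} [NeZero k] {d lo hi : ℕ} (c : Circuit w) (h : d + w ≤ k) (h1 : lo ≤ d)
    (h2 : d + w ≤ hi + 1) : On lo hi (place d c : Circuit k) := by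
  intro g hg
  rw [flatten_place, List.mem_map] at hg
  obtain ⟨g, -, rfl⟩ := hg
  have := wire_val (k := k) h
  cases g <;> simp only [Gate.map, Gate.qubits, Finset.mem_insert, Finset.mem_singleton,
    forall_eq_or_imp, forall_eq, this] <;> omega

lemma Circuit.op_nil {k : ℕ} : Circuit.op ([] : Circuit k) = 1 := rfl

lemma Circuit.op_append {k : ℕ} (A B : Circuit k) :
    Circuit.op (A ++ B) = Circuit.op B * Circuit.op A := by
  rw [op_eq_ev, List.flatten_append, ev_append]; rfl

lemma Circuit.op_cons {k : ℕ} (a : List (Gate k)) (B : Circuit k) :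
    Circuit.op (a :: B) = Circuit.op B * ev a := by
  rw [op_eq_ev, List.flatten_cons, ev_append]; rfl

lemma Apart.commute {k : ℕ} {A B : Circuit k} (h : Apart A B) :
    Circuit.op A * Circuit.op B = Circuit.op B * Circuit.op A := ev_commute h

lemma op_par {k : ℕ} {A B : Circuit k} (h : Apart A B) :
    Circuit.op (par A B) = Circuit.op B * Circuit.op A := by
  induction A, B using par.induct with
  | case1 B => simp [par, Circuit.op_nil]
  | case2 A h =>
    cases A with
    | nil => simp [par, Circuit.op_nil]
    | cons a A => simp [par, Circuit.op_nil]
  | case3 a A b B ih =>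
    have h1 : Apart A B := fun g hg g' hg' => h g (by simp_all) g' (by simp_all)
    have h2 : ev b * Circuit.op A = Circuit.op A * ev b :=
      (ev_commute fun g hg g' hg' => h g (by simp_all) g' (by simp_all)).symm
    rw [par, Circuit.op_cons, ih h1, ev_append, Circuit.op_cons, Circuit.op_cons]
    simp only [mul_assoc]
    rw [← mul_assoc (ev b), h2, mul_assoc]

lemma isLNN_nil {k : ℕ} : Circuit.IsLNN ([] : Circuit k) := by simp [Circuit.IsLNN]

lemma isLNN_append {k : ℕ} {A B : Circuit k} (hA : A.IsLNN) (hB : B.IsLNN) :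
    Circuit.IsLNN (A ++ B) := by
  intro s hs
  rw [List.mem_append] at hs
  exact hs.elim (hA s) (hB s)

lemma isLNN_par {k : ℕ} {A B : Circuit k} (hA : A.IsLNN) (hB : B.IsLNN) (h : Apart A B) :
    (par A B).IsLNN := by
  induction A, B using par.induct with
  | case1 B => simpa [par] using hB
  | case2 A h =>
    cases A with
    | nil => simpa [par] using hB
    | cons a A => simpa [par] using hA
  | case3 a A b B ih =>
    have h1 : Apart A B := fun g hg g' hg' => h g (by simp_all) g' (by simp_all)
    have hA' : Circuit.IsLNN A := fun s hs => hA s (by simp [hs])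
    have hB' : Circuit.IsLNN B := fun s hs => hB s (by simp [hs])
    intro s hs
    rw [par, List.mem_cons] at hs
    rcases hs with rfl | hs
    · obtain ⟨a1, a2⟩ := hA a (by simp)
      obtain ⟨b1, b2⟩ := hB b (by simp)
      refine ⟨List.pairwise_append.2 ⟨a1, b1, fun g hg g' hg' => h g (by simp [hg]) g' (by simp [hg'])⟩, ?_⟩
      intro g hg
      exact (List.mem_append.1 hg).elim (a2 g) (b2 g)
    · exact ih hA' hB' h1 s hs

instance {k : ℕ} (g : Gate k) : Decidable g.NearestNeighbor := by
  cases g <;> unfold Gate.NearestNeighbor <;> infer_instance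

instance {k : ℕ} (c : Circuit k) : Decidable c.IsLNN := by
  unfold Circuit.IsLNN; infer_instance

lemma Gate.qubits_map {w k : ℕ} (f : Fin w → Fin k) (g : Gate w) :
    (g.map f).qubits = g.qubits.image f := by
  cases g <;> simp [Gate.map, Gate.qubits]

lemma isLNN_map {w k : ℕ} {f : Fin w → Fin k} (hf : Function.Injective f)
    (hn : ∀ i j : Fin w, i.val + 1 = j.val → (f i).val + 1 = (f j).val ∨ (f j).val + 1 = (f i).val)
    {c : Circuit w} (hc : c.IsLNN) : Circuit.IsLNN (c.map (List.map (Gate.map f)) : Circuit k) := by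
  intro s hs
  rw [List.mem_map] at hs
  obtain ⟨s, hs, rfl⟩ := hs
  obtain ⟨h1, h2⟩ := hc s hs
  constructor
  · rw [List.pairwise_map]
    refine h1.imp fun {g h} hd => ?_
    rw [Gate.qubits_map, Gate.qubits_map, Finset.disjoint_image hf]
    exact hd
  · intro g hg
    rw [List.mem_map] at hg
    obtain ⟨g, hg, rfl⟩ := hg
    have := h2 g hg
    cases g with
    | CNOT a b =>
      simp only [Gate.map, Gate.NearestNeighbor] at this ⊢
      rcases this with h | h
      · exact hn _ _ h
      · exact (hn _ _ h).symm
    | _ => trivial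

lemma isLNN_place {w k : ℕ} [NeZero k] {d : ℕ} {c : Circuit w} (hc : c.IsLNN) (h : d + w ≤ k) :
    (place d c : Circuit k).IsLNN := by
  refine isLNN_map (wire_injective h) (fun i j hij => ?_) hc
  rw [wire_val h, wire_val h]
  omega

/-- The inverse circuit. -/
def inv {k : ℕ} (c : Circuit k) : Circuit k := (c.map fun s => (s.map Gate.dag).reverse).reverse

lemma inv_cons {k : ℕ} (s : List (Gate k)) (c : Circuit k) :
    inv (s :: c) = inv c ++ [(s.map Gate.dag).reverse] := by simp [inv]

lemma Gate.qubits_dag {k : ℕ} (g : Gate k) : g.dag.qubits = g.qubits := by cases g <;> rfl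

lemma mem_flatten_inv {k : ℕ} {c : Circuit k} {g : Gate k} :
    g ∈ (inv c).flatten ↔ g.dag ∈ c.flatten := by
  simp only [inv, List.mem_flatten, List.mem_reverse, List.mem_map, exists_exists_and_eq_and]
  refine exists_congr fun s => and_congr_right fun _ => ⟨?_, fun h => ⟨_, h, g.dag_dag⟩⟩
  rintro ⟨a, ha, rfl⟩
  rwa [Gate.dag_dag]

lemma On.inv {k : ℕ} {A : Circuit k} {a b : ℕ} (hA : On a b A) : On a b (inv A) := by
  intro g hg
  rw [← g.qubits_dag]
  exact hA _ (mem_flatten_inv.1 hg)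

lemma isLNN_inv {k : ℕ} {c : Circuit k} (hc : c.IsLNN) : (inv c).IsLNN := by
  intro s hs
  simp only [inv, List.mem_reverse, List.mem_map] at hs
  obtain ⟨s, hs, rfl⟩ := hs
  obtain ⟨h1, h2⟩ := hc s hs
  constructor
  · rw [List.pairwise_reverse, List.pairwise_map]
    refine h1.imp fun {g h} hd => ?_
    rw [Gate.qubits_dag, Gate.qubits_dag]
    exact hd.symm
  · intro g hg
    rw [List.mem_reverse, List.mem_map] at hg
    obtain ⟨g, hg, rfl⟩ := hg
    have := h2 g hg
    cases g <;> exact this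

lemma ev_dag_mul {k : ℕ} (l : List (Gate k)) (hl : ∀ g ∈ l, g.NearestNeighbor) :
    ev (l.map Gate.dag).reverse * ev l = 1 := by
  induction l with
  | nil => simp
  | cons g l ih =>
    rw [List.map_cons, List.reverse_cons, ev_append, ev_cons, ev_nil, one_mul, ev_cons, mul_assoc,
      ← mul_assoc _ (ev l), ih fun g hg => hl g (by simp [hg]), one_mul, Gate.dag_op_mul]
    rintro c t rfl rfl
    have := hl _ (by simp : Gate.CNOT c c ∈ Gate.CNOT c c :: l)
    simp [Gate.NearestNeighbor] at this

lemma op_inv_mul {k : ℕ} {c : Circuit k} (hc : c.IsLNN) : (inv c).op * c.op = 1 := by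
  induction c with
  | nil => simp [inv, Circuit.op_nil]
  | cons s c ih =>
    rw [inv_cons, Circuit.op_append, Circuit.op_cons, Circuit.op_cons, Circuit.op_nil, one_mul,
      mul_assoc, ← mul_assoc _ (Circuit.op c), ih fun s hs => hc s (by simp [hs]), one_mul,
      ev_dag_mul _ (hc s (by simp)).2]

lemma op_mul_inv {k : ℕ} {c : Circuit k} (hc : c.IsLNN) : c.op * (inv c).op = 1 :=
  mul_eq_one_comm.1 (op_inv_mul hc)

/-! ### Cost and depth of composed circuits -/

lemma cost_append {k : ℕ} (p : Gate k → Bool) (A B : Circuit k) :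
    Circuit.cost p (A ++ B) = A.cost p + B.cost p := by
  simp [Circuit.cost]

lemma cost_par {k : ℕ} (p : Gate k → Bool) (A B : Circuit k) :
    Circuit.cost p (par A B) = A.cost p + B.cost p := by
  induction A, B using par.induct with
  | case1 B => simp [par, Circuit.cost]
  | case2 A h =>
    cases A with
    | nil => simp [par, Circuit.cost]
    | cons a A => simp [par, Circuit.cost]
  | case3 a A b B ih =>
    simp only [Circuit.cost, par, List.flatten_cons, List.countP_append] at ih ⊢
    omega

lemma depth_append {k : ℕ} (p : Gate k → Bool) (A B : Circuit k) :
    Circuit.depth p (A ++ B) = A.depth p + B.depth p := by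
  simp [Circuit.depth]

/-- Only the slots marked in the list `m` hold gates selected by `p`. -/
def Fits {k : ℕ} (p : Gate k → Bool) : Circuit k → List Bool → Prop
  | [], _ => True
  | _ :: _, [] => False
  | s :: c, b :: m => (s.any p = true → b = true) ∧ Fits p c m

lemma Fits.depth_le {k : ℕ} {p : Gate k → Bool} {c : Circuit k} {m : List Bool} (h : Fits p c m) :
    c.depth p ≤ m.count true := by
  induction c generalizing m with
  | nil => simp [Circuit.depth]
  | cons s c ih =>
    cases m with
    | nil => exact h.elim
    | cons b m =>
      have := ih h.2
      have h1 := h.1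
      simp only [Circuit.depth, List.countP_cons, List.count_cons, beq_iff_eq] at this ⊢
      split_ifs <;> first | omega | simp_all

lemma Fits.par {k : ℕ} {p : Gate k → Bool} {A B : Circuit k} {m : List Bool} (hA : Fits p A m)
    (hB : Fits p B m) : Fits p (par A B) m := by
  induction A, B using par.induct generalizing m with
  | case1 B => simpa [LNN.par] using hB
  | case2 A h =>
    cases A with
    | nil => simpa [LNN.par] using hB
    | cons a A => simpa [LNN.par] using hA
  | case3 a A b B ih =>
    cases m with
    | nil => exact hA.elim
    | cons c m =>
      refine ⟨?_, ih hA.2 hB.2⟩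
      rw [List.any_append, Bool.or_eq_true]
      exact fun h => h.elim hA.1 hB.1

/-- A type of gates that does not depend on the qubits on which a gate acts and that is closed
under inversion. -/
structure GateType : Type where
  /-- The gates of this type. -/
  is {k : ℕ} : Gate k → Bool
  is_map {w k : ℕ} (f : Fin w → Fin k) (g : Gate w) : is (g.map f) = is g
  is_dag {k : ℕ} (g : Gate k) : is g.dag = is g

/-- The type of the `CNOT` gates. -/
def cnotType : GateType := ⟨Gate.isCNOT, fun _ g => by cases g <;> rfl, fun g => by cases g <;> rfl⟩

/-- The type of the `T` gates. -/
def tType : GateType := ⟨Gate.isT, fun _ g => by cases g <;> rfl, fun g => by cases g <;> rfl⟩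

/-- The type of the Hadamard gates. -/
def hType : GateType := ⟨Gate.isH, fun _ g => by cases g <;> rfl, fun g => by cases g <;> rfl⟩

lemma any_map_gate (p : GateType) {w k : ℕ} (f : Fin w → Fin k) (s : List (Gate w)) :
    (s.map (Gate.map f)).any p.is = s.any p.is := by
  simp [List.any_map, Function.comp_def, p.is_map]

lemma cost_map (p : GateType) {w k : ℕ} (f : Fin w → Fin k) (c : Circuit w) :
    Circuit.cost p.is (c.map (List.map (Gate.map f)) : Circuit k) = c.cost p.is := by
  simp [Circuit.cost, ← List.map_flatten, List.countP_map, Function.comp_def, p.is_map]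

lemma depth_map (p : GateType) {w k : ℕ} (f : Fin w → Fin k) (c : Circuit w) :
    Circuit.depth p.is (c.map (List.map (Gate.map f)) : Circuit k) = c.depth p.is := by
  simp [Circuit.depth, List.countP_map, Function.comp_def, p.is_map]

lemma fits_map (p : GateType) {w k : ℕ} (f : Fin w → Fin k) {c : Circuit w} {m : List Bool}
    (h : Fits p.is c m) : Fits p.is (c.map (List.map (Gate.map f)) : Circuit k) m := by
  induction c generalizing m with
  | nil => trivial
  | cons s c ih =>
    cases m with
    | nil => exact h.elim
    | cons b m => exact ⟨by rw [any_map_gate]; exact h.1, ih h.2⟩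

lemma cost_inv (p : GateType) {k : ℕ} (c : Circuit k) : (inv c).cost p.is = c.cost p.is := by
  induction c with
  | nil => rfl
  | cons s c ih =>
    rw [inv_cons, cost_append, ih]
    simp [Circuit.cost, List.countP_map, Function.comp_def, p.is_dag, add_comm]

lemma depth_inv (p : GateType) {k : ℕ} (c : Circuit k) : (inv c).depth p.is = c.depth p.is := by
  simp [Circuit.depth, inv, List.countP_map, Function.comp_def, p.is_dag]

/-! ### The tail of a run of controls -/

/-- The first layer of the tail with carrier `w`, which has `j` pairs of controls to pass before
its end; `o` tells whether the run is odd. It does not act on the carrier. -/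
def lead {k : ℕ} [NeZero k] (w : ℕ) : ℕ → Bool → Circuit k
  | 0, false => []
  | 0, true => place (w + 2) oddLead
  | _ + 1, _ => place (w + 1) pairLead

/-- The end of a tail, after its first layer. -/
def finish {k : ℕ} [NeZero k] (w : ℕ) : Bool → Circuit k
  | false => place w finishEven
  | true => place w finishOdd

/-- The last layer of the pair before the carrier `w`, if there is one. -/
def pend {k : ℕ} [NeZero k] (f pnd : Bool) (w : ℕ) : Circuit k :=
  if pnd then place (w - 1) (pairPend f) else []

/-- The tail with carrier `w` without its first layer. The layers of consecutive
pairs overlap: if `pnd` holds, the last layer of a previous pair is executed as well. -/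
def rest {k : ℕ} [NeZero k] (f : Bool) : Bool → ℕ → ℕ → Bool → Circuit k
  | pnd, w, 0, o => pend f pnd w ++ (if pnd && !f then place w [[.H (0 : Fin 1)]] else []) ++ finish w o
  | pnd, w, j + 1, o => par (pend f pnd w) (place (w + 1) (pairOne f)) ++ place w (pairTwo f) ++
      par (place w (pairThree f (pnd && !f))) (lead (w + 2) j o) ++ rest f true (w + 2) j o

/-- The tail of a run, executed pair by pair. -/
def serialTail {k : ℕ} [NeZero k] (f : Bool) : ℕ → ℕ → Bool → Circuit k
  | w, 0, false => place w finishEven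
  | w, 0, true => place w (place 2 oddLead ++ finishOdd : Circuit 4)
  | w, j + 1, o => place w (pairAll f) ++ serialTail f (w + 2) j o

lemma on_lead {k : ℕ} [NeZero k] {w j : ℕ} {o : Bool} (h : w + 2 * j + 2 + o.toNat < k) :
    On (w + 1) (w + 2 * j + 2 + o.toNat) (lead w j o : Circuit k) := by
  rcases j with _ | j
  · rcases o with _ | _
    · exact On.nil
    · simp only [Bool.toNat_true] at *
      exact On.place _ (by omega) (by omega) (by omega)
  · exact On.place _ (by omega) (by omega) (by omega)

lemma on_pend {k : ℕ} [NeZero k] {w : ℕ} {f pnd : Bool} (hw : pnd = true → 1 ≤ w) (h : w < k) :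
    On (w - 1) w (pend f pnd w : Circuit k) := by
  rcases pnd with _ | _
  · exact On.nil
  · simp only [forall_const] at hw
    exact On.place _ (by omega) (by omega) (by omega)

lemma on_finish {k : ℕ} [NeZero k] {w : ℕ} {o : Bool} (h : w + 2 + o.toNat < k) :
    On w (w + 2 + o.toNat) (finish w o : Circuit k) := by
  rcases o with _ | _
  · simp only [Bool.toNat_false] at *
    exact On.place _ (by omega) (by omega) (by omega)
  · simp only [Bool.toNat_true] at *
    exact On.place _ (by omega) (by omega) (by omega)

lemma on_rest {k : ℕ} [NeZero k] {f pnd : Bool} {w j lo : ℕ} {o : Bool} (hlo : lo ≤ w)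
    (hw : pnd = true → lo + 1 ≤ w) (h : w + 2 * j + 2 + o.toNat < k) :
    On lo (w + 2 * j + 2 + o.toNat) (rest f pnd w j o : Circuit k) := by
  induction j generalizing w pnd with
  | zero =>
    have hp : On lo (w + 2 * 0 + 2 + o.toNat) (pend f pnd w : Circuit k) := by
      rcases pnd with _ | _
      · exact On.nil
      · simp only [forall_const] at hw
        exact (on_pend (fun _ => by omega) (by omega)).mono (by omega) (by omega)
    refine (hp.append ?_).append ((on_finish (by omega)).mono hlo (by omega))
    split_ifs
    · exact On.place _ (by omega) (by omega) (by omega)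
    · exact On.nil
  | succ j ih =>
    have hp : On lo (w + 2 * (j + 1) + 2 + o.toNat) (pend f pnd w : Circuit k) := by
      rcases pnd with _ | _
      · exact On.nil
      · simp only [forall_const] at hw
        exact (on_pend (fun _ => by omega) (by omega)).mono (by omega) (by omega)
    refine ((((hp.par ?_).append ?_).append (On.par ?_ ?_)).append ?_)
    · exact On.place _ (by omega) (by omega) (by omega)
    · exact On.place _ (by omega) (by omega) (by omega)
    · exact On.place _ (by omega) (by omega) (by omega)
    · exact (on_lead (by omega)).mono (by omega) (by omega)
    · exact (ih (by omega) (fun _ => by omega) (by omega)).mono le_rfl (by omega)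

lemma isLNN_lead {k : ℕ} [NeZero k] {w j : ℕ} {o : Bool} (h : w + 2 * j + 2 + o.toNat < k) :
    (lead w j o : Circuit k).IsLNN := by
  rcases j with _ | j
  · rcases o with _ | _
    · exact isLNN_nil
    · simp only [Bool.toNat_true] at *
      exact isLNN_place (by decide) (by omega)
  · exact isLNN_place (by decide) (by omega)

lemma isLNN_pend {k : ℕ} [NeZero k] {w : ℕ} {f pnd : Bool} (hw : pnd = true → 1 ≤ w) (h : w < k) :
    (pend f pnd w : Circuit k).IsLNN := by
  rcases pnd with _ | _
  · exact isLNN_nil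
  · simp only [forall_const] at hw
    exact isLNN_place (by revert f; decide) (by omega)

lemma isLNN_finish {k : ℕ} [NeZero k] {w : ℕ} {o : Bool} (h : w + 2 + o.toNat < k) :
    (finish w o : Circuit k).IsLNN := by
  rcases o with _ | _
  · exact isLNN_place (by decide) (by omega)
  · simp only [Bool.toNat_true] at *
    exact isLNN_place (by decide) (by omega)

lemma isLNN_pairOne : ∀ f, (pairOne f).IsLNN := by decide

lemma isLNN_pairTwo : ∀ f, (pairTwo f).IsLNN := by decide

lemma isLNN_pairThree : ∀ f fin, (pairThree f fin).IsLNN := by decide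

lemma isLNN_rest {k : ℕ} [NeZero k] {f pnd : Bool} {w j : ℕ} {o : Bool}
    (hw : pnd = true → 1 ≤ w) (h : w + 2 * j + 2 + o.toNat < k) :
    (rest f pnd w j o : Circuit k).IsLNN := by
  induction j generalizing w pnd with
  | zero =>
    refine isLNN_append (isLNN_append (isLNN_pend hw (by omega)) ?_) (isLNN_finish (by omega))
    split_ifs
    · exact isLNN_place (by decide) (by omega)
    · exact isLNN_nil
  | succ j ih =>
    refine isLNN_append (isLNN_append (isLNN_append (isLNN_par (isLNN_pend hw (by omega)) ?_ ?_) ?_)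
      (isLNN_par ?_ (isLNN_lead (by omega)) ?_)) (ih (fun _ => by omega) (by omega))
    · exact isLNN_place (isLNN_pairOne f) (by omega)
    · exact (on_pend hw (by omega)).apart (On.place _ (by omega) le_rfl le_rfl) (by omega)
    · exact isLNN_place (isLNN_pairTwo f) (by omega)
    · exact isLNN_place (isLNN_pairThree _ _) (by omega)
    · exact (On.place _ (by omega) le_rfl le_rfl (lo := w) (hi := w + 2)).apart (on_lead (by omega)) (by omega)

lemma op_pairThree {k : ℕ} [NeZero k] (f fin : Bool) (w : ℕ) :
    (place w (pairThree f fin) : Circuit k).op =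
      (place w (pairThree f false) : Circuit k).op *
        (if fin then place w [[.H (0 : Fin 1)]] else [] : Circuit k).op := by
  cases fin
  · simp [Circuit.op_nil]
  · simp only [if_true]
    rw [← Circuit.op_append]
    rfl

/-- Executing the layers of the pairs in the overlapping order amounts to executing the pairs one
after the other. -/
lemma op_lead_rest {k : ℕ} [NeZero k] (f pnd : Bool) (w j : ℕ) (o : Bool)
    (hw : pnd = true → 1 ≤ w) (h : w + 2 * j + 2 + o.toNat < k) :
    (rest f pnd w j o : Circuit k).op * (lead w j o : Circuit k).op =
      (serialTail f w j o : Circuit k).op *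
        ((if pnd && !f then place w [[.H (0 : Fin 1)]] else [] : Circuit k).op *
          (pend f pnd w : Circuit k).op) := by
  induction j generalizing w pnd with
  | zero =>
    have c1 := ((on_pend (f := f) (k := k) hw (by omega)).apart (on_lead (j := 0) (o := o) h)
      (by omega)).commute
    have c2 := ((?_ : On w w (if pnd && !f then place w [[.H (0 : Fin 1)]] else [] : Circuit k)).apart
      (on_lead (j := 0) (o := o) h) (by omega)).commute
    · rw [rest, Circuit.op_append, Circuit.op_append, mul_assoc, mul_assoc, c1, ← mul_assoc _ (lead w 0 o).op,
        c2]
      simp only [← mul_assoc]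
      congr 2
      cases o
      · simp [lead, finish, serialTail, Circuit.op_nil]
      · simp only [lead, finish, serialTail, place_append, Circuit.op_append]
        rw [place_place _ _ _ _ (by omega) rfl]
    · split_ifs
      · exact On.place _ (by omega) (by omega) (by omega)
      · exact On.nil
  | succ j ih =>
    have hfin : On w w (if pnd && !f then place w [[.H (0 : Fin 1)]] else [] : Circuit k) := by
      split_ifs
      · exact On.place _ (by omega) (by omega) (by omega)
      · exact On.nil
    have hone : On (w + 1) (w + 4) (place (w + 1) (pairOne f) : Circuit k) :=
      On.place _ (by omega) (by omega) (by omega)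
    have hp := on_pend (f := f) (k := k) hw (by omega)
    have hl := on_lead (k := k) h
    have c1 := (hp.apart hl (by omega)).commute
    have c3 := (hfin.apart hl (by omega)).commute
    have c4 := (hfin.apart hone (by omega)).commute
    have c5 : (if pnd && !f then place w [[.H (0 : Fin 1)]] else [] : Circuit k).op *
        (place w (pairTwo f) : Circuit k).op = (place w (pairTwo f) : Circuit k).op *
        (if pnd && !f then place w [[.H (0 : Fin 1)]] else [] : Circuit k).op := by
      cases f
      · simp [pairTwo, place, Circuit.op_nil]
      · simp [Circuit.op_nil]
    rw [rest, Circuit.op_append, Circuit.op_append, Circuit.op_append,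
      op_par (hp.apart hone (by omega)), op_par, op_pairThree]
    · generalize hF : (if pnd && !f then place w [[.H (0 : Fin 1)]] else [] : Circuit k).op = F at *
      have e := ih true (w + 2) (fun _ => by omega) (by omega)
      simp only [serialTail, pairAll, place_append, Circuit.op_append]
      rw [place_place _ _ _ _ (by omega) rfl, place_place _ _ _ _ (by omega) rfl,
        place_place _ _ _ _ (by omega) rfl, place_place _ _ _ _ (by omega) rfl,
        place_place _ _ _ _ (by omega) rfl]
      have e2 : (place (w + 1) [pairFin f] : Circuit k).op =
          (if true && !f then place (w + 2) [[.H (0 : Fin 1)]] else [] : Circuit k).op := by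
        cases f
        · exact congrArg Circuit.op (place_place (w := 2) (w + 1) 1 (w + 2) [[.H (0 : Fin 1)]]
            (by omega) rfl)
        · rfl
      have e3 : (pend f true (w + 2) : Circuit k) = place (w + 1) (pairPend f) := rfl
      rw [← e2, e3] at e
      rw [add_zero]
      have e4 : (lead w (j + 1) o : Circuit k) = place (w + 1) pairLead := rfl
      rw [e4] at c1 c3 ⊢
      simp only [← mul_assoc] at e ⊢
      rw [e]
      generalize (serialTail f (w + 2) j o : Circuit k).op = S
      simp only [mul_assoc]
      rw [c1, ← mul_assoc F, c5, mul_assoc, ← mul_assoc F, c4, mul_assoc, ← mul_assoc F, c3, mul_assoc]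
    · exact (On.place _ (by omega) le_rfl le_rfl (lo := w) (hi := w + 2)).apart (on_lead (by omega)) (by omega)

lemma carries_serialTail {k : ℕ} [NeZero k] {W : ℕ → Bool} (f : Bool) {w j : ℕ} {o : Bool}
    (h : w + 2 * j + 2 + o.toNat < k)
    (hW : ∀ i, w < i → i ≤ w + 2 * j + 2 + o.toNat → W i = true) :
    Carries W (serialTail f w j o : Circuit k).flatten w (w + 2) (w + 2 * j + 2 + o.toNat)
      (w + 2 * j + 2 + o.toNat) := by
  induction j generalizing w with
  | zero =>
    cases o
    · simp only [Bool.toNat_false] at *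
      rw [serialTail, flatten_place]
      exact carries_finishEven.place (by omega) (by omega) (by omega) (by omega)
        fun i h1 h2 => hW _ (by omega) (by omega)
    · simp only [Bool.toNat_true] at *
      rw [serialTail, flatten_place]
      exact carries_finishOdd.place (by omega) (by omega) (by omega) (by omega)
        fun i h1 h2 => hW _ (by omega) (by omega)
  | succ j ih =>
    rw [serialTail, List.flatten_append, flatten_place]
    have hp : Carries W ((pairAll f).flatten.map (Gate.map (wire 5 w : Fin 5 → Fin k))) w (w + 2)
        (w + 2) (w + 4) := by
      cases f
      · exact carries_pairSlow.place (by omega) (by omega) (by omega) (by omega)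
          fun i h1 h2 => hW _ (by omega) (by omega)
      · exact carries_pairFast.place (by omega) (by omega) (by omega) (by omega)
          fun i h1 h2 => hW _ (by omega) (by omega)
    have := ih (w := w + 2) (by omega) (fun i h1 h2 => hW i (by omega) (by omega))
    rw [show w + 2 + 2 * j + 2 + o.toNat = w + 2 * (j + 1) + 2 + o.toNat by omega] at this
    exact hp.append this (by omega) (by omega) (by omega) (by omega) (by omega)

/-- The first layer of the tail of a run of `m` controls with carrier `d`. -/
def tailLead {k : ℕ} [NeZero k] (d m : ℕ) : Circuit k :=
  if m < 2 then [] else lead d ((m - 2) / 2) (m % 2 == 1)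

/-- The tail of a run of `m` controls with carrier `d`, after its first layer. -/
def tailRest {k : ℕ} [NeZero k] (f : Bool) (d : ℕ) : ℕ → Circuit k
  | 0 => []
  | 1 => place d [[.CNOT (0 : Fin 2) 1]]
  | m + 2 => rest f false d (m / 2) (m % 2 == 1)

lemma tailLead_add_two {k : ℕ} [NeZero k] (d m : ℕ) :
    (tailLead d (m + 2) : Circuit k) = lead d (m / 2) (m % 2 == 1) := by
  simp [tailLead]

lemma two_mul_half_add_parity (m : ℕ) : 2 * (m / 2) + (m % 2 == 1).toNat = m := by
  rcases Nat.mod_two_eq_zero_or_one m with h | h <;> simp [h] <;> omega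

lemma on_tailLead {k : ℕ} [NeZero k] {d m : ℕ} (h : d + m < k) :
    On (d + 1) (d + m) (tailLead d m : Circuit k) := by
  rcases m with _ | _ | m
  · exact On.nil
  · exact On.nil
  · have := two_mul_half_add_parity m
    rw [tailLead_add_two]
    exact (on_lead (by omega)).mono (by omega) (by omega)

lemma on_tailRest {k : ℕ} [NeZero k] {f : Bool} {d m : ℕ} (h : d + m < k) :
    On d (d + m) (tailRest f d m : Circuit k) := by
  rcases m with _ | _ | m
  · exact On.nil
  · exact On.place _ (by omega) (by omega) (by omega)
  · have := two_mul_half_add_parity m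
    exact (on_rest le_rfl (by simp) (by omega)).mono (by omega) (by omega)

lemma isLNN_tailLead {k : ℕ} [NeZero k] {d m : ℕ} (h : d + m < k) :
    (tailLead d m : Circuit k).IsLNN := by
  rcases m with _ | _ | m
  · exact isLNN_nil
  · exact isLNN_nil
  · have := two_mul_half_add_parity m
    rw [tailLead_add_two]
    exact isLNN_lead (by omega)

lemma isLNN_tailRest {k : ℕ} [NeZero k] {f : Bool} {d m : ℕ} (h : d + m < k) :
    (tailRest f d m : Circuit k).IsLNN := by
  rcases m with _ | _ | m
  · exact isLNN_nil
  · exact isLNN_place (by decide) (by omega)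
  · have := two_mul_half_add_parity m
    exact isLNN_rest (by simp) (by omega)

/-- If the first two controls of the run are known to be on whenever the carrier differs, the tail
moves the difference to the end of the run. -/
lemma carries_tail {k : ℕ} [NeZero k] {W : ℕ → Bool} {f : Bool} {d m : ℕ} (h : d + m < k)
    (hW : ∀ i, d < i → i ≤ d + m → W i = true) :
    Carries W (tailLead d m ++ tailRest f d m : Circuit k).flatten d (d + min m 2) (d + m) (d + m) := by
  rcases m with _ | _ | m
  · refine ⟨id, _, acts_one, fun x y hxy hd => ⟨hxy, fun _ _ => rfl, ?_⟩⟩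
    simp only [id, add_zero, iff_self_and]
    exact fun _ i h1 h2 => absurd h1 (by omega)
  · change Carries W ([Gate.CNOT (0 : Fin 2) 1].map (Gate.map (wire 2 d))) _ _ _ _
    exact carries_CNOT.place (by omega) (by omega) (by omega) (by omega)
        fun i h1 h2 => hW _ (by omega) (by omega)
  · have e := two_mul_half_add_parity m
    have := carries_serialTail (k := k) (W := W) f (w := d) (j := m / 2) (o := m % 2 == 1) (by omega)
      (fun i h1 h2 => hW i h1 (by omega))
    rw [show d + 2 * (m / 2) + 2 + (m % 2 == 1).toNat = d + (m + 2) by omega] at this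
    rw [show d + min (m + 2) 2 = d + 2 by omega, tailLead_add_two, tailRest]
    refine this.of_ev_eq ?_
    have := op_lead_rest (k := k) f false d (m / 2) (m % 2 == 1) (by simp) (by omega)
    simp only [pend, Bool.false_and, Bool.false_eq_true, if_false, Circuit.op_nil, mul_one] at this
    rw [← op_eq_ev, ← op_eq_ev, Circuit.op_append, this]

/-! ### The head of a run of controls -/

/-- The left outer part of the head with target `d` of a run of `m` controls. -/
def headLeft {k : ℕ} [NeZero k] (d : ℕ) : ℕ → Circuit k
  | 0 => []
  | 1 => place d headLeftOne
  | _ + 2 => place d headLeftTwo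

/-- The left inner part of the head with target `d` of a run of `m` controls. -/
def headInner {k : ℕ} [NeZero k] (d : ℕ) : ℕ → Circuit k
  | 0 => []
  | 1 => []
  | _ + 2 => place d headInnerTwo

/-- The middle part of the head with carrier `z` of a run of `m` controls. -/
def headMid {k : ℕ} [NeZero k] (z : ℕ) : ℕ → Circuit k
  | 0 => place z headMidZero
  | 1 => place z headMidOne
  | _ + 2 => place z headMidTwo

/-- The right outer part of the head with target `d` of a run of `m` controls. -/
def headRight {k : ℕ} [NeZero k] (d : ℕ) : ℕ → Circuit k
  | 0 => []
  | 1 => []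
  | _ + 2 => place d headRightTwo

/-- The head with carrier `z` of a run of `m` controls: the product of the carrier and of the first
controls of the run, two at most, is added to the qubit `z + 1`. -/
def headAll {k : ℕ} [NeZero k] (z m : ℕ) : Circuit k :=
  headLeft (z + 1) m ++ headInner (z + 1) m ++ headMid z m ++ headRight (z + 1) m

lemma on_headLeft {k : ℕ} [NeZero k] {d m : ℕ} (h : d + m < k) :
    On d (d + min m 1) (headLeft d m : Circuit k) := by
  rcases m with _ | _ | m
  · exact On.nil
  · exact On.place _ (by omega) (by omega) (by omega)
  · exact On.place _ (by omega) (by omega) (by omega)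

lemma on_headInner {k : ℕ} [NeZero k] {d m : ℕ} (h : d + m < k) :
    On d (d + m) (headInner d m : Circuit k) := by
  rcases m with _ | _ | m
  · exact On.nil
  · exact On.nil
  · exact On.place _ (by omega) (by omega) (by omega)

lemma on_headMid {k : ℕ} [NeZero k] {z m : ℕ} (h : z + 1 + m < k) :
    On z (z + 1 + m) (headMid z m : Circuit k) := by
  rcases m with _ | _ | m
  · exact On.place _ (by omega) (by omega) (by omega)
  · exact On.place _ (by omega) (by omega) (by omega)
  · exact On.place _ (by omega) (by omega) (by omega)

lemma on_headRight {k : ℕ} [NeZero k] {d m : ℕ} (h : d + m < k) :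
    On d (d + m) (headRight d m : Circuit k) := by
  rcases m with _ | _ | m
  · exact On.nil
  · exact On.nil
  · exact On.place _ (by omega) (by omega) (by omega)

lemma isLNN_headLeft {k : ℕ} [NeZero k] {d m : ℕ} (h : d + m < k) :
    (headLeft d m : Circuit k).IsLNN := by
  rcases m with _ | _ | m
  · exact isLNN_nil
  · exact isLNN_place (by decide) (by omega)
  · exact isLNN_place (by decide) (by omega)

lemma isLNN_headInner {k : ℕ} [NeZero k] {d m : ℕ} (h : d + m < k) :
    (headInner d m : Circuit k).IsLNN := by
  rcases m with _ | _ | m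
  · exact isLNN_nil
  · exact isLNN_nil
  · exact isLNN_place (by decide) (by omega)

lemma isLNN_headMid {k : ℕ} [NeZero k] {z m : ℕ} (h : z + 1 + m < k) :
    (headMid z m : Circuit k).IsLNN := by
  rcases m with _ | _ | m
  · exact isLNN_place (by decide) (by omega)
  · exact isLNN_place (by decide) (by omega)
  · exact isLNN_place (by decide) (by omega)

lemma isLNN_headRight {k : ℕ} [NeZero k] {d m : ℕ} (h : d + m < k) :
    (headRight d m : Circuit k).IsLNN := by
  rcases m with _ | _ | m
  · exact isLNN_nil
  · exact isLNN_nil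
  · exact isLNN_place (by decide) (by omega)

lemma on_headAll {k : ℕ} [NeZero k] {z m : ℕ} (h : z + 1 + m < k) :
    On z (z + 1 + m) (headAll z m : Circuit k) :=
  ((((on_headLeft h).mono (by omega) (by omega)).append ((on_headInner h).mono (by omega) (by omega))).append
    (on_headMid h)).append ((on_headRight h).mono (by omega) (by omega))

lemma isLNN_headAll {k : ℕ} [NeZero k] {z m : ℕ} (h : z + 1 + m < k) :
    (headAll z m : Circuit k).IsLNN :=
  isLNN_append (isLNN_append (isLNN_append (isLNN_headLeft h) (isLNN_headInner h)) (isLNN_headMid h))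
    (isLNN_headRight h)

/-- A bit that is changed by `f` on a small register. -/
lemma exists_acts_place_update {w k : ℕ} [NeZero k] {c : Circuit w} {z : ℕ} (hz : z + w ≤ k)
    {t : Fin w} {f : Basis w → Fin 2}
    (h : ∃ φ, Acts (ev c.flatten) (fun y => Function.update y t (y t + f y)) φ) :
    ∃ π φ, Acts (place z c : Circuit k).op π φ ∧ ∀ y : Basis k,
      (∀ i : Fin k, i.val ≠ z + t.val → π y i = y i) ∧
      (¬ SameAt (π y) y (z + t.val) ↔ f (y ∘ wire w z) = 1) := by
  obtain ⟨φ, h⟩ := h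
  have hι := wire_injective (k := k) hz
  have hval := wire_val (k := k) hz
  rw [op_eq_ev, flatten_place, ev_map hι]
  refine ⟨_, _, h.lift hι, fun y => ?_⟩
  have e : ∀ i : Fin k, i.val = z + t.val → i = wire w z t := fun i hi => Fin.ext (by rw [hval, hi])
  constructor
  · intro i hi
    by_cases hj : ∃ j, wire w z j = i
    · obtain ⟨j, rfl⟩ := hj
      rw [hι.extend_apply, Function.update_of_ne]
      · rfl
      · rintro rfl
        exact hi (hval _)
    · rw [Function.extend_apply' _ _ _ hj]
  · have : SameAt (Function.extend (wire w z) (Function.update (y ∘ wire w z) t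
        ((y ∘ wire w z) t + f (y ∘ wire w z))) y) y (z + t.val) ↔ f (y ∘ wire w z) = 0 := by
      constructor
      · intro h
        have := h (wire w z t) (hval t)
        rw [hι.extend_apply, Function.update_self] at this
        simpa using this
      · intro h i hi
        rw [e i hi, hι.extend_apply, Function.update_self, h]
        simp
    rw [this]
    generalize f (y ∘ wire w z) = b
    revert b; decide

/-- The head flips the gap `z + 1` iff the carrier and the first two controls of the run are on. -/
lemma exists_acts_headAll {k : ℕ} [NeZero k] {W : ℕ → Bool} {z m : ℕ} (h : z + 1 + m < k)
    (hW : ∀ i, z + 1 < i → i ≤ z + 1 + m → W i = true) :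
    ∃ π φ, Acts (headAll z m : Circuit k).op π φ ∧ ∀ y : Basis k,
      (∀ i : Fin k, i.val ≠ z + 1 → π y i = y i) ∧
      (¬ SameAt (π y) y (z + 1) ↔
        (∀ i : Fin k, i.val = z → y i = 1) ∧ Ones W y (z + 1) (z + 1 + min m 2)) := by
  have at_iff : ∀ (y : Basis k) (w : ℕ) (i : Fin w), z + w ≤ k →
      ((y ∘ wire w z) i = 1 ↔ ∀ j : Fin k, j.val = z + i.val → y j = 1) := by
    intro y w i hw
    constructor
    · intro h j hj
      rw [show j = wire w z i from Fin.ext (by rw [wire_val hw, hj])]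
      exact h
    · intro h
      exact h _ (wire_val hw i)
  have two : ∀ a b : Fin 2, a * b = 1 ↔ a = 1 ∧ b = 1 := by decide
  rcases m with _ | _ | m
  · obtain ⟨π, φ, h1, h2⟩ := exists_acts_place_update (k := k) (z := z) (c := headMidZero)
      (f := fun y => y 0) (by omega) (exists_acts_CNOT 0 1)
    refine ⟨π, φ, h1, fun y => ⟨(h2 y).1, (h2 y).2.trans ?_⟩⟩
    rw [at_iff _ _ _ (by omega)]
    exact ⟨fun h => ⟨h, fun i h3 h4 => absurd h3 (by omega)⟩, fun h => h.1⟩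
  · obtain ⟨π, φ, h1, h2⟩ := exists_acts_place_update (k := k) (z := z)
      (f := fun y => y 0 * y 2) (by omega) acts_headOne
    refine ⟨π, φ, ?_, fun y => ⟨(h2 y).1, (h2 y).2.trans ?_⟩⟩
    · rw [place_append, place_place _ _ _ _ (by omega) rfl] at h1
      simpa [headAll, headLeft, headInner, headMid, headRight] using h1
    · rw [two, at_iff _ _ _ (by omega), at_iff _ _ _ (by omega)]
      refine and_congr_right fun _ => ⟨fun h i h3 h4 _ => h i (by simp only [Fin.val_two]; omega),
        fun h i h3 => ?_⟩
      simp only [Fin.val_two] at h3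
      exact h i (by omega) (by omega) (hW _ (by omega) (by omega))
  · obtain ⟨π, φ, h1, h2⟩ := exists_acts_place_update (k := k) (z := z)
      (f := fun y => y 0 * y 2 * y 3) (by omega) acts_headTwo
    refine ⟨π, φ, ?_, fun y => ⟨(h2 y).1, (h2 y).2.trans ?_⟩⟩
    · rw [place_append, place_append, place_append, place_place _ _ _ _ (by omega) rfl,
        place_place _ _ _ _ (by omega) rfl, place_place _ _ _ _ (by omega) rfl] at h1
      exact h1
    · rw [two, two, at_iff _ _ _ (by omega), at_iff _ _ _ (by omega), at_iff _ _ _ (by omega), and_assoc]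
      refine and_congr_right fun _ => ⟨fun h i h3 h4 _ => ?_, fun h => ⟨fun i h3 => ?_, fun i h3 => ?_⟩⟩
      · by_cases hi : i.val = z + 2
        · exact h.1 i hi
        · exact h.2 i (show i.val = z + 3 by omega)
      · simp only [Fin.val_two] at h3
        exact h i (by omega) (by omega) (hW _ (by omega) (by omega))
      · have h3 : i.val = z + 3 := h3
        exact h i (by omega) (by omega) (hW _ (by omega) (by omega))

/-- A head moves a difference from the carrier to the gap, provided that its controls are on: both
states have the same bit on the gap, and only one of them may flip it. -/
lemma carries_headAll {k : ℕ} [NeZero k] {W : ℕ → Bool} {z m : ℕ} (h : z + 1 + m < k)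
    (hW : ∀ i, z + 1 < i → i ≤ z + 1 + m → W i = true) (hz : W (z + 1) = false) :
    Carries W (headAll z m : Circuit k).flatten z z (z + 1) (z + 1 + min m 2) := by
  obtain ⟨π, φ, h1, h2⟩ := exists_acts_headAll h hW
  refine ⟨π, φ, h1, fun x y hxy _ => ?_⟩
  have hone : ∀ y : Basis k, Ones W y z (z + 1 + min m 2) ↔ Ones W y (z + 1) (z + 1 + min m 2) := by
    refine fun y => ⟨fun h => h.mono (by omega) le_rfl, fun h i h3 h4 h5 => h i ?_ h4 h5⟩
    rcases eq_or_ne i.val (z + 1) with e | e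
    · rw [e, hz] at h5
      simp at h5
    · omega
  refine ⟨fun i hi => ?_, fun i hi => (h2 y).1 i (by omega), ?_⟩
  · rw [(h2 x).1 i (by omega), hxy i (by omega)]
  · have a1 := (h2 x).2
    have a2 := (h2 y).2
    have ex : Ones W x (z + 1) (z + 1 + min m 2) ↔ Ones W y (z + 1) (z + 1 + min m 2) := by
      refine forall₃_congr fun i h3 _ => ?_
      rw [hxy i (by omega)]
    rw [hone, ← not_iff_not, not_not]
    rw [ex] at a1
    have at_iff : ∀ (x y : Basis k) v (hv : v < k), SameAt x y v ↔ x ⟨v, hv⟩ = y ⟨v, hv⟩ := by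
      refine fun x y v hv => ⟨fun h => h _ rfl, fun h i hi => ?_⟩
      rw [show i = ⟨v, hv⟩ from Fin.ext hi]
      exact h
    have one_iff : ∀ (x : Basis k) v (hv : v < k), (∀ i : Fin k, i.val = v → x i = 1) ↔ x ⟨v, hv⟩ = 1 := by
      refine fun x v hv => ⟨fun h => h _ rfl, fun h i hi => ?_⟩
      rw [show i = ⟨v, hv⟩ from Fin.ext hi]
      exact h
    have hd := hxy ⟨z + 1, by omega⟩ (by simp)
    rw [at_iff _ _ _ (by omega : z + 1 < k), one_iff _ z (by omega)] at a1 a2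
    rw [at_iff _ _ _ (by omega : z + 1 < k), at_iff _ _ z (by omega)]
    rw [hd] at a1
    generalize Ones W y (z + 1) (z + 1 + min m 2) = Q at *
    generalize π x ⟨z + 1, by omega⟩ = b1, π y ⟨z + 1, by omega⟩ = b2, x ⟨z, by omega⟩ = b3,
      y ⟨z, by omega⟩ = b4, y ⟨z + 1, by omega⟩ = b5 at *
    by_cases hQ : Q <;> simp only [hQ, and_true, and_false] at * <;> clear hQ <;>
    · clear h2 h1 hd ex hone at_iff one_iff
      revert b1 b2 b3 b4 b5
      decide

lemma par_nil {k : ℕ} (A : Circuit k) : par A [] = A := by cases A <;> rfl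

lemma par_concat {k : ℕ} {A B : Circuit k} (a b : List (Gate k)) (h : A.length = B.length) :
    par (A ++ [a]) (B ++ [b]) = par A B ++ [a ++ b] := by
  induction A, B using par.induct with
  | case1 B =>
    obtain rfl := List.eq_nil_of_length_eq_zero h.symm
    rfl
  | case2 A hA =>
    obtain rfl := List.eq_nil_of_length_eq_zero h
    rfl
  | case3 a A b B ih =>
    have := ih (by simpa using h)
    simp only [List.cons_append, par, this]

/-- The last step of an outer part of a head and the last step of the first layer of the tail act
on neighboring qubits; all the preceding steps are disjoint. -/
lemma par_tailLead {k : ℕ} [NeZero k] {c : Circuit 2} (hc : c.length = 6)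
    (hl : Circuit.IsLNN (c ++ [[.H 0]])) {d m : ℕ}
    (h : d + m < k) (hm : 2 ≤ m) :
    (par (place d (c ++ [[.H 0]])) (tailLead d m) : Circuit k).op =
      (tailLead d m : Circuit k).op * (place d (c ++ [[.H 0]]) : Circuit k).op ∧
    (par (place d (c ++ [[.H 0]])) (tailLead d m) : Circuit k).IsLNN := by
  obtain ⟨m, rfl⟩ := Nat.exists_eq_add_of_le' hm
  have hA : (place d (c ++ [[.H 0]]) : Circuit k).IsLNN := isLNN_place hl (by omega)
  have hX := isLNN_tailLead (k := k) h
  rw [tailLead_add_two] at *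
  have hp := two_mul_half_add_parity m
  rcases hj : m / 2 with _ | j
  · have ha : Apart (place d (c ++ [[.H 0]]) : Circuit k) (lead d 0 (m % 2 == 1)) := by
      rcases ho : (m % 2 == 1) with _ | _
      · intro g hg g' hg'
        simp [lead] at hg'
      · rw [hj, ho, Bool.toNat_true] at hp
        exact (On.place _ (by omega) (le_refl d) (le_refl (d + 2))).apart
          (On.place _ (by omega) (le_refl (d + 2)) (le_refl (d + 2 + 2))) (by omega)
    rw [hj] at hX
    exact ⟨op_par ha, isLNN_par hA hX ha⟩
  · have e : (lead d (j + 1) (m % 2 == 1) : Circuit k) =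
        place (d + 2) [[.H (0 : Fin 2)], [], [.CNOT 0 1], [.T 0, .Tdag 1], [.CNOT 1 0], []] ++
          place (d + 1) [[.H (0 : Fin 1)]] := by
      rw [lead, show pairLead = place 1 [[.H (0 : Fin 2)], [], [.CNOT 0 1], [.T 0, .Tdag 1],
        [.CNOT 1 0], []] ++ [[.H 0]] from rfl, place_append, place_place _ _ _ _ (by omega) rfl]
      rfl
    rw [hj, e] at hX
    rw [e]
    rw [place_append] at hA ⊢
    have hX' : (place (d + 2) [[.H (0 : Fin 2)], [], [.CNOT 0 1], [.T 0, .Tdag 1], [.CNOT 1 0], []] :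
        Circuit k).IsLNN := isLNN_place (by decide) (by omega)
    have hXl : (place (d + 1) [[.H (0 : Fin 1)]] : Circuit k).IsLNN := isLNN_place (by decide) (by omega)
    have hAl : (place d [[.H (0 : Fin 2)]] : Circuit k).IsLNN := isLNN_place (by decide) (by omega)
    have hA' : (place d c : Circuit k).IsLNN := fun s hs => hA s (by simp [hs])
    have oA : On d (d + 1) (place d c : Circuit k) := On.place _ (by omega) le_rfl le_rfl
    have oX : On (d + 2) (d + 3) (place (d + 2) [[.H (0 : Fin 2)], [], [.CNOT 0 1], [.T 0, .Tdag 1],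
        [.CNOT 1 0], []] : Circuit k) := On.place _ (by omega) le_rfl le_rfl
    have ea : (place d [[.H (0 : Fin 2)]] : Circuit k) = place d [[.H (0 : Fin 1)]] := rfl
    have oa : On d d (place d [[.H (0 : Fin 2)]] : Circuit k) := by
      rw [ea]; exact On.place _ (by omega) le_rfl le_rfl
    have ox : On (d + 1) (d + 1) (place (d + 1) [[.H (0 : Fin 1)]] : Circuit k) :=
      On.place _ (by omega) le_rfl le_rfl
    have key : par (place d c ++ place d [[.H (0 : Fin 2)]] : Circuit k)
        (place (d + 2) [[.H (0 : Fin 2)], [], [.CNOT 0 1], [.T 0, .Tdag 1], [.CNOT 1 0], []] ++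
          place (d + 1) [[.H (0 : Fin 1)]]) = par (place d c) (place (d + 2)
          [[.H (0 : Fin 2)], [], [.CNOT 0 1], [.T 0, .Tdag 1], [.CNOT 1 0], []]) ++
          par (place d [[.H (0 : Fin 2)]]) (place (d + 1) [[.H (0 : Fin 1)]]) :=
      par_concat _ _ (by simp [place, hc])
    rw [key]
    constructor
    · rw [Circuit.op_append, op_par (oA.apart oX (by omega)), op_par (oa.apart ox (by omega)),
        Circuit.op_append, Circuit.op_append, mul_assoc, mul_assoc]
      congr 1
      rw [← mul_assoc, ← mul_assoc, (oa.apart oX (by omega)).commute]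
    · exact isLNN_append (isLNN_par hA' hX' (oA.apart oX (by omega)))
        (isLNN_par hAl hXl (oa.apart ox (by omega)))

lemma par_headRight_tailLead {k : ℕ} [NeZero k] {d m : ℕ} (h : d + m < k) :
    (par (headRight d m) (tailLead d m) : Circuit k).op =
      (tailLead d m : Circuit k).op * (headRight d m : Circuit k).op ∧
    (par (headRight d m) (tailLead d m) : Circuit k).IsLNN := by
  rcases m with _ | _ | m
  · exact ⟨(mul_one _).symm, isLNN_nil⟩
  · exact ⟨(mul_one _).symm, isLNN_nil⟩
  · exact par_tailLead (c := [[.H 0], [], [.CNOT 0 1], [.Tdag 0, .T 1], [.CNOT 0 1], []]) rfl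
      (by decide) h (by omega)

lemma inv_place {w k : ℕ} [NeZero k] (d : ℕ) (c : Circuit w) :
    inv (place d c : Circuit k) = place d (inv c) := by
  simp only [inv, place, List.map_reverse, List.map_map]
  congr 1
  refine List.map_congr_left fun s _ => ?_
  simp only [Function.comp, List.map_reverse, List.map_map]
  congr 1
  refine List.map_congr_left fun g _ => ?_
  cases g <;> rfl

lemma par_inv_headLeft_tailLead {k : ℕ} [NeZero k] {d m : ℕ} (h : d + m < k) :
    (par (inv (headLeft d m)) (tailLead d m) : Circuit k).op =
      (tailLead d m : Circuit k).op * (inv (headLeft d m) : Circuit k).op ∧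
    (par (inv (headLeft d m)) (tailLead d m) : Circuit k).IsLNN := by
  rcases m with _ | _ | m
  · exact ⟨(mul_one _).symm, isLNN_nil⟩
  · rw [show (tailLead d 1 : Circuit k) = [] from rfl, par_nil]
    exact ⟨(one_mul _).symm, isLNN_inv (isLNN_headLeft h)⟩
  · rw [headLeft, inv_place]
    exact par_tailLead (c := [[.H 0], [], [.CNOT 0 1], [.T 1, .Tdag 0], [.CNOT 0 1], []]) rfl
      (by decide) h (by omega)

/-! ### All runs of controls -/

/-- The left outer parts of the heads of the runs of `m₁, m₂, …` controls that follow the qubit `z`.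
-/
def headLefts {k : ℕ} [NeZero k] (z : ℕ) : List ℕ → Circuit k
  | [] => []
  | m :: ms => par (headLeft (z + 1) m) (headLefts (z + 1 + m) ms)

/-- The left inner parts of the heads of the runs of `m₁, m₂, …` controls that follow the qubit `z`.
-/
def headInners {k : ℕ} [NeZero k] (z : ℕ) : List ℕ → Circuit k
  | [] => []
  | m :: ms => par (headInner (z + 1) m) (headInners (z + 1 + m) ms)

/-- The right parts of the heads, and the tails, of the runs of `m₁, m₂, …` controls that
follow the qubit `z`. -/
def items {k : ℕ} [NeZero k] (z : ℕ) : List ℕ → Circuit k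
  | [] => []
  | m :: ms => headMid z m ++ par (headRight (z + 1) m) (tailLead (z + 1) m) ++
      tailRest true (z + 1) m ++ items (z + 1 + m) ms

/-- The last qubit of the runs of `m₁, m₂, …` controls that follow the qubit `z`, each of them
preceded by a gap. -/
def lastQubit (z : ℕ) : List ℕ → ℕ
  | [] => z
  | m :: ms => lastQubit (z + 1 + m) ms

/-- The qubits after `z` are a gap, `m₁` controls, a gap, `m₂` controls, and so on. -/
def Runs (W : ℕ → Bool) (z : ℕ) : List ℕ → Prop
  | [] => True
  | m :: ms => W (z + 1) = false ∧ (∀ i, z + 1 < i → i ≤ z + 1 + m → W i = true) ∧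
      Runs W (z + 1 + m) ms

lemma le_lastQubit (z : ℕ) (ms : List ℕ) : z ≤ lastQubit z ms := by
  induction ms generalizing z with
  | nil => exact le_rfl
  | cons m ms ih => exact (by omega : z ≤ z + 1 + m).trans (ih _)

lemma on_headLefts {k : ℕ} [NeZero k] {z : ℕ} {ms : List ℕ} (h : lastQubit z ms < k) :
    On (z + 1) (lastQubit z ms) (headLefts z ms : Circuit k) := by
  induction ms generalizing z with
  | nil => exact On.nil
  | cons m ms ih =>
    have := le_lastQubit (z + 1 + m) ms
    rw [lastQubit] at *
    exact ((on_headLeft (by omega)).mono le_rfl (by omega)).par ((ih h).mono (by omega) le_rfl)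

lemma on_headInners {k : ℕ} [NeZero k] {z : ℕ} {ms : List ℕ} (h : lastQubit z ms < k) :
    On (z + 1) (lastQubit z ms) (headInners z ms : Circuit k) := by
  induction ms generalizing z with
  | nil => exact On.nil
  | cons m ms ih =>
    have := le_lastQubit (z + 1 + m) ms
    rw [lastQubit] at *
    exact ((on_headInner (by omega)).mono le_rfl (by omega)).par ((ih h).mono (by omega) le_rfl)

lemma on_items {k : ℕ} [NeZero k] {z : ℕ} {ms : List ℕ} (h : lastQubit z ms < k) :
    On z (lastQubit z ms) (items z ms : Circuit k) := by
  induction ms generalizing z with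
  | nil => exact On.nil
  | cons m ms ih =>
    have := le_lastQubit (z + 1 + m) ms
    rw [lastQubit] at *
    exact ((((on_headMid (by omega)).mono le_rfl (by omega)).append
      (((on_headRight (by omega)).mono (by omega) (by omega)).par
        ((on_tailLead (by omega)).mono (by omega) (by omega)))).append
      ((on_tailRest (by omega)).mono (by omega) (by omega))).append
      ((ih h).mono (by omega) le_rfl)

lemma isLNN_headLefts {k : ℕ} [NeZero k] {z : ℕ} {ms : List ℕ} (h : lastQubit z ms < k) :
    (headLefts z ms : Circuit k).IsLNN := by
  induction ms generalizing z with
  | nil => exact isLNN_nil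
  | cons m ms ih =>
    have := le_lastQubit (z + 1 + m) ms
    rw [lastQubit] at *
    exact isLNN_par (isLNN_headLeft (by omega)) (ih h)
      ((on_headLeft (by omega)).apart (on_headLefts h) (by omega))

lemma isLNN_headInners {k : ℕ} [NeZero k] {z : ℕ} {ms : List ℕ} (h : lastQubit z ms < k) :
    (headInners z ms : Circuit k).IsLNN := by
  induction ms generalizing z with
  | nil => exact isLNN_nil
  | cons m ms ih =>
    have := le_lastQubit (z + 1 + m) ms
    rw [lastQubit] at *
    exact isLNN_par (isLNN_headInner (by omega)) (ih h)
      ((on_headInner (by omega)).apart (on_headInners h) (by omega))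

lemma isLNN_items {k : ℕ} [NeZero k] {z : ℕ} {ms : List ℕ} (h : lastQubit z ms < k) :
    (items z ms : Circuit k).IsLNN := by
  induction ms generalizing z with
  | nil => exact isLNN_nil
  | cons m ms ih =>
    have := le_lastQubit (z + 1 + m) ms
    rw [lastQubit] at *
    exact isLNN_append (isLNN_append (isLNN_append (isLNN_headMid (by omega))
      (par_headRight_tailLead (by omega)).2) (isLNN_tailRest (by omega))) (ih h)

lemma carries_nil {k : ℕ} {W : ℕ → Bool} {v : ℕ} : Carries W ([] : List (Gate k)) v v v v := by
  refine ⟨id, _, acts_one, fun x y hxy _ => ⟨hxy, fun _ _ => rfl, ?_⟩⟩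
  simp only [id, iff_self_and]
  exact fun _ i h1 h2 => absurd h1 (by omega)

/-- The runs of controls carry a difference from the qubit `z` to the last qubit of the last run. -/
lemma carries_items {k : ℕ} [NeZero k] {W : ℕ → Bool} {z : ℕ} {ms : List ℕ} (h : lastQubit z ms < k)
    (hW : Runs W z ms) :
    Carries W (headLefts z ms ++ headInners z ms ++ items z ms : Circuit k).flatten z z
      (lastQubit z ms) (lastQubit z ms) := by
  induction ms generalizing z with
  | nil => exact carries_nil
  | cons m ms ih =>
    have hs := le_lastQubit (z + 1 + m) ms
    obtain ⟨hW1, hW2, hW3⟩ := hW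
    rw [lastQubit] at *
    have c1 := carries_headAll (k := k) (W := W) (z := z) (m := m) (by omega) hW2 hW1
    have c2 := carries_tail (k := k) (W := W) (f := true) (d := z + 1) (m := m) (by omega) hW2
    have c3 := (c1.append c2 (by omega) (by omega) (by omega) (by omega) (by omega)).append (ih h hW3)
      (by omega) (by omega) (by omega) (by omega) (by omega)
    refine c3.of_ev_eq ?_
    rw [← List.flatten_append, ← List.flatten_append, ← op_eq_ev, ← op_eq_ev]
    have oL := on_headLeft (k := k) (d := z + 1) (m := m) (by omega)
    have oN := on_headInner (k := k) (d := z + 1) (m := m) (by omega)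
    have oM := on_headMid (k := k) (z := z) (m := m) (by omega)
    have oR := on_headRight (k := k) (d := z + 1) (m := m) (by omega)
    have oX := on_tailLead (k := k) (d := z + 1) (m := m) (by omega)
    have oT := on_tailRest (k := k) (f := true) (d := z + 1) (m := m) (by omega)
    have oPA := on_headLefts (k := k) h
    have oPB := on_headInners (k := k) h
    have hX := (par_headRight_tailLead (k := k) (d := z + 1) (m := m) (by omega)).1
    simp only [headLefts, headInners, items, headAll, Circuit.op_append, hX,
      op_par (oL.apart oPA (by omega)), op_par (oN.apart oPB (by omega))]
    have a1 := (oN.apart oPA (by omega)).commute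
    have a2 := (oM.apart oPA (by omega)).commute
    have a3 := (oR.apart oPA (by omega)).commute
    have a4 := (oX.apart oPA (by omega)).commute
    have a5 := (oT.apart oPA (by omega)).commute
    have b2 := (oM.apart oPB (by omega)).commute
    have b3 := (oR.apart oPB (by omega)).commute
    have b4 := (oX.apart oPB (by omega)).commute
    have b5 := (oT.apart oPB (by omega)).commute
    generalize (headLeft (z + 1) m : Circuit k).op = L, (headInner (z + 1) m : Circuit k).op = N,
      (headMid z m : Circuit k).op = M, (headRight (z + 1) m : Circuit k).op = R,
      (tailLead (z + 1) m : Circuit k).op = X, (tailRest true (z + 1) m : Circuit k).op = T,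
      (headLefts (z + 1 + m) ms : Circuit k).op = PA,
      (headInners (z + 1 + m) ms : Circuit k).op = PB, (items (z + 1 + m) ms : Circuit k).op = I at *
    simp only [mul_assoc]
    rw [← mul_assoc N PA, a1, ← mul_assoc M PB, b2]
    simp only [mul_assoc]
    rw [← mul_assoc R PB, b3, ← mul_assoc M PA, a2]
    simp only [mul_assoc]
    rw [← mul_assoc X PB, b4, ← mul_assoc R PA, a3]
    simp only [mul_assoc]
    rw [← mul_assoc T PB, b5, ← mul_assoc X PA, a4]
    simp only [mul_assoc]
    rw [← mul_assoc T PA, a5]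
    simp only [mul_assoc]

/-! ### Conditional flips of a qubit -/

/-- The operator `A` adds the bit `f` to the qubit `t`. -/
def IsFlip {k : ℕ} (t : Fin k) (f : Basis k → Fin 2) (A : Op k) : Prop :=
  Acts A (fun y => Function.update y t (y t + f y)) (fun _ => 0)

lemma IsFlip.ket {k : ℕ} {t : Fin k} {f : Basis k → Fin 2} {A : Op k} (h : IsFlip t f A)
    (y : Basis k) : A *ᵥ ket y = LNN.ket (Function.update y t (y t + f y)) := by
  rw [h y, ph_zero, one_smul]

lemma isFlip_CNOT {k : ℕ} (c t : Fin k) : IsFlip t (fun y => y c) (Gate.CNOT c t).op := acts_CNOT c t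

lemma isFlip_pauliX {k : ℕ} (t : Fin k) : IsFlip t (fun _ => 1) (controlled pauliX ∅ t) := by
  intro y
  rw [controlled_ket, Fin.sum_univ_two]
  rcases Fin.exists_fin_two.mp ⟨y t, rfl⟩ with h' | h' <;> simp [h', pauliX]

lemma op_commute_pauliX {k : ℕ} {c : Circuit k} {t : Fin k} (h : ∀ g ∈ c.flatten, t ∉ g.qubits) :
    c.op * controlled pauliX ∅ t = controlled pauliX ∅ t * c.op := by
  rw [op_eq_ev]
  generalize c.flatten = l at h
  induction l with
  | nil => simp
  | cons g l ih =>
    have hg : g.op * controlled pauliX ∅ t = controlled pauliX ∅ t * g.op := by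
      have := h g (by simp)
      cases g <;> simp only [Gate.qubits, Finset.mem_insert, Finset.mem_singleton, not_or] at this <;>
        apply controlled_commute <;> simp_all [eq_comm]
    rw [ev_cons, mul_assoc, hg, ← mul_assoc, ih fun g hg => h g (by simp [hg]), mul_assoc]

/-- Conjugation by a monomial circuit that does not act on the qubit `t` transports the condition
of a conditional flip of `t`. -/
lemma IsFlip.conj {k : ℕ} {c : Circuit k} (hc : c.IsLNN) {t : Fin k}
    (ht : ∀ g ∈ c.flatten, t ∉ g.qubits) {π : Basis k → Basis k} {φ : Basis k → ZMod 8}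
    (hA : Acts c.op π φ) {f : Basis k → Fin 2} {F : Op k} (hF : IsFlip t f F) :
    IsFlip t (f ∘ π) ((inv c).op * (F * c.op)) := by
  intro y
  have hI : ∀ u, (inv c).op *ᵥ (c.op *ᵥ u) = u := fun u => by
    rw [mulVec_mulVec, op_inv_mul hc, one_mulVec]
  rw [ph_zero, one_smul, ← mulVec_mulVec, ← mulVec_mulVec, hA y, mulVec_smul, hF.ket]
  rcases Fin.exists_fin_two.mp ⟨f (π y), rfl⟩ with h | h
  · simp only [h, Function.comp, add_zero, Function.update_eq_self]
    rw [← hA y, hI]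
  · simp only [h, Function.comp]
    rw [← (isFlip_pauliX t).ket, ← mulVec_smul, ← hA y, mulVec_mulVec _ (controlled pauliX ∅ t),
      ← op_commute_pauliX ht, ← mulVec_mulVec, hI, (isFlip_pauliX t).ket]

lemma ket_injective {k : ℕ} {a b : ℂ} (ha : a ≠ 0) {x y : Basis k} (h : a • ket x = b • ket y) :
    x = y := by
  have := congrFun h x
  simp only [Pi.smul_apply, ket_apply, if_true, smul_eq_mul, mul_one] at this
  by_contra hxy
  rw [if_neg hxy, mul_zero] at this
  exact ha this

lemma Acts.update_of_commute {k : ℕ} {A : Op k} {π : Basis k → Basis k} {φ : Basis k → ZMod 8}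
    (hA : Acts A π φ) {t : Fin k} (h : A * controlled pauliX ∅ t = controlled pauliX ∅ t * A)
    (y : Basis k) (b : Fin 2) {i : Fin k} (hi : i ≠ t) :
    π (Function.update y t (y t + b)) i = π y i := by
  rcases Fin.exists_fin_two.mp ⟨b, rfl⟩ with rfl | rfl
  · simp
  · have hX := isFlip_pauliX t
    have := congrArg (· *ᵥ ket y) h
    simp only [← mulVec_mulVec] at this
    rw [hX.ket, hA y, mulVec_smul, hA, hX.ket] at this
    rw [ket_injective (ph_ne_zero _) this, Function.update_of_ne hi]

lemma IsFlip.mul {k : ℕ} {t : Fin k} {f g : Basis k → Fin 2} {F G : Op k} (hF : IsFlip t f F)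
    (hG : IsFlip t g G) (hf : ∀ y b, f (Function.update y t (y t + b)) = f y) :
    IsFlip t (fun y => g y + f y) (F * G) := by
  intro y
  rw [← mulVec_mulVec, hG.ket, hF.ket, hf]
  simp [add_assoc]

lemma IsFlip.congr {k : ℕ} {t : Fin k} {f g : Basis k → Fin 2} {F : Op k} (hF : IsFlip t f F)
    (h : ∀ y, f y = g y) : IsFlip t g F := (funext h : f = g) ▸ hF

/-! ### The circuit between the two swaps -/

/-- The circuit that carries a difference from the first gap `s + 1` to the qubit before the
target, without its parts that are executed once only. -/
def body {k : ℕ} [NeZero k] (s e : ℕ) (ms : List ℕ) : Circuit k :=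
  tailRest false (s + 1) e ++ items (s + 1 + e) ms

/-- The conditional flip of the target, between `body` and its inverse. -/
def mid {k : ℕ} [NeZero k] (s e : ℕ) (ms : List ℕ) : Circuit k :=
  body s e ms ++ place (lastQubit (s + 1 + e) ms) [[.CNOT (0 : Fin 2) 1]] ++ inv (body s e ms)

/-- The circuit that flips the qubit after the last run if the qubit `s` and all controls are on.
The qubit `s + 1` is a gap and is followed by `e` controls, and then by the runs `ms`. -/
def core {k : ℕ} [NeZero k] (s e : ℕ) (ms : List ℕ) : Circuit k :=
  par (headLefts (s + 1 + e) ms) (headLeft (s + 1) e) ++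
  par (headInners (s + 1 + e) ms) (headInner (s + 1) e) ++
  headMid s e ++ par (headRight (s + 1) e) (tailLead (s + 1) e) ++ mid s e ms ++
  inv (par (headRight (s + 1) e) (tailLead (s + 1) e)) ++ inv (headMid s e) ++
  inv (headInner (s + 1) e) ++ par (inv (headLeft (s + 1) e)) (tailLead (s + 1) e) ++ mid s e ms ++
  inv (headInners (s + 1 + e) ms) ++ par (inv (headLefts (s + 1 + e) ms)) (inv (tailLead (s + 1) e))

/-- The circuit that carries a difference from the first gap `s + 1` to the qubit before the target.
-/
def carrier {k : ℕ} [NeZero k] (s e : ℕ) (ms : List ℕ) : Circuit k :=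
  headLefts (s + 1 + e) ms ++ headInners (s + 1 + e) ms ++ tailLead (s + 1) e ++ body s e ms

lemma on_body {k : ℕ} [NeZero k] {s e : ℕ} {ms : List ℕ} (h : lastQubit (s + 1 + e) ms < k) :
    On s (lastQubit (s + 1 + e) ms) (body s e ms : Circuit k) := by
  have := le_lastQubit (s + 1 + e) ms
  exact ((on_tailRest (by omega)).mono (by omega) (by omega)).append
    ((on_items h).mono (by omega) le_rfl)

lemma on_carrier {k : ℕ} [NeZero k] {s e : ℕ} {ms : List ℕ} (h : lastQubit (s + 1 + e) ms < k) :
    On s (lastQubit (s + 1 + e) ms) (carrier s e ms : Circuit k) := by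
  have := le_lastQubit (s + 1 + e) ms
  exact ((((on_headLefts h).mono (by omega) le_rfl).append ((on_headInners h).mono (by omega) le_rfl)).append
    ((on_tailLead (by omega)).mono (by omega) (by omega))).append (on_body h)

lemma isLNN_body {k : ℕ} [NeZero k] {s e : ℕ} {ms : List ℕ} (h : lastQubit (s + 1 + e) ms < k) :
    (body s e ms : Circuit k).IsLNN := by
  have := le_lastQubit (s + 1 + e) ms
  exact isLNN_append (isLNN_tailRest (by omega)) (isLNN_items h)

lemma isLNN_carrier {k : ℕ} [NeZero k] {s e : ℕ} {ms : List ℕ} (h : lastQubit (s + 1 + e) ms < k) :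
    (carrier s e ms : Circuit k).IsLNN := by
  have := le_lastQubit (s + 1 + e) ms
  exact isLNN_append (isLNN_append (isLNN_append (isLNN_headLefts h) (isLNN_headInners h))
    (isLNN_tailLead (by omega))) (isLNN_body h)

lemma isLNN_mid {k : ℕ} [NeZero k] {s e : ℕ} {ms : List ℕ} (h : lastQubit (s + 1 + e) ms + 1 < k) :
    (mid s e ms : Circuit k).IsLNN :=
  isLNN_append (isLNN_append (isLNN_body (by omega)) (isLNN_place (by decide) (by omega)))
    (isLNN_inv (isLNN_body (by omega)))

lemma isLNN_core {k : ℕ} [NeZero k] {s e : ℕ} {ms : List ℕ} (h : lastQubit (s + 1 + e) ms + 1 < k) :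
    (core s e ms : Circuit k).IsLNN := by
  have hs := le_lastQubit (s + 1 + e) ms
  have h' : lastQubit (s + 1 + e) ms < k := by omega
  have oL := on_headLeft (k := k) (d := s + 1) (m := e) (by omega)
  have oN := on_headInner (k := k) (d := s + 1) (m := e) (by omega)
  have oX := on_tailLead (k := k) (d := s + 1) (m := e) (by omega)
  have hR := (par_headRight_tailLead (k := k) (d := s + 1) (m := e) (by omega)).2
  have hL := (par_inv_headLeft_tailLead (k := k) (d := s + 1) (m := e) (by omega)).2
  have lN := isLNN_headInner (k := k) (d := s + 1) (m := e) (by omega)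
  have lM := isLNN_headMid (k := k) (z := s) (m := e) (by omega)
  refine isLNN_append (isLNN_append (isLNN_append (isLNN_append (isLNN_append (isLNN_append
    (isLNN_append (isLNN_append (isLNN_append (isLNN_append (isLNN_append ?_ ?_) lM) hR)
    (isLNN_mid h)) (isLNN_inv hR)) (isLNN_inv lM)) (isLNN_inv lN)) hL) (isLNN_mid h))
    (isLNN_inv (isLNN_headInners h'))) ?_
  · exact isLNN_par (isLNN_headLefts h') (isLNN_headLeft (by omega))
      ((on_headLefts h').apart oL (by omega))
  · exact isLNN_par (isLNN_headInners h') lN ((on_headInners h').apart oN (by omega))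
  · exact isLNN_par (isLNN_inv (isLNN_headLefts h')) (isLNN_inv (isLNN_tailLead (by omega)))
      ((on_headLefts h').inv.apart oX.inv (by omega))

/-- The operator of a circuit, as an invertible operator. -/
def unit {k : ℕ} (c : Circuit k) (hc : c.IsLNN) : (Op k)ˣ :=
  ⟨c.op, (inv c).op, op_mul_inv hc, op_inv_mul hc⟩

lemma op_inv_of_op_eq {k : ℕ} {c a b : Circuit k} (hc : c.IsLNN) (ha : a.IsLNN) (hb : b.IsLNN)
    (h : c.op = b.op * a.op) : (inv c).op = (inv a).op * (inv b).op := by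
  have : unit c hc = unit b hb * unit a ha := Units.ext h
  have := congrArg (fun u : (Op k)ˣ => (↑u⁻¹ : Op k)) this
  rwa [_root_.mul_inv_rev, Units.val_mul] at this

/-- The parts `pa` and `pb` that are executed once only cancel in the middle of the commutator. -/
lemma core_reorder {G : Type*} [Group G] {pa pb l n m r x b g : G}
    (al : Commute pa l) (an : Commute pa n) (am : Commute pa m) (ar : Commute pa r)
    (bl : Commute pb l) (bn : Commute pb n) (bm : Commute pb m) (br : Commute pb r)
    (ax : Commute pa x) (bx : Commute pb x) :
    (x⁻¹ * pa⁻¹) * (pb⁻¹ * ((b⁻¹ * (g * b)) * ((x * l⁻¹) * (n⁻¹ * (m⁻¹ * ((r⁻¹ * x⁻¹) *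
      ((b⁻¹ * (g * b)) * ((x * r) * (m * ((n * pb) * (l * pa))))))))))) =
    ((b * (x * (pb * pa)))⁻¹ * (g * (b * (x * (pb * pa))))) * ((r * (m * (n * l)))⁻¹ *
      (((b * (x * (pb * pa)))⁻¹ * (g * (b * (x * (pb * pa))))) * (r * (m * (n * l))))) := by
  have hq : Commute (pb * pa) (r * (m * (n * l))) :=
    ((br.mul_right (bm.mul_right (bn.mul_right bl))).mul_left
      (ar.mul_right (am.mul_right (an.mul_right al))))
  have hx : Commute (pb * pa) x := bx.mul_left ax
  have e1 : n * pb * (l * pa) = n * l * (pb * pa) := by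
    rw [mul_assoc, ← mul_assoc pb, bl.eq, mul_assoc, mul_assoc]
  have e2 : (x⁻¹ * pa⁻¹) * pb⁻¹ = (pb * pa)⁻¹ * x⁻¹ := by
    rw [mul_assoc, ← _root_.mul_inv_rev, hx.inv_inv.eq]
  calc _ = ((x⁻¹ * pa⁻¹) * pb⁻¹) * (b⁻¹ * (g * b)) * x * (r * (m * (n * l)))⁻¹ * x⁻¹ *
        (b⁻¹ * (g * b)) * x * (r * m * (n * pb * (l * pa))) := by group
    _ = (pb * pa)⁻¹ * x⁻¹ * (b⁻¹ * (g * b)) * x * (r * (m * (n * l)))⁻¹ * x⁻¹ *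
        (b⁻¹ * (g * b)) * x * (r * (m * (n * l)) * (pb * pa)) := by rw [e1, e2]; group
    _ = (pb * pa)⁻¹ * x⁻¹ * (b⁻¹ * (g * b)) * x *
        ((pb * pa) * (r * (m * (n * l)))⁻¹ * (pb * pa)⁻¹) * x⁻¹ *
        (b⁻¹ * (g * b)) * x * (pb * pa * (r * (m * (n * l)))) := by
          rw [hq.inv_right.eq, mul_inv_cancel_right, hq.eq]
    _ = _ := by group

/-- Up to the order of commuting parts, the core is the product of a conditional flip of the target,
conjugated by the carrier, with the conjugate of the same flip by the first head. -/
lemma op_core {k : ℕ} [NeZero k] {s e : ℕ} {ms : List ℕ} (h : lastQubit (s + 1 + e) ms + 1 < k) :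
    (core s e ms : Circuit k).op =
      ((inv (carrier s e ms)).op * ((place (lastQubit (s + 1 + e) ms) [[.CNOT (0 : Fin 2) 1]]).op *
        (carrier s e ms).op)) * ((inv (headAll s e)).op *
      (((inv (carrier s e ms)).op * ((place (lastQubit (s + 1 + e) ms) [[.CNOT (0 : Fin 2) 1]]).op *
        (carrier s e ms).op)) * (headAll s e : Circuit k).op)) := by
  have hs := le_lastQubit (s + 1 + e) ms
  have h' : lastQubit (s + 1 + e) ms < k := by omega
  have oL := on_headLeft (k := k) (d := s + 1) (m := e) (by omega)
  have oN := on_headInner (k := k) (d := s + 1) (m := e) (by omega)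
  have oM := on_headMid (k := k) (z := s) (m := e) (by omega)
  have oR := on_headRight (k := k) (d := s + 1) (m := e) (by omega)
  have oX := on_tailLead (k := k) (d := s + 1) (m := e) (by omega)
  have oPA := on_headLefts (k := k) h'
  have oPB := on_headInners (k := k) h'
  have hR := par_headRight_tailLead (k := k) (d := s + 1) (m := e) (by omega)
  have hL := par_inv_headLeft_tailLead (k := k) (d := s + 1) (m := e) (by omega)
  have uL := isLNN_headLeft (k := k) (d := s + 1) (m := e) (by omega)
  have uN := isLNN_headInner (k := k) (d := s + 1) (m := e) (by omega)
  have uM := isLNN_headMid (k := k) (z := s) (m := e) (by omega)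
  have uR := isLNN_headRight (k := k) (d := s + 1) (m := e) (by omega)
  have uX := isLNN_tailLead (k := k) (d := s + 1) (m := e) (by omega)
  have uPA := isLNN_headLefts (k := k) h'
  have uPB := isLNN_headInners (k := k) h'
  have uB := isLNN_body (k := k) h'
  have uG : (place (lastQubit (s + 1 + e) ms) [[.CNOT (0 : Fin 2) 1]] : Circuit k).IsLNN :=
    isLNN_place (by decide) (by omega)
  have cm : ∀ {A B : Circuit k} (hA : A.IsLNN) (hB : B.IsLNN), Apart A B →
      Commute (unit A hA) (unit B hB) := fun _ _ h => Units.ext h.commute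
  have key := core_reorder (b := unit _ uB) (g := unit _ uG)
    (cm uPA uL (oPA.apart oL (by omega))) (cm uPA uN (oPA.apart oN (by omega)))
    (cm uPA uM (oPA.apart oM (by omega))) (cm uPA uR (oPA.apart oR (by omega)))
    (cm uPB uL (oPB.apart oL (by omega))) (cm uPB uN (oPB.apart oN (by omega)))
    (cm uPB uM (oPB.apart oM (by omega))) (cm uPB uR (oPB.apart oR (by omega)))
    (cm uPA uX (oPA.apart oX (by omega))) (cm uPB uX (oPB.apart oX (by omega)))
  have eC : unit (carrier s e ms : Circuit k) (isLNN_carrier h') =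
      unit _ uB * (unit _ uX * (unit _ uPB * unit _ uPA)) := Units.ext (by
    simp only [carrier, unit, Units.val_mul, Circuit.op_append])
  have eH : unit (headAll s e : Circuit k) (isLNN_headAll (by omega)) =
      unit _ uR * (unit _ uM * (unit _ uN * unit _ uL)) := Units.ext (by
    simp only [headAll, unit, Units.val_mul, Circuit.op_append])
  rw [← eC, ← eH] at key
  have := congrArg (fun u : (Op k)ˣ => (u : Op k)) key
  simp only [Units.val_mul] at this
  refine Eq.trans ?_ this
  simp only [core, mid, Circuit.op_append, op_par (oPA.apart oL (by omega)),
    op_par (oPB.apart oN (by omega)), hR.1, hL.1, op_inv_of_op_eq hR.2 uR uX hR.1,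
    op_par (oPA.inv.apart oX.inv (by omega))]
  rfl

lemma carries_carrier {k : ℕ} [NeZero k] {W : ℕ → Bool} {s e : ℕ} {ms : List ℕ}
    (h : lastQubit (s + 1 + e) ms < k) (hW : ∀ i, s + 1 < i → i ≤ s + 1 + e → W i = true)
    (hR : Runs W (s + 1 + e) ms) :
    Carries W (carrier s e ms : Circuit k).flatten (s + 1) (s + 1 + min e 2)
      (lastQubit (s + 1 + e) ms) (lastQubit (s + 1 + e) ms) := by
  have hs := le_lastQubit (s + 1 + e) ms
  have c1 := carries_tail (k := k) (f := false) (d := s + 1) (m := e) (by omega) hW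
  have c2 := c1.append (carries_items h hR) (by omega) (by omega) (by omega) (by omega) (by omega)
  refine c2.of_ev_eq ?_
  rw [← List.flatten_append, ← op_eq_ev, ← op_eq_ev]
  have oX := on_tailLead (k := k) (d := s + 1) (m := e) (by omega)
  have oT := on_tailRest (k := k) (f := false) (d := s + 1) (m := e) (by omega)
  have oPA := on_headLefts (k := k) h
  have oPB := on_headInners (k := k) h
  have a1 := (oX.apart oPA (by omega)).commute
  have a2 := (oT.apart oPA (by omega)).commute
  have b1 := (oX.apart oPB (by omega)).commute
  have b2 := (oT.apart oPB (by omega)).commute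
  simp only [carrier, body, Circuit.op_append, mul_assoc]
  rw [← mul_assoc (tailLead (s + 1) e).op, b1, mul_assoc, a1, ← mul_assoc (tailRest false (s + 1) e).op,
    b2, mul_assoc, ← mul_assoc (tailRest false (s + 1) e).op, a2, mul_assoc]

/-- The core flips the target iff the qubit `s` and all controls after the gap `s + 1` are on. -/
lemma isFlip_core {k : ℕ} [NeZero k] {W : ℕ → Bool} {s e : ℕ} {ms : List ℕ} {t : Fin k}
    (ht : lastQubit (s + 1 + e) ms + 1 = t.val) (hW : ∀ i, s + 1 < i → i ≤ s + 1 + e → W i = true)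
    (hR : Runs W (s + 1 + e) ms) : ∃ f, IsFlip t f (core s e ms).op ∧ ∀ y,
      f y = 1 ↔ (∀ i : Fin k, i.val = s → y i = 1) ∧ Ones W y (s + 1) (lastQubit (s + 1 + e) ms) := by
  have htk := t.isLt
  have hs := le_lastQubit (s + 1 + e) ms
  have h' : lastQubit (s + 1 + e) ms < k := by omega
  obtain ⟨π, φ, hA, hT⟩ := carries_carrier h' hW hR
  obtain ⟨ρ, ψ, hB, hH⟩ := exists_acts_headAll (k := k) (z := s) (m := e) (by omega) hW
  let u : Fin k := ⟨lastQubit (s + 1 + e) ms, h'⟩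
  have hg : IsFlip t (fun y => y u)
      (place (lastQubit (s + 1 + e) ms) [[.CNOT (0 : Fin 2) 1]] : Circuit k).op := by
    have hv := wire_val (k := k) (w := 2) (d := lastQubit (s + 1 + e) ms) (by omega)
    have e1 : wire 2 (lastQubit (s + 1 + e) ms) 0 = u := Fin.ext (hv 0)
    have e2 : wire 2 (lastQubit (s + 1 + e) ms) 1 = t := Fin.ext ((hv 1).trans ht)
    have : (place (lastQubit (s + 1 + e) ms) [[.CNOT (0 : Fin 2) 1]] : Circuit k).op =
        (Gate.CNOT u t).op := by
      rw [← e1, ← e2]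
      exact mul_one _
    rw [this]
    exact isFlip_CNOT u t
  have avoid : ∀ {c : Circuit k}, On s (lastQubit (s + 1 + e) ms) c → ∀ g ∈ c.flatten, t ∉ g.qubits := by
    intro c hc g hg hq
    have := hc g hg t hq
    omega
  have oC := on_carrier (k := k) h'
  have hM := hg.conj (isLNN_carrier h') (avoid oC) hA
  have oH := (on_headAll (k := k) (z := s) (m := e) (by omega)).mono (b' := lastQubit (s + 1 + e) ms)
    le_rfl (by omega)
  have hK := hM.conj (isLNN_headAll (by omega)) (avoid oH) hB
  -- The core is the product of two conditional flips of `t`: their conditions are the bit of `u` after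
  -- the carrier has acted on `y`, and after it has acted on the image of `y` under the head. They
  -- differ iff the carrier has moved the difference made by the head to `u`.
  rw [op_core (by omega)]
  refine ⟨_, hM.mul hK ?_, fun y => ?_⟩
  · intro y b
    refine hA.update_of_commute (op_commute_pauliX (avoid oC)) y b ?_
    intro e1
    have : u.val = t.val := congrArg Fin.val e1
    simp only [u] at this
    omega
  · obtain ⟨-, -, h3⟩ := hT (ρ y) y (fun i hi => (hH y).1 i (by omega))
      (fun hd => (((hH y).2.1 hd).2).mono le_rfl (by omega))
    have two : ∀ a b : Fin 2, a + b = 1 ↔ ¬ a = b := by decide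
    have same : SameAt (π (ρ y)) (π y) (lastQubit (s + 1 + e) ms) ↔ π (ρ y) u = π y u := by
      refine ⟨fun h => h u rfl, fun h i hi => ?_⟩
      rw [show i = u from Fin.ext hi]
      exact h
    rw [same] at h3
    simp only [Function.comp, two, h3, (hH y).2, and_assoc]
    exact and_congr_right fun _ => ⟨fun h => h.2, fun h => ⟨h.mono le_rfl (by omega), h⟩⟩

/-! ### Moving controls to neighboring qubits -/

/-- Two `CNOT` gates that copy the state of qubit `0` to qubit `1`. They also change
qubit `0`. -/
def shiftUp : Circuit 2 := [[.CNOT 1 0], [.CNOT 0 1]]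

/-- Two `CNOT` gates that copy the state of qubit `1` to qubit `0`, and also change
qubit `1`. -/
def shiftDown : Circuit 2 := [[.CNOT 0 1], [.CNOT 1 0]]

/-- Move the states of the qubits `1, …, μ` one qubit further, the last one first. The qubit `μ + 1`
is overwritten. -/
def pulls {k : ℕ} [NeZero k] : ℕ → Circuit k
  | 0 => []
  | μ + 1 => place (μ + 1) shiftUp ++ pulls μ

lemma acts_place_steps {w k : ℕ} [NeZero k] {c : Circuit w} {z : ℕ} (hz : z + w ≤ k)
    (hl : c.flatten.all (fun g => !g.isH) = true) :
    ∃ π φ, Acts (place z c : Circuit k).op π φ ∧ ∀ y : Basis k,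
      (∀ i : Fin k, i.val < z ∨ z + w ≤ i.val → π y i = y i) ∧
      (∀ (i : Fin k) (j : Fin w), i.val = z + j.val →
        π y i = (steps c.flatten (y ∘ wire w z, 0)).1 j) := by
  have hι := wire_injective (k := k) hz
  have hval := wire_val (k := k) hz
  rw [op_eq_ev, flatten_place, ev_map hι]
  refine ⟨_, _, (acts_steps _ hl).lift hι, fun y => ⟨fun i hi => ?_, fun i j hij => ?_⟩⟩
  · refine Function.extend_apply' _ _ _ ?_
    rintro ⟨j, rfl⟩
    rw [hval] at hi
    omega
  · rw [show i = wire w z j from Fin.ext (by rw [hval, hij]), hι.extend_apply]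

lemma acts_shiftUp {k : ℕ} [NeZero k] {d : ℕ} (h : d + 2 ≤ k) :
    ∃ π φ, Acts (place d shiftUp : Circuit k).op π φ ∧ ∀ y : Basis k,
      (∀ i : Fin k, i.val < d ∨ d + 2 ≤ i.val → π y i = y i) ∧
      (∀ i j : Fin k, i.val = d → j.val = d + 1 → π y j = y i) := by
  obtain ⟨π, φ, hA, hπ⟩ := acts_place_steps (k := k) (c := shiftUp) h rfl
  refine ⟨π, φ, hA, fun y => ⟨(hπ y).1, fun i j hi hj => ?_⟩⟩
  have key : ∀ a b : Fin 2, (steps shiftUp.flatten (![a, b], 0)).1 1 = a := by decide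
  rw [(hπ y).2 j 1 hj, show y ∘ wire 2 d = ![(y ∘ wire 2 d) 0, (y ∘ wire 2 d) 1] by
    ext i; fin_cases i <;> rfl, key]
  exact congrArg y (Fin.ext (by rw [wire_val h, hi]; rfl))

lemma acts_shiftDown {k : ℕ} [NeZero k] {d : ℕ} (h : d + 2 ≤ k) :
    ∃ π φ, Acts (place d shiftDown : Circuit k).op π φ ∧ ∀ y : Basis k,
      (∀ i : Fin k, i.val < d ∨ d + 2 ≤ i.val → π y i = y i) ∧
      (∀ i j : Fin k, i.val = d + 1 → j.val = d → π y j = y i) := by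
  obtain ⟨π, φ, hA, hπ⟩ := acts_place_steps (k := k) (c := shiftDown) h rfl
  refine ⟨π, φ, hA, fun y => ⟨(hπ y).1, fun i j hi hj => ?_⟩⟩
  have key : ∀ a b : Fin 2, (steps shiftDown.flatten (![a, b], 0)).1 0 = b := by decide
  rw [(hπ y).2 j 0 hj, show y ∘ wire 2 d = ![(y ∘ wire 2 d) 0, (y ∘ wire 2 d) 1] by
    ext i; fin_cases i <;> rfl, key]
  exact congrArg y (Fin.ext (by rw [wire_val h, hi]; rfl))

lemma acts_pulls {k : ℕ} [NeZero k] {μ : ℕ} (h : μ + 2 ≤ k) :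
    ∃ π φ, Acts (pulls μ : Circuit k).op π φ ∧ ∀ y : Basis k,
      (∀ i : Fin k, i.val = 0 ∨ μ + 1 < i.val → π y i = y i) ∧
      (∀ i j : Fin k, 1 ≤ i.val → i.val ≤ μ → j.val = i.val + 1 → π y j = y i) := by
  induction μ with
  | zero => exact ⟨id, _, acts_one, fun y => ⟨fun _ _ => rfl, fun i j _ _ => by omega⟩⟩
  | succ μ ih =>
    obtain ⟨π, φ, hA, hπ⟩ := ih (by omega)
    obtain ⟨ρ, ψ, hB, hρ⟩ := acts_shiftUp (k := k) (d := μ + 1) (by omega)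
    rw [pulls, Circuit.op_append]
    refine ⟨_, _, hA.comp hB, fun y => ⟨fun i hi => ?_, fun i j h1 h2 h3 => ?_⟩⟩
    · rw [Function.comp, (hπ _).1 i (by omega), (hρ y).1 i (by omega)]
    · rcases eq_or_ne i.val (μ + 1) with h4 | h4
      · rw [Function.comp, (hπ _).1 j (by omega), (hρ y).2 i j h4 (by omega)]
      · rw [Function.comp, (hπ _).2 i j h1 (by omega) h3, (hρ y).1 i (by omega)]

lemma on_pulls {k : ℕ} [NeZero k] {μ : ℕ} (h : μ + 2 ≤ k) : On 0 (μ + 1) (pulls μ : Circuit k) := by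
  induction μ with
  | zero => exact On.nil
  | succ μ ih =>
    exact (On.place _ (by omega) (by omega) (by omega)).append ((ih (by omega)).mono le_rfl (by omega))

lemma isLNN_pulls {k : ℕ} [NeZero k] {μ : ℕ} (h : μ + 2 ≤ k) : (pulls μ : Circuit k).IsLNN := by
  induction μ with
  | zero => exact isLNN_nil
  | succ μ ih => exact isLNN_append (isLNN_place (by decide) (by omega)) (ih (by omega))

/-! ### Exchanging the target with a control -/

lemma isFlip_mcx {k : ℕ} (C : Finset (Fin k)) (t : Fin k) :
    IsFlip t (fun y => if ∀ c ∈ C, y c = 1 then 1 else 0) (mcx C t) := by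
  intro y
  rw [mcx, controlled_ket, Fin.sum_univ_two]
  by_cases h : ∀ c ∈ C, y c = 1
  · simp only [if_pos h]
    rcases Fin.exists_fin_two.mp ⟨y t, rfl⟩ with h' | h' <;> simp [h', pauliX]
  · simp only [if_neg h]
    rcases Fin.exists_fin_two.mp ⟨y t, rfl⟩ with h' | h' <;> simp [h', Matrix.one_apply]

lemma IsFlip.eq_mcx {k : ℕ} {C : Finset (Fin k)} {t : Fin k} {f : Basis k → Fin 2} {F : Op k}
    (hF : IsFlip t f F) (hf : ∀ y, f y = 1 ↔ ∀ c ∈ C, y c = 1) : F = mcx C t := by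
  refine (hF.congr fun y => ?_).unique (isFlip_mcx C t)
  by_cases h : ∀ c ∈ C, y c = 1
  · rw [if_pos h]; exact (hf y).2 h
  · rw [if_neg h]
    have := mt (hf y).1 h
    generalize f y = b at this ⊢
    revert b; decide

/-- The multi-controlled `Z` gate on the qubits in `S`. -/
def mcz {k : ℕ} (S : Finset (Fin k)) : Op k :=
  Matrix.diagonal fun y => ph (if ∀ c ∈ S, y c = 1 then 4 else 0)

lemma acts_mcz {k : ℕ} (S : Finset (Fin k)) :
    Acts (mcz S) id (fun y => if ∀ c ∈ S, y c = 1 then 4 else 0) := by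
  intro y
  ext x
  rw [mulVec_ket, mcz, Matrix.diagonal_apply, Pi.smul_apply, ket_apply]
  by_cases h : x = y
  · subst h; simp
  · simp [h]

/-- The multi-controlled `X` gate is a multi-controlled `Z` gate between Hadamard gates on the
target. As the `Z` gate is symmetric in all its qubits, the target can be exchanged with any
control. -/
lemma H_mul_mcz_mul_H {k : ℕ} {S : Finset (Fin k)} {t : Fin k} (ht : t ∈ S) :
    (Gate.H t).op * mcz S * (Gate.H t).op = mcx (S.erase t) t := by
  have := acts_bracket (acts_mcz S) t t (fun y => if ∀ c ∈ S.erase t, y c = 1 then 1 else 0)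
    (fun y => by simp) (fun y => by
      have h0 : ¬ ∀ c ∈ S, Function.update y t 0 c = 1 := fun h => by simpa using h t ht
      have h1 : (∀ c ∈ S, Function.update y t 1 c = 1) ↔ ∀ c ∈ S.erase t, y c = 1 := by
        refine ⟨fun h c hc => ?_, fun h c hc => ?_⟩
        · rw [Finset.mem_erase] at hc
          rw [← h c hc.2, Function.update_of_ne hc.1]
        · by_cases hct : c = t
          · subst hct; simp
          · rw [Function.update_of_ne hct]; exact h c (by simp [hc, hct])
      rw [if_neg h0]
      by_cases h : ∀ c ∈ S.erase t, y c = 1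
      · rw [if_pos (h1.2 h), if_pos h]; simp
      · rw [if_neg (mt h1.1 h), if_neg h]; simp)
  refine this.unique (fun y => ?_)
  have h0 : ¬ ∀ c ∈ S, Function.update y t 0 c = 1 := fun h => by simpa using h t ht
  dsimp only
  rw [if_neg h0, isFlip_mcx _ _ y]
  simp

lemma H_mul_H {k : ℕ} (t : Fin k) : (Gate.H t).op * (Gate.H t).op = 1 :=
  Gate.dag_op_mul (.H t) (by simp)

/-- The Hadamard gates that exchange the target `u` of a multi-controlled gate with its control `t`.
-/
def exchange {k : ℕ} (t u : Fin k) : Circuit k := if t = u then [] else [[.H t, .H u]]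

lemma exchange_mcx {k : ℕ} {S : Finset (Fin k)} {t u : Fin k} (ht : t ∈ S) (hu : u ∈ S) :
    (exchange t u).op * (mcx (S.erase u) u * (exchange t u).op) = mcx (S.erase t) t := by
  by_cases h : t = u
  · subst h; simp [exchange, Circuit.op_nil]
  · have hc : (Gate.H u).op * (Gate.H t).op = (Gate.H t).op * (Gate.H u).op :=
      Gate.op_commute (by simpa [Gate.qubits] using Ne.symm h)
    have e : (exchange t u).op = (Gate.H t).op * (Gate.H u).op := by
      rw [exchange, if_neg h, ← hc, Circuit.op_cons, ev_cons, ev_cons]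
      simp [Circuit.op_nil]
    rw [← H_mul_mcz_mul_H ht, ← H_mul_mcz_mul_H hu, e]
    calc _ = (Gate.H t).op * (((Gate.H u).op * (Gate.H u).op) * mcz S *
          ((Gate.H u).op * ((Gate.H t).op * (Gate.H u).op))) := by simp only [mul_assoc]
      _ = _ := by rw [← hc, ← mul_assoc (Gate.H u).op, H_mul_H]; simp only [one_mul, mul_assoc]

lemma isLNN_exchange {k : ℕ} (t u : Fin k) : (exchange t u).IsLNN := by
  unfold exchange
  split_ifs with h
  · exact isLNN_nil
  · intro s hs
    rw [List.mem_singleton] at hs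
    subst hs
    simp [Gate.qubits, Gate.NearestNeighbor, h]

/-! ### Cost and depth of the tail of a run -/

lemma cost_place (p : GateType) {w k : ℕ} [NeZero k] (d : ℕ) (c : Circuit w) :
    Circuit.cost p.is (place d c : Circuit k) = c.cost p.is := cost_map p _ c

lemma depth_place (p : GateType) {w k : ℕ} [NeZero k] (d : ℕ) (c : Circuit w) :
    Circuit.depth p.is (place d c : Circuit k) = c.depth p.is := depth_map p _ c

lemma cost_nil {k : ℕ} (p : Gate k → Bool) : Circuit.cost p [] = 0 := rfl

lemma depth_nil {k : ℕ} (p : Gate k → Bool) : Circuit.depth p [] = 0 := rfl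

/-- The cost of a tail: `P` for each pair, `a` for the end, and `b` more for the end of an odd run.
-/
lemma cost_rest_add_cost_lead (p : GateType) {f : Bool} {P E q a b : ℕ}
    (hP : (pairLead.cost p.is + (pairOne f).cost p.is + (pairTwo f).cost p.is +
      (pairThree f false).cost p.is) + E = P)
    (hE : (pairPend f).cost p.is + q = E)
    (hfin : ∀ pnd, (pairThree f (pnd && !f)).cost p.is = (pairThree f false).cost p.is +
      if pnd then q else 0)
    (hH : ∀ pnd, (if pnd && !f then [[.H (0 : Fin 1)]] else [] : Circuit 1).cost p.is =
      if pnd then q else 0)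
    (ha : finishEven.cost p.is = a) (hb : oddLead.cost p.is + finishOdd.cost p.is = a + b)
    {k : ℕ} [NeZero k] (pnd : Bool) (w j : ℕ) (o : Bool) :
    (rest f pnd w j o : Circuit k).cost p.is + (lead w j o : Circuit k).cost p.is =
      j * P + a + b * o.toNat + if pnd then E else 0 := by
  have hp : ∀ w, (pend f pnd w : Circuit k).cost p.is = if pnd then (pairPend f).cost p.is else 0 := by
    intro w
    cases pnd
    · rfl
    · exact cost_place p _ _
  induction j generalizing w pnd with
  | zero =>
    have hH' : (if pnd && !f then place w [[.H (0 : Fin 1)]] else [] : Circuit k).cost p.is =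
        if pnd then q else 0 := by
      rw [← hH]
      split_ifs
      · exact cost_place p _ _
      · rfl
    rw [rest, cost_append, cost_append, hH', hp]
    cases o
    · simp only [finish, lead, cost_place, cost_nil, Bool.toNat_false]
      split_ifs <;> omega
    · simp only [finish, lead, cost_place, Bool.toNat_true]
      split_ifs <;> omega
  | succ j ih =>
    have e := ih true (w + 2) (fun w => cost_place p _ _)
    rw [if_pos rfl] at e
    rw [rest, cost_append, cost_append, cost_append, cost_par, cost_par, hp]
    have hl : (lead w (j + 1) o : Circuit k) = place (w + 1) pairLead := rfl
    rw [hl, cost_place, cost_place, cost_place, cost_place, hfin, add_mul, one_mul]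
    cases pnd
    · simp only [Bool.false_eq_true, if_false]
      omega
    · simp only [if_true]
      omega

instance decidableFits {k : ℕ} (p : Gate k → Bool) : ∀ (c : Circuit k) (m : List Bool), Decidable (Fits p c m)
  | [], _ => isTrue trivial
  | _ :: _, [] => isFalse id
  | s :: c, b :: m =>
    have := decidableFits p c m
    inferInstanceAs (Decidable ((s.any p = true → b = true) ∧ Fits p c m))

lemma fits_place (p : GateType) {w k : ℕ} [NeZero k] (d : ℕ) {c : Circuit w} {m : List Bool}
    (h : Fits p.is c m) : Fits p.is (place d c : Circuit k) m := fits_map p _ h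

/-- The depth of a tail: `P` for each pair, `E` for the last layer of the last pair (which is
executed on its own), `a` for the end, `b` more for the end of an odd run, and `δ` less in the layer
that the last pair shares with the end of the run. -/
lemma depth_rest_le (p : GateType) {f : Bool} {P E a b δ B : ℕ} (mA mC mC' : List Bool)
    (hA : Fits p.is (pairPend f) mA ∧ Fits p.is (pairOne f) mA)
    (hB : (pairTwo f).depth p.is = B)
    (hC : ∀ pnd, Fits p.is (pairThree f (pnd && !f)) mC) (hC1 : Fits p.is pairLead mC)
    (hC' : ∀ pnd, Fits p.is (pairThree f (pnd && !f)) mC') (hC1' : Fits p.is oddLead mC')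
    (hP : mA.count true + B + mC.count true ≤ P) (hP' : mA.count true + B + mC'.count true + δ ≤ P)
    (hE : (pairPend f).depth p.is +
      (if !f then [[.H (0 : Fin 1)]] else [] : Circuit 1).depth p.is ≤ E)
    (ha : finishEven.depth p.is ≤ a) (hb : finishOdd.depth p.is ≤ a + b)
    {k : ℕ} [NeZero k] (pnd : Bool) (w j : ℕ) (o : Bool) :
    (rest f pnd w j o : Circuit k).depth p.is + (if j = 0 then 0 else δ) ≤
      j * P + a + b * o.toNat + if pnd ∨ j ≠ 0 then E else 0 := by
  have hp : ∀ w, Fits p.is (pend f pnd w : Circuit k) mA := by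
    intro w
    cases pnd
    · trivial
    · exact fits_place p _ hA.1
  induction j generalizing w pnd with
  | zero =>
    have hpE : (pend f pnd w : Circuit k).depth p.is + Circuit.depth p.is
        (if pnd && !f then place w [[.H (0 : Fin 1)]] else [] : Circuit k) ≤ if pnd then E else 0 := by
      cases pnd
      · simp [pend, depth_nil]
      · rw [if_pos rfl]
        refine le_trans (le_of_eq ?_) hE
        congr 1
        · exact depth_place p _ _
        · cases f
          · exact depth_place p _ _
          · rfl
    have hfin : (finish w o : Circuit k).depth p.is ≤ a + b * o.toNat := by
      cases o
      · rw [finish, depth_place, Bool.toNat_false]; omega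
      · rw [finish, depth_place, Bool.toNat_true]; omega
    rw [rest, depth_append, depth_append]
    simp only [ne_eq, not_true_eq_false, or_false, if_true]
    omega
  | succ j ih =>
    have e := ih true (w + 2) (fun w => fits_place p _ hA.1)
    have h1 := ((hp w).par (fits_place p (k := k) (w + 1) hA.2)).depth_le
    rw [rest, depth_append, depth_append, depth_append, depth_place, hB]
    rw [add_mul, one_mul]
    simp only [ne_eq, Nat.add_eq_zero_iff, one_ne_zero, and_false, not_false_eq_true, or_true,
      true_or, if_true, if_false] at e ⊢
    rcases j with _ | j
    · have h2 : Circuit.depth p.is (par (place w (pairThree f (pnd && !f))) (lead (w + 2) 0 o) :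
          Circuit k) ≤ mC'.count true := by
        refine ((fits_place p _ (hC' pnd)).par ?_).depth_le
        cases o
        · trivial
        · exact fits_place p _ hC1'
      simp only [if_true] at e
      omega
    · have h2 := ((fits_place p (k := k) w (hC pnd)).par (B := lead (w + 2) (j + 1) o)
        (fits_place p _ hC1)).depth_le
      simp only [Nat.add_eq_zero_iff, one_ne_zero, and_false, if_false] at e
      omega

/-- The cost of the tail of a run of at least two controls. -/
lemma cost_tail_cnot {k : ℕ} [NeZero k] (f : Bool) (d m : ℕ) :
    (tailRest f d (m + 2) : Circuit k).cost cnotType.is + (tailLead d (m + 2) : Circuit k).cost cnotType.is =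
      m / 2 * (if f then 11 else 9) + 2 + 4 * (m % 2 == 1).toNat := by
  rw [tailLead_add_two, tailRest]
  cases f
  · exact cost_rest_add_cost_lead cnotType (E := 2) (q := 0) (by decide) (by decide) (by decide)
      (by decide) (by decide) (by decide) false d (m / 2) _
  · exact cost_rest_add_cost_lead cnotType (E := 1) (q := 0) (by decide) (by decide) (by decide)
      (by decide) (by decide) (by decide) false d (m / 2) _

lemma cost_tail_t {k : ℕ} [NeZero k] (f : Bool) (d m : ℕ) :
    (tailRest f d (m + 2) : Circuit k).cost tType.is + (tailLead d (m + 2) : Circuit k).cost tType.is =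
      m / 2 * 8 + 4 * (m % 2 == 1).toNat := by
  rw [tailLead_add_two, tailRest]
  cases f
  · exact cost_rest_add_cost_lead tType (f := false) (P := 8) (b := 4) (E := 2) (q := 0) (a := 0) (by decide) (by decide) (by decide)
      (by decide) (by decide) (by decide) false d (m / 2) _
  · exact cost_rest_add_cost_lead tType (f := true) (P := 8) (b := 4) (E := 0) (q := 0) (a := 0) (by decide) (by decide) (by decide)
      (by decide) (by decide) (by decide) false d (m / 2) _

lemma cost_tail_h {k : ℕ} [NeZero k] (f : Bool) (d m : ℕ) :
    (tailRest f d (m + 2) : Circuit k).cost hType.is + (tailLead d (m + 2) : Circuit k).cost hType.is =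
      m / 2 * 4 + 2 * (m % 2 == 1).toNat := by
  rw [tailLead_add_two, tailRest]
  cases f
  · exact cost_rest_add_cost_lead hType (f := false) (P := 4) (b := 2) (E := 1) (q := 1) (a := 0) (by decide) (by decide) (by decide)
      (by decide) (by decide) (by decide) false d (m / 2) _
  · exact cost_rest_add_cost_lead hType (f := true) (P := 4) (b := 2) (E := 0) (q := 0) (a := 0) (by decide) (by decide) (by decide)
      (by decide) (by decide) (by decide) false d (m / 2) _

lemma depth_tailRest_cnot {k : ℕ} [NeZero k] (f : Bool) (d m : ℕ) :
    (tailRest f d (m + 2) : Circuit k).depth cnotType.is ≤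
      m / 2 * (if f then 6 else 5) + 2 + 2 * (m % 2 == 1).toNat +
        if m / 2 = 0 then 0 else if f then 1 else 2 := by
  rw [tailRest]
  cases f
  · have := depth_rest_le cnotType (f := false) (P := 5) (E := 2) (a := 2) (b := 2) (δ := 0) (k := k)
      [true, true, false, true] [false, false, true, false, true, false, false]
      [false, false, true, false, true, false, false]
      (by decide) rfl (by decide) (by decide) (by decide) (by decide) (by decide) (by decide)
      (by decide) (by decide) (by decide) false d (m / 2) (m % 2 == 1)
    by_cases h : m / 2 = 0 <;> simp [h] at this ⊢ <;> omega
  · have := depth_rest_le cnotType (f := true) (P := 6) (E := 1) (a := 2) (b := 2) (δ := 0) (k := k)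
      [true] [false, true, true, false, true, false, false]
      [false, true, true, false, true, false, false]
      (by decide) rfl (by decide) (by decide) (by decide) (by decide) (by decide) (by decide)
      (by decide) (by decide) (by decide) false d (m / 2) (m % 2 == 1)
    by_cases h : m / 2 = 0 <;> simp [h] at this ⊢ <;> omega

lemma depth_tailRest_t {k : ℕ} [NeZero k] (f : Bool) (d m : ℕ) :
    (tailRest f d (m + 2) : Circuit k).depth tType.is ≤
      m / 2 * 2 + (m % 2 == 1).toNat + if m / 2 = 0 then 0 else if f then 0 else 1 := by
  rw [tailRest]
  cases f
  · have := depth_rest_le tType (f := false) (P := 2) (E := 1) (a := 0) (b := 1) (δ := 0) (k := k)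
      [false, false, true, false] [false, false, false, true, false, false, false]
      [false, false, false, true, false, false, false]
      (by decide) rfl (by decide) (by decide) (by decide) (by decide) (by decide) (by decide)
      (by decide) (by decide) (by decide) false d (m / 2) (m % 2 == 1)
    by_cases h : m / 2 = 0 <;> simp [h] at this ⊢ <;> omega
  · have := depth_rest_le tType (f := true) (P := 2) (E := 0) (a := 0) (b := 1) (δ := 0) (k := k)
      [false] [false, false, false, true, false, false, false]
      [false, false, false, true, false, false, false]
      (by decide) rfl (by decide) (by decide) (by decide) (by decide) (by decide) (by decide)
      (by decide) (by decide) (by decide) false d (m / 2) (m % 2 == 1)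
    by_cases h : m / 2 = 0 <;> simp [h] at this ⊢ <;> omega

lemma depth_tailRest_h {k : ℕ} [NeZero k] (f : Bool) (d m : ℕ) :
    (tailRest f d (m + 2) : Circuit k).depth hType.is ≤ m / 2 * 2 + (m % 2 == 1).toNat := by
  rw [tailRest]
  cases f
  · have := depth_rest_le hType (f := false) (P := 2) (E := 1) (a := 0) (b := 1) (δ := 1) (k := k)
      [false, false, false, false] [true, false, false, false, false, false, true]
      [true, false, false, false, false, false, false]
      (by decide) rfl (by decide) (by decide) (by decide) (by decide) (by decide) (by decide)
      (by decide) (by decide) (by decide) false d (m / 2) (m % 2 == 1)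
    by_cases h : m / 2 = 0 <;> simp [h] at this ⊢ <;> omega
  · have := depth_rest_le hType (f := true) (P := 2) (E := 0) (a := 0) (b := 1) (δ := 0) (k := k)
      [false] [true, false, false, false, false, false, true]
      [true, false, false, false, false, false, true]
      (by decide) rfl (by decide) (by decide) (by decide) (by decide) (by decide) (by decide)
      (by decide) (by decide) (by decide) false d (m / 2) (m % 2 == 1)
    by_cases h : m / 2 = 0 <;> simp [h] at this ⊢ <;> omega

lemma tailLead_zero {k : ℕ} [NeZero k] (d : ℕ) : (tailLead d 0 : Circuit k) = [] := rfl

lemma tailLead_one {k : ℕ} [NeZero k] (d : ℕ) : (tailLead d (0 + 1) : Circuit k) = [] := rfl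

/-! ### Cost of the core -/

/-- The part of the circuit that belongs to one run and that is executed four times. -/
def item {k : ℕ} [NeZero k] (z m : ℕ) : Circuit k :=
  headMid z m ++ par (headRight (z + 1) m) (tailLead (z + 1) m) ++ tailRest true (z + 1) m

lemma cost_item (p : GateType) {k : ℕ} [NeZero k] (z m : ℕ) :
    (item z m : Circuit k).cost p.is = (headMid z m : Circuit k).cost p.is +
      (headRight (z + 1) m : Circuit k).cost p.is + ((tailRest true (z + 1) m : Circuit k).cost p.is +
      (tailLead (z + 1) m : Circuit k).cost p.is) := by
  rw [item, cost_append, cost_append, cost_par]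
  omega

lemma cost_items_le (p : GateType) {k : ℕ} [NeZero k] {A B : ℕ}
    (h : ∀ z m, 2 * ((headLeft (z + 1) m : Circuit k).cost p.is +
      (headInner (z + 1) m : Circuit k).cost p.is) + 4 * (item z m : Circuit k).cost p.is ≤ A * m + B)
    (z : ℕ) (ms : List ℕ) :
    2 * ((headLefts z ms : Circuit k).cost p.is + (headInners z ms : Circuit k).cost p.is) +
      4 * (items z ms : Circuit k).cost p.is ≤ A * ms.sum + B * ms.length := by
  induction ms generalizing z with
  | nil => simp [headLefts, headInners, items, cost_nil]
  | cons m ms ih =>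
    have h1 := h z m
    have h2 := ih (z + 1 + m)
    rw [item] at h1
    rw [headLefts, headInners, items, cost_par, cost_par, cost_append, List.sum_cons,
      List.length_cons, Nat.mul_add A, Nat.mul_add B, Nat.mul_one B]
    omega

lemma cost_item_cnot {k : ℕ} [NeZero k] (z m : ℕ) :
    2 * ((headLeft (z + 1) m : Circuit k).cost cnotType.is +
      (headInner (z + 1) m : Circuit k).cost cnotType.is) +
      4 * (item z m : Circuit k).cost cnotType.is ≤ 22 * m + 4 := by
  rw [cost_item]
  rcases m with _ | _ | m
  · simp only [headLeft, headInner, headMid, headRight, tailRest, tailLead_zero, cost_nil, cost_place]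
    decide
  · simp only [headLeft, headInner, headMid, headRight, tailRest, tailLead_one, cost_nil, cost_place]
    decide
  · have e := two_mul_half_add_parity m
    rw [cost_tail_cnot, headLeft, headInner, headMid, headRight, cost_place, cost_place, cost_place,
      cost_place, show headLeftTwo.cost cnotType.is = 2 from rfl,
      show headInnerTwo.cost cnotType.is = 3 from rfl, show headMidTwo.cost cnotType.is = 5 from rfl,
      show headRightTwo.cost cnotType.is = 2 from rfl, if_pos rfl]
    omega

lemma cost_item_t {k : ℕ} [NeZero k] (z m : ℕ) :
    2 * ((headLeft (z + 1) m : Circuit k).cost tType.is +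
      (headInner (z + 1) m : Circuit k).cost tType.is) +
      4 * (item z m : Circuit k).cost tType.is ≤ 16 * m + 0 := by
  rw [cost_item]
  rcases m with _ | _ | m
  · simp only [headLeft, headInner, headMid, headRight, tailRest, tailLead_zero, cost_nil, cost_place]
    decide
  · simp only [headLeft, headInner, headMid, headRight, tailRest, tailLead_one, cost_nil, cost_place]
    decide
  · have e := two_mul_half_add_parity m
    rw [cost_tail_t, headLeft, headInner, headMid, headRight, cost_place, cost_place, cost_place,
      cost_place, show headLeftTwo.cost tType.is = 2 from rfl,
      show headInnerTwo.cost tType.is = 2 from rfl, show headMidTwo.cost tType.is = 2 from rfl,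
      show headRightTwo.cost tType.is = 2 from rfl]
    omega

lemma cost_item_h {k : ℕ} [NeZero k] (z m : ℕ) :
    2 * ((headLeft (z + 1) m : Circuit k).cost hType.is +
      (headInner (z + 1) m : Circuit k).cost hType.is) +
      4 * (item z m : Circuit k).cost hType.is ≤ 8 * m + 0 := by
  rw [cost_item]
  rcases m with _ | _ | m
  · simp only [headLeft, headInner, headMid, headRight, tailRest, tailLead_zero, cost_nil, cost_place]
    decide
  · simp only [headLeft, headInner, headMid, headRight, tailRest, tailLead_one, cost_nil, cost_place]
    decide
  · have e := two_mul_half_add_parity m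
    rw [cost_tail_h, headLeft, headInner, headMid, headRight, cost_place, cost_place, cost_place,
      cost_place, show headLeftTwo.cost hType.is = 2 from rfl,
      show headInnerTwo.cost hType.is = 0 from rfl, show headMidTwo.cost hType.is = 0 from rfl,
      show headRightTwo.cost hType.is = 2 from rfl]
    omega

lemma cost_core (p : GateType) {k : ℕ} [NeZero k] (s e : ℕ) (ms : List ℕ) :
    (core s e ms : Circuit k).cost p.is =
      2 * ((headLeft (s + 1) e : Circuit k).cost p.is + (headInner (s + 1) e : Circuit k).cost p.is +
        (headMid s e : Circuit k).cost p.is + (headRight (s + 1) e : Circuit k).cost p.is) +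
      4 * ((tailRest false (s + 1) e : Circuit k).cost p.is +
        (tailLead (s + 1) e : Circuit k).cost p.is) +
      2 * Circuit.cost p.is [[.CNOT (0 : Fin 2) 1]] +
      (2 * ((headLefts (s + 1 + e) ms : Circuit k).cost p.is +
        (headInners (s + 1 + e) ms : Circuit k).cost p.is) +
      4 * (items (s + 1 + e) ms : Circuit k).cost p.is) := by
  simp only [core, mid, body, cost_append, cost_par, cost_inv, cost_place]
  omega

lemma cost_core_cnot {k : ℕ} [NeZero k] (s e : ℕ) (ms : List ℕ) :
    (core s e ms : Circuit k).cost Gate.isCNOT ≤ 18 * e + 4 + 22 * ms.sum + 4 * ms.length := by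
  have h := cost_items_le cnotType (k := k) cost_item_cnot (s + 1 + e) ms
  have hc := cost_core cnotType (k := k) s e ms
  have key : 2 * ((headLeft (s + 1) e : Circuit k).cost cnotType.is +
        (headInner (s + 1) e : Circuit k).cost cnotType.is +
        (headMid s e : Circuit k).cost cnotType.is + (headRight (s + 1) e : Circuit k).cost cnotType.is) +
      4 * ((tailRest false (s + 1) e : Circuit k).cost cnotType.is +
        (tailLead (s + 1) e : Circuit k).cost cnotType.is) +
      2 * Circuit.cost cnotType.is [[.CNOT (0 : Fin 2) 1]] ≤ 18 * e + 4 := by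
    rcases e with _ | _ | e
    · simp only [headLeft, headInner, headMid, headRight, tailRest, tailLead_zero, cost_nil, cost_place]
      decide
    · simp only [headLeft, headInner, headMid, headRight, tailRest, tailLead_one, cost_nil, cost_place]
      decide
    · have e := two_mul_half_add_parity e
      rw [cost_tail_cnot, headLeft, headInner, headMid, headRight, cost_place, cost_place, cost_place,
        cost_place, show headLeftTwo.cost cnotType.is = 2 from rfl,
        show headInnerTwo.cost cnotType.is = 3 from rfl, show headMidTwo.cost cnotType.is = 5 from rfl,
        show headRightTwo.cost cnotType.is = 2 from rfl, if_neg (by simp),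
        show Circuit.cost cnotType.is [[.CNOT (0 : Fin 2) 1]] = 1 from rfl]
      omega
  change (core s e ms : Circuit k).cost cnotType.is ≤ _
  omega

lemma cost_core_t {k : ℕ} [NeZero k] (s e : ℕ) (ms : List ℕ) :
    (core s e ms : Circuit k).cost Gate.isT ≤ 16 * e + 16 * ms.sum := by
  have h := cost_items_le tType (k := k) cost_item_t (s + 1 + e) ms
  have hc := cost_core tType (k := k) s e ms
  have key : 2 * ((headLeft (s + 1) e : Circuit k).cost tType.is +
        (headInner (s + 1) e : Circuit k).cost tType.is +
        (headMid s e : Circuit k).cost tType.is + (headRight (s + 1) e : Circuit k).cost tType.is) +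
      4 * ((tailRest false (s + 1) e : Circuit k).cost tType.is +
        (tailLead (s + 1) e : Circuit k).cost tType.is) +
      2 * Circuit.cost tType.is [[.CNOT (0 : Fin 2) 1]] ≤ 16 * e := by
    rcases e with _ | _ | e
    · simp only [headLeft, headInner, headMid, headRight, tailRest, tailLead_zero, cost_nil, cost_place]
      decide
    · simp only [headLeft, headInner, headMid, headRight, tailRest, tailLead_one, cost_nil, cost_place]
      decide
    · have e := two_mul_half_add_parity e
      rw [cost_tail_t, headLeft, headInner, headMid, headRight, cost_place, cost_place, cost_place,
        cost_place, show headLeftTwo.cost tType.is = 2 from rfl,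
        show headInnerTwo.cost tType.is = 2 from rfl, show headMidTwo.cost tType.is = 2 from rfl,
        show headRightTwo.cost tType.is = 2 from rfl,
        show Circuit.cost tType.is [[.CNOT (0 : Fin 2) 1]] = 0 from rfl]
      omega
  change (core s e ms : Circuit k).cost tType.is ≤ _
  omega

lemma cost_core_h {k : ℕ} [NeZero k] (s e : ℕ) (ms : List ℕ) :
    (core s e ms : Circuit k).cost Gate.isH ≤ 8 * e + 8 * ms.sum := by
  have h := cost_items_le hType (k := k) cost_item_h (s + 1 + e) ms
  have hc := cost_core hType (k := k) s e ms
  have key : 2 * ((headLeft (s + 1) e : Circuit k).cost hType.is +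
        (headInner (s + 1) e : Circuit k).cost hType.is +
        (headMid s e : Circuit k).cost hType.is + (headRight (s + 1) e : Circuit k).cost hType.is) +
      4 * ((tailRest false (s + 1) e : Circuit k).cost hType.is +
        (tailLead (s + 1) e : Circuit k).cost hType.is) +
      2 * Circuit.cost hType.is [[.CNOT (0 : Fin 2) 1]] ≤ 8 * e := by
    rcases e with _ | _ | e
    · simp only [headLeft, headInner, headMid, headRight, tailRest, tailLead_zero, cost_nil, cost_place]
      decide
    · simp only [headLeft, headInner, headMid, headRight, tailRest, tailLead_one, cost_nil, cost_place]
      decide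
    · have e := two_mul_half_add_parity e
      rw [cost_tail_h, headLeft, headInner, headMid, headRight, cost_place, cost_place, cost_place,
        cost_place, show headLeftTwo.cost hType.is = 2 from rfl,
        show headInnerTwo.cost hType.is = 0 from rfl, show headMidTwo.cost hType.is = 0 from rfl,
        show headRightTwo.cost hType.is = 2 from rfl,
        show Circuit.cost hType.is [[.CNOT (0 : Fin 2) 1]] = 0 from rfl]
      omega
  change (core s e ms : Circuit k).cost hType.is ≤ _
  omega

/-! ### Depth of the core -/

lemma par_length {k : ℕ} (A B : Circuit k) : (par A B).length = max A.length B.length := by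
  induction A, B using par.induct with
  | case1 B => simp [par]
  | case2 A h => rw [par_nil]; simp
  | case3 a A b B ih => rw [par, List.length_cons, ih]; simp

/-- The circuit is empty or has the length of `m`, and only the slots marked in `m` hold gates
selected by `p`. -/
def Shape {k : ℕ} (p : Gate k → Bool) (c : Circuit k) (m : List Bool) : Prop :=
  Fits p c m ∧ (c = [] ∨ c.length = m.length)

lemma Shape.par {k : ℕ} {p : Gate k → Bool} {A B : Circuit k} {m : List Bool} (hA : Shape p A m)
    (hB : Shape p B m) : Shape p (par A B) m := by
  refine ⟨hA.1.par hB.1, ?_⟩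
  rcases hA.2 with rfl | hA
  · exact hB.2
  · rcases hB.2 with rfl | hB
    · rw [par_nil]; exact Or.inr hA
    · right
      rw [par_length, hA, hB, max_self]

lemma fits_append_of_length {k : ℕ} {p : Gate k → Bool} {A B : Circuit k} {m m' : List Bool}
    (hA : Fits p A m) (hB : Fits p B m') (h : A.length = m.length) : Fits p (A ++ B) (m ++ m') := by
  induction A generalizing m with
  | nil =>
    obtain rfl := List.eq_nil_of_length_eq_zero h.symm
    exact hB
  | cons a A ih =>
    cases m with
    | nil => exact hA.elim
    | cons b m => exact ⟨hA.1, ih hA.2 (by simpa using h)⟩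

lemma any_dag (p : GateType) {k : ℕ} (s : List (Gate k)) :
    (s.map Gate.dag).reverse.any p.is = s.any p.is := by
  simp [List.any_map, Function.comp_def, p.is_dag]

lemma Shape.inv (p : GateType) {k : ℕ} {c : Circuit k} {m : List Bool} (h : Shape p.is c m) :
    Shape p.is (inv c) m.reverse := by
  obtain ⟨h, rfl | hl⟩ := h
  · exact ⟨trivial, Or.inl rfl⟩
  · refine ⟨?_, Or.inr (by simp [LNN.inv, hl])⟩
    induction c generalizing m with
    | nil => trivial
    | cons s c ih =>
      cases m with
      | nil => exact h.elim
      | cons b m =>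
        rw [inv_cons, List.reverse_cons]
        refine fits_append_of_length (ih h.2 (by simpa using hl)) ⟨?_, trivial⟩ (by simpa [LNN.inv] using hl)
        rw [any_dag]
        exact h.1

lemma Shape.place (p : GateType) {w k : ℕ} [NeZero k] (d : ℕ) {c : Circuit w} {m : List Bool}
    (h : Fits p.is c m) (hl : c.length = m.length) : Shape p.is (place d c : Circuit k) m :=
  ⟨fits_place p d h, Or.inr (by simp [LNN.place, hl])⟩

lemma shape_nil {k : ℕ} (p : Gate k → Bool) (m : List Bool) : Shape p [] m := ⟨trivial, Or.inl rfl⟩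

/-- The slots of the outer parts of the heads, and of the first layers of the tails, are
described by the palindrome `m`. -/
structure Outer (p : GateType) (m : List Bool) : Prop where
  length : m.length = 7
  rev : m.reverse = m
  leftOne : Fits p.is headLeftOne m
  leftTwo : Fits p.is headLeftTwo m
  rightTwo : Fits p.is headRightTwo m
  pair : Fits p.is pairLead m
  odd : Fits p.is oddLead m

lemma Outer.headLeft {p : GateType} {m : List Bool} (h : Outer p m) {k : ℕ} [NeZero k] (d e : ℕ) :
    Shape p.is (headLeft d e : Circuit k) m := by
  rcases e with _ | _ | e
  · exact shape_nil _ _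
  · exact Shape.place p d h.leftOne h.length.symm
  · exact Shape.place p d h.leftTwo h.length.symm

lemma Outer.headRight {p : GateType} {m : List Bool} (h : Outer p m) {k : ℕ} [NeZero k] (d e : ℕ) :
    Shape p.is (headRight d e : Circuit k) m := by
  rcases e with _ | _ | e
  · exact shape_nil _ _
  · exact shape_nil _ _
  · exact Shape.place p d h.rightTwo h.length.symm

lemma Outer.tailLead {p : GateType} {m : List Bool} (h : Outer p m) {k : ℕ} [NeZero k] (d e : ℕ) :
    Shape p.is (tailLead d e : Circuit k) m := by
  rcases e with _ | _ | e
  · exact shape_nil _ _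
  · exact shape_nil _ _
  · rw [tailLead_add_two]
    rcases e / 2 with _ | j
    · rcases (e % 2 == 1) with _ | _
      · exact shape_nil _ _
      · exact Shape.place p _ h.odd h.length.symm
    · exact Shape.place p _ h.pair h.length.symm

lemma Outer.headLefts {p : GateType} {m : List Bool} (h : Outer p m) {k : ℕ} [NeZero k] (z : ℕ)
    (ms : List ℕ) : Shape p.is (headLefts z ms : Circuit k) m := by
  induction ms generalizing z with
  | nil => exact shape_nil _ _
  | cons e ms ih => exact (h.headLeft _ _).par (ih _)

lemma Outer.inv {p : GateType} {m : List Bool} (h : Outer p m) {k : ℕ} {c : Circuit k}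
    (hc : Shape p.is c m) : Shape p.is (inv c) m := by
  have := hc.inv
  rwa [h.rev] at this

lemma fits_headInner (p : GateType) {m : List Bool} (h : Fits p.is headInnerTwo m) {k : ℕ} [NeZero k]
    (d e : ℕ) : Fits p.is (headInner d e : Circuit k) m := by
  rcases e with _ | _ | e
  · trivial
  · trivial
  · exact fits_place p _ h

lemma fits_headInners (p : GateType) {m : List Bool} (h : Fits p.is headInnerTwo m) {k : ℕ}
    [NeZero k] (z : ℕ) (ms : List ℕ) : Fits p.is (headInners z ms : Circuit k) m := by
  induction ms generalizing z with
  | nil => trivial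
  | cons e ms ih => exact (fits_headInner p h _ _).par (ih _)

lemma cnot_outer : Outer cnotType [false, false, true, false, true, false, false] :=
  ⟨by decide, by decide, by decide, by decide, by decide, by decide, by decide⟩

lemma t_outer : Outer tType [false, false, false, true, false, false, false] :=
  ⟨by decide, by decide, by decide, by decide, by decide, by decide, by decide⟩

lemma h_outer : Outer hType [true, false, false, false, false, false, true] :=
  ⟨by decide, by decide, by decide, by decide, by decide, by decide, by decide⟩

lemma depth_item_le {p : GateType} {m : List Bool} (h : Outer p m) {k : ℕ} [NeZero k] (z e : ℕ) :
    (item z (e + 2) : Circuit k).depth p.is ≤ headMidTwo.depth p.is + m.count true +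
      (tailRest true (z + 1) (e + 2) : Circuit k).depth p.is := by
  rw [item, depth_append, depth_append, headMid, depth_place]
  have := ((h.headRight (k := k) (z + 1) (e + 2)).par (h.tailLead (z + 1) (e + 2))).1.depth_le
  omega

lemma depth_item_zero (p : GateType) {k : ℕ} [NeZero k] (z : ℕ) :
    (item z 0 : Circuit k).depth p.is = headMidZero.depth p.is := by
  rw [item, tailLead_zero, headRight, par_nil, tailRest, List.append_nil, List.append_nil, headMid,
    depth_place]

lemma depth_item_one (p : GateType) {k : ℕ} [NeZero k] (z : ℕ) :
    (item z (0 + 1) : Circuit k).depth p.is = headMidOne.depth p.is +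
      Circuit.depth p.is [[.CNOT (0 : Fin 2) 1]] := by
  rw [item, tailLead_one, headRight, par_nil, tailRest, List.append_nil, headMid, depth_append,
    depth_place, depth_place]

/-- The bound `13 * m + 8` is not attained by long runs. The slack pays for moving controls in front
of the last run. -/
lemma depth_item_cnot {k : ℕ} [NeZero k] (z m : ℕ) :
    4 * (item z m : Circuit k).depth cnotType.is + (m - 4) ≤ 13 * m + 8 := by
  rcases m with _ | _ | m
  · rw [depth_item_zero]; decide
  · rw [depth_item_one]; decide
  · rw [show m + 1 + 1 = m + 2 from rfl]
    have e := two_mul_half_add_parity m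
    have h1 := depth_item_le cnot_outer (k := k) z m
    have h2 := depth_tailRest_cnot (k := k) true (z + 1) m
    rw [show headMidTwo.depth cnotType.is = 4 from rfl,
      show List.count true [false, false, true, false, true, false, false] = 2 from rfl] at h1
    simp only [if_true] at h2
    split_ifs at h2 <;> omega

lemma depth_item_t {k : ℕ} [NeZero k] (z m : ℕ) :
    4 * (item z m : Circuit k).depth tType.is ≤ 4 * m := by
  rcases m with _ | _ | m
  · rw [depth_item_zero]; decide
  · rw [depth_item_one]; decide
  · rw [show m + 1 + 1 = m + 2 from rfl]
    have e := two_mul_half_add_parity m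
    have h1 := depth_item_le t_outer (k := k) z m
    have h2 := depth_tailRest_t (k := k) true (z + 1) m
    rw [show headMidTwo.depth tType.is = 1 from rfl,
      show List.count true [false, false, false, true, false, false, false] = 1 from rfl] at h1
    simp only [if_true, ite_self] at h2
    omega

lemma depth_item_h {k : ℕ} [NeZero k] (z m : ℕ) :
    4 * (item z m : Circuit k).depth hType.is ≤ 4 * m := by
  rcases m with _ | _ | m
  · rw [depth_item_zero]; decide
  · rw [depth_item_one]; decide
  · rw [show m + 1 + 1 = m + 2 from rfl]
    have e := two_mul_half_add_parity m
    have h1 := depth_item_le h_outer (k := k) z m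
    have h2 := depth_tailRest_h (k := k) true (z + 1) m
    rw [show headMidTwo.depth hType.is = 0 from rfl,
      show List.count true [true, false, false, false, false, false, true] = 2 from rfl] at h1
    omega

lemma depth_items_cnot {k : ℕ} [NeZero k] (z : ℕ) (ms : List ℕ) :
    4 * (items z ms : Circuit k).depth cnotType.is + (ms.map (· - 4)).sum ≤
      13 * ms.sum + 8 * ms.length := by
  induction ms generalizing z with
  | nil => simp [items, depth_nil]
  | cons m ms ih =>
    have h1 := depth_item_cnot (k := k) z m
    have h2 := ih (z + 1 + m)
    rw [item] at h1
    rw [items, depth_append, List.map_cons, List.sum_cons, List.sum_cons, List.length_cons]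
    omega

lemma depth_items_le (p : GateType) {k : ℕ} [NeZero k]
    (h : ∀ z m, 4 * (item z m : Circuit k).depth p.is ≤ 4 * m) (z : ℕ) (ms : List ℕ) :
    4 * (items z ms : Circuit k).depth p.is ≤ 4 * ms.sum := by
  induction ms generalizing z with
  | nil => simp [items, depth_nil]
  | cons m ms ih =>
    have h1 := h z m
    have h2 := ih (z + 1 + m)
    rw [item] at h1
    rw [items, depth_append, List.sum_cons]
    omega

/-- The depth of the core. The numbers `r` and `l` bound the depth of the layers in which the right
and the left outer part of the first head are executed together with the first layer of its tail. -/
lemma depth_core_le {p : GateType} {m m' : List Bool} (h : Outer p m) (h' : Fits p.is headInnerTwo m')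
    {k : ℕ} [NeZero k] (s e r l : ℕ) (ms : List ℕ)
    (hr : (par (headRight (s + 1) e) (tailLead (s + 1) e) : Circuit k).depth p.is ≤ r)
    (hl : (par (inv (headLeft (s + 1) e)) (tailLead (s + 1) e) : Circuit k).depth p.is ≤ l) :
    (core s e ms : Circuit k).depth p.is ≤ 2 * m.count true + 2 * m'.count true +
      2 * (headMid s e : Circuit k).depth p.is + 2 * r + (headInner (s + 1) e : Circuit k).depth p.is +
      l + 2 * Circuit.depth p.is [[.CNOT (0 : Fin 2) 1]] +
      4 * (tailRest false (s + 1) e : Circuit k).depth p.is +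
      4 * (items (s + 1 + e) ms : Circuit k).depth p.is := by
  have h1 := ((h.headLefts (k := k) (s + 1 + e) ms).par (h.headLeft (s + 1) e)).1.depth_le
  have h2 := ((fits_headInners p h' (k := k) (s + 1 + e) ms).par
    (fits_headInner p h' (s + 1) e)).depth_le
  have h3 := ((h.inv (h.headLefts (k := k) (s + 1 + e) ms)).par
    (h.inv (h.tailLead (s + 1) e))).1.depth_le
  have h4 := (fits_headInners p h' (k := k) (s + 1 + e) ms).depth_le
  simp only [core, mid, body, depth_append, depth_inv, depth_place]
  omega

lemma depth_core_cnot {k : ℕ} [NeZero k] (s e : ℕ) (ms : List ℕ) :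
    (core s e ms : Circuit k).depth Gate.isCNOT + (ms.map (· - 4)).sum ≤
      10 * e + 25 + 13 * ms.sum + 8 * ms.length := by
  have hi := depth_items_cnot (k := k) (s + 1 + e) ms
  have h' : Fits cnotType.is headInnerTwo [true, true, false, true] := by decide
  change (core s e ms : Circuit k).depth cnotType.is + _ ≤ _
  have hr := ((cnot_outer.headRight (k := k) (s + 1) e).par (cnot_outer.tailLead (s + 1) e)).1.depth_le
  have hl := ((cnot_outer.inv (cnot_outer.headLeft (k := k) (s + 1) e)).par
    (cnot_outer.tailLead (s + 1) e)).1.depth_le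
  have h := depth_core_le cnot_outer h' s e _ _ ms hr hl
  rw [show List.count true [false, false, true, false, true, false, false] = 2 from rfl,
    show List.count true [true, true, false, true] = 3 from rfl,
    show Circuit.depth cnotType.is [[.CNOT (0 : Fin 2) 1]] = 1 from rfl] at h
  rcases e with _ | _ | e
  · rw [headMid, headInner, tailRest, depth_place, depth_nil,
      show headMidZero.depth cnotType.is = 1 from rfl] at h
    omega
  · rw [headMid, headInner, tailRest, depth_place, depth_nil, depth_place,
      show headMidOne.depth cnotType.is = 3 from rfl,
      show Circuit.depth cnotType.is [[.CNOT (0 : Fin 2) 1]] = 1 from rfl] at h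
    omega
  · rw [show e + 1 + 1 = e + 2 from rfl] at h hi ⊢
    have e1 := two_mul_half_add_parity e
    have h2 := depth_tailRest_cnot (k := k) false (s + 1) e
    rw [headMid, headInner, depth_place, depth_place, show headMidTwo.depth cnotType.is = 4 from rfl,
      show headInnerTwo.depth cnotType.is = 3 from rfl] at h
    simp only [Bool.false_eq_true, if_false] at h2
    split_ifs at h2 <;> omega

lemma depth_core_t {k : ℕ} [NeZero k] (s e : ℕ) (ms : List ℕ) :
    (core s e ms : Circuit k).depth Gate.isT ≤ 4 * e + 8 + 4 * ms.sum := by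
  have hi := depth_items_le tType (k := k) depth_item_t (s + 1 + e) ms
  have h' : Fits tType.is headInnerTwo [false, false, true, false] := by decide
  change (core s e ms : Circuit k).depth tType.is ≤ _
  have hr := ((t_outer.headRight (k := k) (s + 1) e).par (t_outer.tailLead (s + 1) e)).1.depth_le
  have hl := ((t_outer.inv (t_outer.headLeft (k := k) (s + 1) e)).par
    (t_outer.tailLead (s + 1) e)).1.depth_le
  have h := depth_core_le t_outer h' s e _ _ ms hr hl
  rw [show List.count true [false, false, false, true, false, false, false] = 1 from rfl,
    show List.count true [false, false, true, false] = 1 from rfl,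
    show Circuit.depth tType.is [[.CNOT (0 : Fin 2) 1]] = 0 from rfl] at h
  rcases e with _ | _ | e
  · rw [headMid, headInner, tailRest, depth_place, depth_nil,
      show headMidZero.depth tType.is = 0 from rfl] at h
    omega
  · rw [headMid, headInner, tailRest, depth_place, depth_nil, depth_place,
      show headMidOne.depth tType.is = 1 from rfl,
      show Circuit.depth tType.is [[.CNOT (0 : Fin 2) 1]] = 0 from rfl] at h
    omega
  · rw [show e + 1 + 1 = e + 2 from rfl] at h hi ⊢
    have e1 := two_mul_half_add_parity e
    have h2 := depth_tailRest_t (k := k) false (s + 1) e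
    rw [headMid, headInner, depth_place, depth_place, show headMidTwo.depth tType.is = 1 from rfl,
      show headInnerTwo.depth tType.is = 1 from rfl] at h
    simp only [Bool.false_eq_true, if_false] at h2
    split_ifs at h2 <;> omega

lemma depth_core_h {k : ℕ} [NeZero k] (s e : ℕ) (ms : List ℕ) :
    (core s e ms : Circuit k).depth Gate.isH ≤ 4 * e + 5 + 4 * ms.sum := by
  have hi := depth_items_le hType (k := k) depth_item_h (s + 1 + e) ms
  have h' : Fits hType.is headInnerTwo [false, false, false, false] := by decide
  change (core s e ms : Circuit k).depth hType.is ≤ _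
  have c1 : List.count true [true, false, false, false, false, false, true] = 2 := rfl
  have c2 : List.count true [false, false, false, false] = 0 := rfl
  have c3 : Circuit.depth hType.is [[.CNOT (0 : Fin 2) 1]] = 0 := rfl
  rcases e with _ | _ | e
  · have h := depth_core_le h_outer h' (k := k) s 0 0 0 ms (by rw [tailLead_zero, par_nil]; rfl)
      (by rw [tailLead_zero, par_nil]; rfl)
    rw [headMid, headInner, tailRest, depth_place, depth_nil,
      show headMidZero.depth hType.is = 0 from rfl] at h
    omega
  · have h := depth_core_le h_outer h' (k := k) s (0 + 1) 0 1 ms (by rw [tailLead_one, par_nil]; rfl)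
      (by rw [tailLead_one, par_nil, depth_inv, headLeft, depth_place]; decide)
    rw [headMid, headInner, tailRest, depth_place, depth_nil, depth_place,
      show headMidOne.depth hType.is = 1 from rfl] at h
    omega
  · rw [show e + 1 + 1 = e + 2 from rfl] at hi ⊢
    have hr := ((h_outer.headRight (k := k) (s + 1) (e + 2)).par
      (h_outer.tailLead (s + 1) (e + 2))).1.depth_le
    have hl := ((h_outer.inv (h_outer.headLeft (k := k) (s + 1) (e + 2))).par
      (h_outer.tailLead (s + 1) (e + 2))).1.depth_le
    have h := depth_core_le h_outer h' s (e + 2) _ _ ms hr hl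
    have e1 := two_mul_half_add_parity e
    have h2 := depth_tailRest_h (k := k) false (s + 1) e
    rw [headMid, headInner, depth_place, depth_place, show headMidTwo.depth hType.is = 0 from rfl,
      show headInnerTwo.depth hType.is = 0 from rfl] at h
    omega

/-! ### The complete circuit -/

/-- The operator `A` is the operator of a circuit within the bounds for `n` controls on `k` qubits.
-/
def Realizable (n k : ℕ) (A : Op k) : Prop :=
  ∃ c : Circuit k, c.IsLNN ∧ c.op = A ∧
    c.cost Gate.isCNOT ≤ 8 * k + 14 * n - 34 ∧ c.depth Gate.isCNOT ≤ 8 * k + 5 * n + 1 ∧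
    c.cost Gate.isT ≤ 16 * n - 16 ∧ c.depth Gate.isT ≤ 4 * n + 4 ∧
    c.cost Gate.isH ≤ 8 * n + 4 ∧ c.depth Gate.isH ≤ 4 * n + 3

lemma exchange_cost {k : ℕ} (t u : Fin k) :
    (exchange t u).cost Gate.isCNOT = 0 ∧ (exchange t u).depth Gate.isCNOT = 0 ∧
    (exchange t u).cost Gate.isT = 0 ∧ (exchange t u).depth Gate.isT = 0 ∧
    (exchange t u).cost Gate.isH ≤ 2 ∧ (exchange t u).depth Gate.isH ≤ 1 := by
  unfold exchange
  split_ifs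
  · simp [Circuit.cost, Circuit.depth]
  · exact ⟨rfl, rfl, rfl, rfl, le_rfl, le_rfl⟩

/-- The flip of the qubit `u` on condition that the qubits of `S` other than `u` are on yields
the multi-controlled gate with any target in `S`. The circuit `V` moves controls so that all of them
stand in runs after the gap `s + 1`, and `μ` counts the moves. The moves cost `4 * μ` gates in all;
the bounds on `μ` say that the runs leave room for them. -/
lemma realizable_of_runs {n k : ℕ} [NeZero k] {W : ℕ → Bool} {s e μ : ℕ} {ms : List ℕ} {t u : Fin k}
    {S : Finset (Fin k)} (ht : t ∈ S) (hu : u ∈ S) {V : Circuit k} (hV : V.IsLNN)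
    (hVu : ∀ g ∈ V.flatten, u ∉ g.qubits) {π : Basis k → Basis k} {φ : Basis k → ZMod 8}
    (hπ : Acts V.op π φ) (hs : lastQubit (s + 1 + e) ms + 1 = u.val)
    (hW : ∀ i, s + 1 < i → i ≤ s + 1 + e → W i = true) (hR : Runs W (s + 1 + e) ms)
    (hS : ∀ y : Basis k, ((∀ i : Fin k, i.val = s → π y i = 1) ∧
      Ones W (π y) (s + 1) (lastQubit (s + 1 + e) ms)) ↔ ∀ c ∈ S.erase u, y c = 1)
    (hn : n = 1 + e + ms.sum) (hk : n + 2 + ms.length ≤ k)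
    (hV1 : V.cost Gate.isCNOT = 2 * μ) (hV2 : V.depth Gate.isCNOT ≤ 2 * μ)
    (hV3 : V.cost Gate.isT = 0 ∧ V.depth Gate.isT = 0 ∧ V.cost Gate.isH = 0 ∧ V.depth Gate.isH = 0)
    (hμ : μ ≤ e + ms.length) (hμ' : 4 * μ ≤ 3 * e + 5 + (ms.map (· - 4)).sum) :
    Realizable n k (mcx (S.erase t) t) := by
  have hlt := u.isLt
  obtain ⟨f, hf, hf'⟩ := isFlip_core hs hW hR
  refine ⟨exchange t u ++ V ++ core s e ms ++ inv V ++ exchange t u, ?_, ?_, ?_⟩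
  · exact isLNN_append (isLNN_append (isLNN_append (isLNN_append (isLNN_exchange _ _) hV)
      (isLNN_core (by omega))) (isLNN_inv hV)) (isLNN_exchange _ _)
  · have h1 := (hf.conj hV hVu hπ).eq_mcx (C := S.erase u) fun y => by
      rw [Function.comp, hf', hS]
    rw [← exchange_mcx ht hu, ← h1]
    simp only [Circuit.op_append, mul_assoc]
  · obtain ⟨x1, x2, x3, x4, x5, x6⟩ := exchange_cost t u
    obtain ⟨v3, v4, v5, v6⟩ := hV3
    have i1 : (inv V).cost Gate.isCNOT = V.cost Gate.isCNOT := cost_inv cnotType V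
    have i2 : (inv V).depth Gate.isCNOT = V.depth Gate.isCNOT := depth_inv cnotType V
    have i3 : (inv V).cost Gate.isT = V.cost Gate.isT := cost_inv tType V
    have i4 : (inv V).depth Gate.isT = V.depth Gate.isT := depth_inv tType V
    have i5 : (inv V).cost Gate.isH = V.cost Gate.isH := cost_inv hType V
    have i6 : (inv V).depth Gate.isH = V.depth Gate.isH := depth_inv hType V
    have c1 := cost_core_cnot (k := k) s e ms
    have c2 := depth_core_cnot (k := k) s e ms
    have c3 := cost_core_t (k := k) s e ms
    have c4 := depth_core_t (k := k) s e ms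
    have c5 := cost_core_h (k := k) s e ms
    have c6 := depth_core_h (k := k) s e ms
    simp only [cost_append, depth_append]
    omega

lemma lastQubit_eq (z : ℕ) (ms : List ℕ) : lastQubit z ms = z + ms.sum + ms.length := by
  induction ms generalizing z with
  | nil => rfl
  | cons m ms ih =>
    rw [lastQubit, ih, List.sum_cons, List.length_cons]
    omega

/-- The qubits between `d` and `hi` consist of runs of controls that are separated by gaps. -/
lemma exists_runs (W : ℕ → Bool) {d hi : ℕ} (h : d < hi) :
    ∃ m ms, (∀ i, d < i → i ≤ d + m → W i = true) ∧ Runs W (d + m) ms ∧ lastQubit (d + m) ms + 1 = hi ∧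
      ((Finset.Ioo d hi).filter fun i => W i = true).card = m + ms.sum := by
  obtain ⟨r, rfl⟩ := Nat.exists_eq_add_of_lt h
  induction r generalizing d with
  | zero =>
    refine ⟨0, [], fun i _ _ => by omega, trivial, rfl, ?_⟩
    rw [List.sum_nil, zero_add 0, Finset.card_eq_zero, Finset.filter_eq_empty_iff]
    intro i hi
    rw [Finset.mem_Ioo] at hi
    omega
  | succ r ih =>
    obtain ⟨m, ms, h1, h2, h3, h4⟩ := ih (d := d + 1) (by omega)
    have hI : Finset.Ioo d (d + (r + 1) + 1) = insert (d + 1) (Finset.Ioo (d + 1) (d + 1 + r + 1)) := by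
      ext i
      simp only [Finset.mem_Ioo, Finset.mem_insert]
      omega
    rw [hI, Finset.filter_insert]
    cases hW : W (d + 1)
    · refine ⟨0, m :: ms, fun i _ _ => by omega, ⟨hW, h1, h2⟩, ?_, ?_⟩
      · rw [lastQubit, ← show d + 1 + r + 1 = d + (r + 1) + 1 by omega, ← h3]
      · simp [h4]
    · refine ⟨m + 1, ms, fun i hi hi' => ?_, ?_, ?_, ?_⟩
      · rcases eq_or_ne i (d + 1) with rfl | hne
        · exact hW
        · exact h1 i (by omega) (by omega)
      · rwa [show d + (m + 1) = d + 1 + m by omega]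
      · rw [show d + (m + 1) = d + 1 + m by omega, h3]; omega
      · rw [if_pos rfl, Finset.card_insert_of_notMem (by simp), h4]; omega

/-- A segment of selected qubits after `d` belongs to the first run. -/
lemma le_first_run {W : ℕ → Bool} {d m μ : ℕ} {ms : List ℕ} (hR : Runs W (d + m) ms)
    (hμ : ∀ i, d < i → i ≤ d + μ → W i = true) (h : d + μ < lastQubit (d + m) ms + 1) : μ ≤ m := by
  cases ms with
  | nil => rw [lastQubit] at h; omega
  | cons m' ms =>
    by_contra hc
    have := hμ (d + m + 1) (by omega) (by omega)
    rw [hR.1] at this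
    simp at this

/-- A segment of `μ` selected qubits at the end belongs to the last run. If this is not the first
run, then all but four of these qubits contribute to the slack in the `CNOT` depth. -/
lemma le_last_run {W : ℕ → Bool} {d m μ : ℕ} {ms : List ℕ} (hR : Runs W (d + m) ms)
    (hμ : ∀ i, lastQubit (d + m) ms + 1 ≤ i + μ → i ≤ lastQubit (d + m) ms → W i = true)
    (h : d + μ < lastQubit (d + m) ms + 1) : ms = [] ∧ μ ≤ m ∨ μ ≤ 4 + (ms.map (· - 4)).sum := by
  induction ms generalizing d m with
  | nil => rw [lastQubit] at h; exact Or.inl ⟨rfl, by omega⟩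
  | cons m' ms ih =>
    right
    have hs := le_lastQubit (d + m + 1 + m') ms
    have h1 : d + m + 1 + μ < lastQubit (d + m + 1 + m') ms + 1 := by
      by_contra hc
      have := hμ (d + m + 1) (by rw [lastQubit]; omega) (by rw [lastQubit]; omega)
      rw [hR.1] at this
      simp at this
    rw [List.map_cons, List.sum_cons]
    rcases ih hR.2.2 hμ h1 with ⟨-, h2⟩ | h2 <;> omega

/-- If the first qubit of the line is not used, there is a free qubit before the first control. The
control moves there, so that its old place becomes the gap after it. -/
lemma realizable_of_zero_notMem {n k : ℕ} (hn : 5 ≤ n) {S : Finset (Fin k)}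
    (hS : S.card = n + 1) {t : Fin k} (ht : t ∈ S) (h0 : ∀ i ∈ S, i.val ≠ 0) :
    Realizable n k (mcx (S.erase t) t) := by
  have : NeZero k := ⟨fun h => by subst h; exact t.elim0⟩
  have hne : S.Nonempty := ⟨t, ht⟩
  let lo := S.min' hne
  let u := S.max' hne
  have hlo : lo ∈ S := S.min'_mem hne
  have hu : u ∈ S := S.max'_mem hne
  have hlou : lo.val < u.val := by
    refine S.min'_lt_max'_of_card (by omega)
  have h1 := h0 lo hlo
  have hlt := u.isLt
  obtain ⟨e, ms, r1, r2, r3, r4⟩ := exists_runs (fun j => decide (∃ i ∈ S, i.val = j)) hlou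
  obtain ⟨s, hs⟩ := Nat.exists_eq_add_of_lt (Nat.pos_of_ne_zero h1)
  have hs : lo.val = s + 1 := by omega
  rw [hs] at r1 r2 r3 r4
  have hcard : ((Finset.Ioo (s + 1) u.val).filter fun i => decide (∃ j ∈ S, j.val = i) = true).card + 2 =
      n + 1 := by
    rw [← hS, ← Finset.card_image_of_injective S Fin.val_injective]
    have : S.image Fin.val = insert (s + 1) (insert u.val
        ((Finset.Ioo (s + 1) u.val).filter fun i => decide (∃ j ∈ S, j.val = i) = true)) := by
      ext i
      simp only [Finset.mem_image, Finset.mem_insert, Finset.mem_filter, Finset.mem_Ioo, decide_eq_true_eq]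
      constructor
      · rintro ⟨j, hj, rfl⟩
        have g1 : lo.val ≤ j.val := S.min'_le j hj
        have g2 : j.val ≤ u.val := S.le_max' j hj
        by_cases g3 : j.val = s + 1
        · exact Or.inl g3
        · by_cases g4 : j.val = u.val
          · exact Or.inr (Or.inl g4)
          · exact Or.inr (Or.inr ⟨by omega, j, hj, rfl⟩)
      · rintro (rfl | rfl | ⟨-, h⟩)
        · exact ⟨lo, hlo, hs⟩
        · exact ⟨u, hu, rfl⟩
        · exact h
    rw [this, Finset.card_insert_of_notMem, Finset.card_insert_of_notMem]
    · simp
    · simp; omega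
  have hst := lastQubit_eq (s + 1 + e) ms
  obtain ⟨π, φ, hA, hπ⟩ := acts_shiftDown (k := k) (d := s) (by omega)
  have c1 := cost_place cnotType (k := k) s shiftDown
  have c2 := depth_place cnotType (k := k) s shiftDown
  have c3 := cost_place tType (k := k) s shiftDown
  have c4 := depth_place tType (k := k) s shiftDown
  have c5 := cost_place hType (k := k) s shiftDown
  have c6 := depth_place hType (k := k) s shiftDown
  refine realizable_of_runs ht hu (V := place s shiftDown) (μ := 1) (isLNN_place (by decide) (by omega))
    (fun g hg hq => ?_) hA r3 r1 r2 (fun y => ?_) (by omega) (by omega) (c1.trans (by decide))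
    (c2.le.trans (by decide)) ⟨c3.trans (by decide), c4.trans (by decide), c5.trans (by decide),
      c6.trans (by decide)⟩ ?_ (by omega)
  · have := (On.place (k := k) shiftDown (by omega : s + 2 ≤ k) le_rfl le_rfl) g hg u hq
    omega
  · constructor
    · rintro ⟨g1, g2⟩ c hc
      rw [Finset.mem_erase] at hc
      have g3 : lo.val ≤ c.val := S.min'_le c hc.2
      have g4 : c.val ≤ u.val := S.le_max' c hc.2
      have g5 : c.val ≠ u.val := fun h => hc.1 (Fin.ext h)
      by_cases g6 : c.val = s + 1
      · rw [← (hπ y).2 c ⟨s, by omega⟩ g6 rfl]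
        exact g1 _ rfl
      · rw [← (hπ y).1 c (by omega)]
        exact g2 c (by omega) (by omega) (by simpa using ⟨c, hc.2, rfl⟩)
    · intro h
      constructor
      · intro i hi
        rw [(hπ y).2 lo i hs hi]
        exact h lo (Finset.mem_erase.2 ⟨fun h => by rw [h] at hlou; omega, hlo⟩)
      · intro i g1 g2 g3
        rw [(hπ y).1 i (by omega)]
        simp only [decide_eq_true_eq] at g3
        obtain ⟨j, hj, g3⟩ := g3
        obtain rfl := Fin.ext g3
        exact h j (Finset.mem_erase.2 ⟨fun h => by rw [h] at g2; omega, hj⟩)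
  · rcases ms with _ | ⟨m, ms⟩
    · rw [List.sum_nil] at r4
      omega
    · rw [List.length_cons]
      omega

lemma cost_pulls (p : GateType) {k : ℕ} [NeZero k] (μ : ℕ) :
    Circuit.cost p.is (pulls μ : Circuit k) = shiftUp.cost p.is * μ := by
  induction μ with
  | zero => rfl
  | succ μ ih => rw [pulls, cost_append, cost_place, ih, mul_add_one, add_comm]

lemma depth_pulls (p : GateType) {k : ℕ} [NeZero k] (μ : ℕ) :
    Circuit.depth p.is (pulls μ : Circuit k) = shiftUp.depth p.is * μ := by
  induction μ with
  | zero => rfl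
  | succ μ ih => rw [pulls, depth_append, depth_place, ih, mul_add_one, add_comm]

/-- Both ends of the line are used, and the first gap from the left, which is the qubit `μ + 1`, is
at least as close to its end as the first gap from the right. Moving the controls between the first
qubit and this gap one qubit further puts the gap next to the first qubit. -/
lemma realizable_of_both_ends {n k μ : ℕ} {S : Finset (Fin k)}
    (hS : S.card = n + 1) {t : Fin k} (ht : t ∈ S) (hμ : μ + 2 < k)
    (hl : ∀ i : Fin k, i.val ≤ μ → i ∈ S) (hg : ∀ i ∈ S, i.val ≠ μ + 1)
    (hr : ∀ i : Fin k, k ≤ i.val + 1 + μ → i ∈ S) : Realizable n k (mcx (S.erase t) t) := by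
  have : NeZero k := ⟨by omega⟩
  obtain ⟨hi, rfl⟩ : ∃ hi, k = hi + 1 := ⟨k - 1, by omega⟩
  obtain ⟨e, ms, r1, r2, r3, r4⟩ := exists_runs
    (fun j => decide (j = μ + 1 ∨ ∃ i ∈ S, i.val = j)) (show 1 < hi by omega)
  have hcard : ((Finset.Ioo 1 hi).filter fun i =>
      decide (i = μ + 1 ∨ ∃ j ∈ S, j.val = i) = true).card + 3 = n + 2 := by
    have h1 : μ + 1 ∉ S.image Fin.val := by
      simp only [Finset.mem_image, not_exists, not_and]
      exact hg
    have h2 : (insert (μ + 1) (S.image Fin.val)).card = n + 2 := by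
      rw [Finset.card_insert_of_notMem h1, Finset.card_image_of_injective S Fin.val_injective, hS]
    rw [← h2]
    have : insert (μ + 1) (S.image Fin.val) = insert 0 (insert 1 (insert hi
        ((Finset.Ioo 1 hi).filter fun i => decide (i = μ + 1 ∨ ∃ j ∈ S, j.val = i) = true))) := by
      ext i
      simp only [Finset.mem_image, Finset.mem_insert, Finset.mem_filter, Finset.mem_Ioo, decide_eq_true_eq]
      constructor
      · intro h
        have h3 : i ≤ hi := by
          rcases h with rfl | ⟨j, -, rfl⟩ <;> omega
        by_cases h4 : i = 0
        · exact Or.inl h4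
        · by_cases h5 : i = 1
          · exact Or.inr (Or.inl h5)
          · by_cases h6 : i = hi
            · exact Or.inr (Or.inr (Or.inl h6))
            · exact Or.inr (Or.inr (Or.inr ⟨by omega, h⟩))
      · rintro (rfl | rfl | rfl | ⟨-, h⟩)
        · exact Or.inr ⟨⟨0, by omega⟩, hl _ (Nat.zero_le _), rfl⟩
        · rcases Nat.eq_zero_or_pos μ with h | h
          · left; omega
          · exact Or.inr ⟨⟨1, by omega⟩, hl _ h, rfl⟩
        · exact Or.inr ⟨⟨i, by omega⟩, hr _ (by simp), rfl⟩
        · exact h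
    rw [this, Finset.card_insert_of_notMem, Finset.card_insert_of_notMem, Finset.card_insert_of_notMem]
    · simp
    · simp; omega
    · simp; omega
  have hst := lastQubit_eq (1 + e) ms
  have hμe : μ ≤ e := by
    refine le_first_run r2 (fun i h1 h2 => ?_) (by omega)
    rw [decide_eq_true_eq]
    by_cases h3 : i = μ + 1
    · exact Or.inl h3
    · exact Or.inr ⟨⟨i, by omega⟩, hl _ (by simp; omega), rfl⟩
  have hμ' : 4 * μ ≤ 3 * e + 5 + (ms.map (· - 4)).sum := by
    have := le_last_run r2 (μ := μ) (fun i h1 h2 => by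
      rw [decide_eq_true_eq]
      exact Or.inr ⟨⟨i, by omega⟩, hr _ (by simp; omega), rfl⟩) (by omega)
    rcases this with ⟨rfl, -⟩ | h
    · have h1 : ¬ hi + 1 ≤ μ + 1 + 1 + μ := fun h => hg ⟨μ + 1, by omega⟩ (hr _ h) rfl
      rw [lastQubit] at r3
      omega
    · omega
  obtain ⟨π, φ, hA, hπ⟩ := acts_pulls (k := hi + 1) (μ := μ) (by omega)
  have hu : Fin.last hi ∈ S := hr _ (by simp)
  have c1 := cost_pulls cnotType (k := hi + 1) μ
  have c2 := depth_pulls cnotType (k := hi + 1) μ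
  have c3 := cost_pulls tType (k := hi + 1) μ
  have c4 := depth_pulls tType (k := hi + 1) μ
  have c5 := cost_pulls hType (k := hi + 1) μ
  have c6 := depth_pulls hType (k := hi + 1) μ
  refine realizable_of_runs (s := 0) (e := e) (ms := ms) ht hu (V := pulls μ) (μ := μ)
    (W := fun j => decide (j = μ + 1 ∨ ∃ i ∈ S, i.val = j)) (isLNN_pulls (by omega))
    (fun g hg hq => ?_) hA ?_ ?_ ?_ (fun y => ?_) (by omega) (by omega) c1 c2.le
    ⟨c3.trans (zero_mul _), c4.trans (zero_mul _), c5.trans (zero_mul _), c6.trans (zero_mul _)⟩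
    (by omega) hμ'
  · have := (on_pulls (k := hi + 1) (μ := μ) (by omega)) g hg _ hq
    rw [Fin.val_last] at this
    omega
  · rwa [zero_add]
  · rwa [zero_add]
  · rwa [zero_add]
  · rw [zero_add]
    constructor
    · rintro ⟨g1, g2⟩ c hc
      rw [Finset.mem_erase] at hc
      have g3 : c.val ≠ hi := fun h => hc.1 (Fin.ext h)
      have g4 := hg c hc.2
      have g5 := c.isLt
      rcases Nat.eq_zero_or_pos c.val with g6 | g6
      · rw [← (hπ y).1 c (Or.inl g6)]
        exact g1 c g6
      · rcases le_or_gt c.val μ with g7 | g7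
        · rw [← (hπ y).2 c ⟨c.val + 1, by omega⟩ g6 g7 rfl]
          refine g2 _ (Nat.succ_lt_succ g6) (by rw [hst] at r3 ⊢; exact (by omega : c.val + 1 ≤ 1 + e + ms.sum + ms.length)) ?_
          rw [decide_eq_true_eq]
          rcases g7.eq_or_lt with g8 | g8
          · exact Or.inl (congrArg (· + 1) g8)
          · exact Or.inr ⟨⟨c.val + 1, by omega⟩, hl _ g8, rfl⟩
        · rw [← (hπ y).1 c (by omega)]
          refine g2 c (by omega) (by omega) ?_
          rw [decide_eq_true_eq]
          exact Or.inr ⟨c, hc.2, rfl⟩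
    · intro h
      have h' : ∀ c : Fin (hi + 1), c ∈ S → c.val < hi → y c = 1 := fun c hc hlt =>
        h c (Finset.mem_erase.2 ⟨fun h => by rw [h, Fin.val_last] at hlt; omega, hc⟩)
      constructor
      · intro i g0
        rw [(hπ y).1 i (Or.inl g0)]
        exact h' i (hl i (by omega)) (by omega)
      · intro i g1 g2 g3
        rcases le_or_gt i.val (μ + 1) with g4 | g4
        · rw [(hπ y).2 ⟨i.val - 1, by omega⟩ i (by simp; omega) (by simp; omega) (by simp; omega)]
          exact h' _ (hl _ (by simp; omega)) (by simp; omega)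
        · rw [(hπ y).1 i (Or.inr g4)]
          rw [decide_eq_true_eq] at g3
          obtain ⟨j, hj, g3⟩ := g3.resolve_left (by omega)
          obtain rfl := Fin.ext g3
          exact h' j hj (by omega)

/-- The reflection of the line maps circuits to circuits of the same cost. -/
lemma realizable_of_reflect {n k : ℕ} {C : Finset (Fin k)} {t : Fin k}
    (h : Realizable n k (mcx (C.image Fin.rev) t.rev)) : Realizable n k (mcx C t) := by
  obtain ⟨c, h1, h2, h3, h4, h5, h6, h7, h8⟩ := h
  have hrev : Function.Injective (Fin.rev : Fin k → Fin k) := Fin.rev_injective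
  refine ⟨c.map (List.map (Gate.map Fin.rev)), ?_, ?_, (cost_map cnotType _ c).trans_le h3,
    (depth_map cnotType _ c).trans_le h4, (cost_map tType _ c).trans_le h5,
    (depth_map tType _ c).trans_le h6, (cost_map hType _ c).trans_le h7,
    (depth_map hType _ c).trans_le h8⟩
  · refine isLNN_map hrev (fun i j hij => ?_) h1
    rw [Fin.val_rev, Fin.val_rev]
    omega
  · rw [op_eq_ev, ← List.map_flatten, ev_map hrev, ← op_eq_ev, h2, mcx, mcx, liftOp_controlled hrev,
      Fin.rev_rev, Finset.image_image, Fin.rev_involutive.comp_self, Finset.image_id]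

/-- The first gap of a set of qubits that contains the first and the last qubit, but not all. -/
lemma exists_first_gap {k : ℕ} {S : Finset (Fin k)} (hS : S.card < k)
    (h0 : ∃ i ∈ S, i.val = 0) (h1 : ∃ i ∈ S, i.val + 1 = k) :
    ∃ μ, μ + 2 < k ∧ (∀ i : Fin k, i.val ≤ μ → i ∈ S) ∧ ∀ i ∈ S, i.val ≠ μ + 1 := by
  have hex : ∃ j, ∃ h : j < k, (⟨j, h⟩ : Fin k) ∉ S := by
    by_contra! hc
    have : S = Finset.univ := Finset.eq_univ_of_forall fun i => hc i i.isLt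
    rw [this, Finset.card_univ, Fintype.card_fin] at hS
    exact lt_irrefl _ hS
  classical
  obtain ⟨hlt, hg⟩ := Nat.find_spec hex
  have hmin := fun j (hj : j < Nat.find hex) => Nat.find_min hex hj
  generalize Nat.find hex = g at hlt hg hmin
  obtain ⟨i, hi, h0⟩ := h0
  obtain ⟨j, hj, h1⟩ := h1
  have g0 : g ≠ 0 := fun h => hg (by rwa [show (⟨g, hlt⟩ : Fin k) = i from Fin.ext (h.trans h0.symm)])
  have g1 : g ≠ j.val := fun h => hg (by rwa [show (⟨g, hlt⟩ : Fin k) = j from Fin.ext h])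
  refine ⟨g - 1, by omega, fun i hi => ?_, fun i hi h => ?_⟩
  · by_contra hc
    exact hmin i.val (by omega) ⟨i.isLt, hc⟩
  · exact hg (by rwa [show (⟨g, hlt⟩ : Fin k) = i from Fin.ext (by simp only; omega)])

/-- The target and the controls form the set `S`. Up to a reflection of the line, either the first
qubit is not in `S`, or both ends are and the first gap is at least as close to its end as the last
gap. -/
theorem realizable_mcx {n k : ℕ} (hn : 5 ≤ n) (hk : n + 2 ≤ k) {S : Finset (Fin k)}
    (hS : S.card = n + 1) {t : Fin k} (ht : t ∈ S) : Realizable n k (mcx (S.erase t) t) := by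
  have hrev : Function.Injective (Fin.rev : Fin k → Fin k) := Fin.rev_injective
  have hS' : (S.image Fin.rev).card = n + 1 := by rw [Finset.card_image_of_injective S hrev, hS]
  have ht' : t.rev ∈ S.image Fin.rev := Finset.mem_image_of_mem _ ht
  have hmem : ∀ i : Fin k, i ∈ S.image Fin.rev ↔ i.rev ∈ S := fun i => by
    rw [← Fin.rev_rev i, hrev.mem_finset_image, Fin.rev_rev]
  have hrefl : Realizable n k (mcx ((S.image Fin.rev).erase t.rev) t.rev) →
      Realizable n k (mcx (S.erase t) t) := fun h =>
    realizable_of_reflect (by rwa [Finset.image_erase hrev])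
  by_cases h0 : ∃ i ∈ S, i.val = 0
  swap
  · push Not at h0
    exact realizable_of_zero_notMem hn hS ht h0
  by_cases h1 : ∃ i ∈ S, i.val + 1 = k
  swap
  · push Not at h1
    refine hrefl (realizable_of_zero_notMem hn hS' ht' fun i hi h => ?_)
    refine h1 _ ((hmem i).1 hi) ?_
    rw [Fin.val_rev]
    omega
  have h0' : ∃ i ∈ S.image Fin.rev, i.val = 0 := by
    obtain ⟨i, hi, h⟩ := h1
    exact ⟨i.rev, Finset.mem_image_of_mem _ hi, by rw [Fin.val_rev]; omega⟩
  have h1' : ∃ i ∈ S.image Fin.rev, i.val + 1 = k := by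
    obtain ⟨i, hi, h⟩ := h0
    exact ⟨i.rev, Finset.mem_image_of_mem _ hi, by rw [Fin.val_rev]; omega⟩
  obtain ⟨μ, hμ, hl, hg⟩ := exists_first_gap (by omega) h0 h1
  obtain ⟨ν, hν, hl', hg'⟩ := exists_first_gap (by omega) h0' h1'
  rcases le_total μ ν with h | h
  · refine realizable_of_both_ends hS ht hμ hl hg fun i hi => ?_
    rw [← Fin.rev_rev i, ← hmem]
    refine hl' _ ?_
    rw [Fin.val_rev]
    omega
  · refine hrefl (realizable_of_both_ends hS' ht' hν hl' hg' fun i hi => ?_)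
    rw [hmem]
    refine hl _ ?_
    rw [Fin.val_rev]
    omega

end

end LNN

/-- The qubits of the line are `0, …, k - 1`; the controls `C` and the target `t` are arbitrary. The
circuit acts as the multi-controlled `X` gate on all `k` qubits, for every input, so that the
remaining `k - n - 1` qubits are returned to their (arbitrary) initial state. None of the
subtractions is truncated, since `5 ≤ n`. -/
theorem mainTheorem5 (n k : ℕ) (hn : 5 ≤ n) (hk : n + 2 ≤ k)
    (C : Finset (Fin k)) (hC : C.card = n) (t : Fin k) (ht : t ∉ C) :
    ∃ c : LNN.Circuit k, c.IsLNN ∧ c.op = LNN.mcx C t ∧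
      c.cost LNN.Gate.isCNOT ≤ 8 * k + 14 * n - 34 ∧
      c.depth LNN.Gate.isCNOT ≤ 8 * k + 5 * n + 1 ∧
      c.cost LNN.Gate.isT ≤ 16 * n - 16 ∧
      c.depth LNN.Gate.isT ≤ 4 * n + 4 ∧
      c.cost LNN.Gate.isH ≤ 8 * n + 4 ∧
      c.depth LNN.Gate.isH ≤ 4 * n + 3 := by
  have h := LNN.realizable_mcx hn hk (S := insert t C)
    (by rw [Finset.card_insert_of_notMem ht, hC]) (Finset.mem_insert_self t C)
  rwa [Finset.erase_insert ht] at h
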